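/- Let $T>0$, $d,D\ge 0$ integers, $S_0\in\mathbb R^d$, and let $\Omega\in\mathbb R^{D\times D}$ be positive semidefinite. Consider $$dS_i=a_i(S,t)\,dt+\sum_{j=1}^D b_{ij}(S,t)\,dW_j,\qquad S(0)=S_0,\qquad t\in[0,T],$$ where $W$ is a $D$-dimensional Brownian motion with correlation matrix $\Omega$ ($W(t)$ has covariance $t\,\Omega$), and put $h_{ijk}=\frac12\sum_{l=1}^d b_{lk}\,\partial b_{ij}/\partial x_l$. Assume that for $t\in[0,T]$ the functions $a_i(\cdot,t)$, $b_{ij}(\cdot,t)$ are $C^2$ with first and second derivatives bounded uniformly in $(x,t)$, that the first derivatives in $x$ of the $h_{ijk}(\cdot,t)$ are bounded uniformly in $(x,t)$, and that each $f\in\{a_i,b_{ij},h_{ijk}\}$ satisfies $|f(x,t)-f(x,s)|\le L(1+\|x\|)|t-s|$ for $s,t\in[0,T]$ (automatic in the autonomous case). Let $$D^f_i(x,t,h,w)=a_i(x,t)h+\sum_j b_{ij}(x,t)w_j+\sum_{j,k}h_{ijk}(x,t)\,(w_jw_k-\Omega_{jk}h).$$ Fix an integer $M\ge2$. For $N\ge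 1$ put $\Delta t=T/N$, $\delta t=\Delta t/M$, let $\delta W_{n+m/M}=W((nM+m+1)\delta t)-W((nM+m)\delta t)$ for $0\le m<M$, $\Delta W_n=\sum_{m=0}^{M-1}\delta W_{n+m/M}$, $t_{n+m/M}=(nM+m)\delta t$, $t_n=n\Delta t$, and define, from the common initial value $S_0$, the fine, antithetic and coarse paths $$S^f_{n+\frac{m+1}M}=S^f_{n+\frac mM}+D^f\big(S^f_{n+\frac mM},t_{n+\frac mM},\delta t,\delta W_{n+\frac mM}\big),$$ $$S^a_{n+\frac{m+1}M}=S^a_{n+\frac mM}+D^f\big(S^a_{n+\frac mM},t_{n+\frac mM},\delta t,\delta W_{n+\frac{M-1-m}M}\big),$$ $$S^c_{n+1}=S^c_n+D^f(S^c_n,t_n,\Delta t,\Delta W_n),$$ and $\bar S^f_n=\frac12(S^f_n+S^a_n)$. (1) For every real $p\ge2$ there is a constant $C$, independent of $N$, such that for all $N\ge1$ $$\mathbb E\Big[\max_{0\le n\le N}\|\bar S^f_n-S^c_n\|^p\Big]\le C\,\Delta t^p .$$ (2) Let $P:\mathbb R^d\to\mathbb R$ be $C^2$ with bounded first and second derivatives,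 and let $h_l=TM^{-l}$. For $l\ge1$ take $\delta t=h_l$, $\Delta t=h_{l-1}$, let $P^f_l=\frac12\big(P(S^f)+P(S^a)\big)$ and $P^c_l=P(S^c)$ at time $T$, and let $V_l=\mathrm{Var}[P^f_l-P^c_l]$. Then $P^f_l-P^c_l$ is square integrable and there is a constant $C$ with $V_l\le C\,h_l^2$ for all $l\ge1$. (3) For $P$ as in (2), let $P(S_{h_l}(T))$ be the payoff of the scheme $S_{k+1}=S_k+D^f(S_k,kh_l,h_l,W((k+1)h_l)-W(kh_l))$ with step $h_l$, and let $V_0=\mathrm{Var}[P(S_{h_0}(T))]$. For every $c_1>0$ there is a constant $K$ such that the following holds. Suppose that the scheme has weak order one for $P$ with constant $c_1$, i.e. $|\mathbb E[P(S_{h_l}(T))]-\mathbb E[P(S(T))]|\le c_1h_l$ for all $l\ge0$, where $S$ is a weak solution of the SDE (a solution of its martingale problem). For $0<\varepsilon\le1$ let $L=\max\big(0,\lceil\log(\sqrt2\,c_1T/\varepsilon)/\log M\rceil\big)$ and $$N_l=\max\Big(1,\Big\lceil \tfrac{2}{\varepsilon^2}\sqrt{V_lh_l}\sum_{k=0}^L\sqrt{V_k/h_k}\Big\rceil\Big),\qquad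 0\le l\le L.$$ Let $\hat P_L=\sum_{l=0}^L\frac1{N_l}\sum_{r=1}^{N_l}Y_l^{(r)}$, where the $Y_l^{(r)}$ are sampled from independent Brownian motions (independent over both $l$ and $r$) and are copies of $P(S_{h_0}(T))$ for $l=0$ and of $P^f_l-P^c_l$ for $l\ge1$. Then $\hat P_L$ is square integrable, it has RMS error at most $\varepsilon$, i.e. $\mathbb E\big[(\hat P_L-\mathbb E[P(S(T))])^2\big]\le\varepsilon^2$, and its cost, measured by the number of time steps up to the constant factor $T$, satisfies $$\sum_{l=0}^L N_l\,(2h_l^{-1}+h_{l-1}^{-1})\le K\,\varepsilon^{-2},\qquad h_{-1}=TM .$$ -/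

import Mathlib

open MeasureTheory ProbabilityTheory
open scoped NNReal

noncomputable section

namespace MLMC

/-- Column vectors in `ℝⁿ` with the Euclidean norm. -/
abbrev Vec (n : ℕ) : Type := EuclideanSpace ℝ (Fin n)

/-- The data of the system `dS_i = a_i(S,t) dt + ∑_j b_ij(S,t) dW_j`, `S(0) = init`, on the time
interval `[0, T]`, where `W` is a `D`-dimensional Brownian motion with correlation matrix `corr`,
i.e. `W(t)` has covariance matrix `t • corr`. -/
structure SDE (d D : ℕ) where
  a : Fin d → Vec d → ℝ → ℝ
  b : Fin d → Fin D → Vec d → ℝ → ℝ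
  corr : Matrix (Fin D) (Fin D) ℝ
  init : Vec d
  T : ℝ

/-- `f` is twice continuously differentiable, with first and second derivatives bounded by `L`
(`f` itself need not be bounded). -/
def HasTwoBoundedDerivs {d : ℕ} (L : ℝ) (f : Vec d → ℝ) : Prop :=
  ContDiff ℝ 2 f ∧ ∀ x, ‖fderiv ℝ f x‖ ≤ L ∧ ‖iteratedFDeriv ℝ 2 f x‖ ≤ L

/-- `f(x, t)` is Lipschitz in `t ∈ [0, T]`, with a constant that may grow linearly in `x`. -/
def LipschitzInTime {d : ℕ} (T L : ℝ) (f : Vec d → ℝ → ℝ) : Prop :=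
  ∀ x, ∀ s ∈ Set.Icc 0 T, ∀ t ∈ Set.Icc 0 T, |f x t - f x s| ≤ L * (1 + ‖x‖) * |t - s|

section Coefficients

variable {d D : ℕ} (E : SDE d D)

/-- `h_ijk = (1/2) ∑_l b_lk ∂b_ij/∂x_l`. -/
def SDE.hCoeff (i : Fin d) (j k : Fin D) (x : Vec d) (t : ℝ) : ℝ :=
  (1 / 2) * ∑ l, E.b l k x t *
    fderiv ℝ (fun y => E.b i j y t) x (EuclideanSpace.single l (1 : ℝ))

/-- Regularity of the coefficients: on `[0, T]`, the `a_i` and `b_ij` are `C²` in space with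
bounded first and second derivatives, the `h_ijk` have bounded first derivatives in space, and
all of them are Lipschitz in time. -/
def SDE.Regular : Prop :=
  ∃ L : ℝ,
    (∀ i, LipschitzInTime E.T L (E.a i)) ∧
    (∀ i j, LipschitzInTime E.T L (E.b i j)) ∧
    (∀ i j k, LipschitzInTime E.T L (E.hCoeff i j k)) ∧
    ∀ t ∈ Set.Icc 0 E.T,
      (∀ i, HasTwoBoundedDerivs L (fun x => E.a i x t)) ∧
      (∀ i j, HasTwoBoundedDerivs L (fun x => E.b i j x t)) ∧
      (∀ i j k x, ‖fderiv ℝ (fun y => E.hCoeff i j k y t) x‖ ≤ L)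

/-- The increment `D^f(x, t, h, w)` of the Milstein scheme with the Lévy areas set to zero. -/
def SDE.step (x : Vec d) (t h : ℝ) (w : Vec D) : Vec d :=
  WithLp.toLp 2 fun i =>
    E.a i x t * h + ∑ j, E.b i j x t * w j +
      ∑ j, ∑ k, E.hCoeff i j k x t * (w j * w k - E.corr j k * h)

/-- The scheme with time step `h`, started at `init` at time `0` and driven by the sequence
`w 0, w 1, …` of increments. -/
def SDE.path (E : SDE d D) (h : ℝ) (w : ℕ → Vec D) : ℕ → Vec d
  | 0 => E.init
  | k + 1 => SDE.path E h w k + E.step (SDE.path E h w k) (k * h) h (w k)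

/-- Reverses the order inside each block of `M` consecutive increments: the increment with index
`n M + m`, `m < M`, becomes the one with index `n M + (M - 1 - m)`. -/
def reverseBlocks (M : ℕ) (w : ℕ → Vec D) (k : ℕ) : Vec D :=
  w (k / M * M + (M - 1 - k % M))

/-- The coarse increment `ΔW_n = ∑_{m < M} δW_{n M + m}`. -/
def sumBlocks (M : ℕ) (w : ℕ → Vec D) (n : ℕ) : Vec D :=
  ∑ m ∈ Finset.range M, w (n * M + m)

/-- The fine path `S^f_n` after `n` coarse steps, i.e. `n M` fine steps of length `δ`, driven by
the fine increments `w`. -/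
def SDE.fine (M : ℕ) (δ : ℝ) (w : ℕ → Vec D) (n : ℕ) : Vec d :=
  E.path δ w (n * M)

/-- The antithetic path `S^a_n`: the fine path with the `M` increments in each coarse step taken
in reversed order. -/
def SDE.anti (M : ℕ) (δ : ℝ) (w : ℕ → Vec D) (n : ℕ) : Vec d :=
  E.path δ (reverseBlocks M w) (n * M)

/-- The coarse path `S^c_n`, with time step `M δ`. -/
def SDE.coarse (M : ℕ) (δ : ℝ) (w : ℕ → Vec D) (n : ℕ) : Vec d :=
  E.path (M * δ) (sumBlocks M w) n

/-- The averaged fine path `(S^f_n + S^a_n) / 2`. -/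
def SDE.avg (M : ℕ) (δ : ℝ) (w : ℕ → Vec D) (n : ℕ) : Vec d :=
  (1 / 2 : ℝ) • (E.fine M δ w n + E.anti M δ w n)

/-- `max_{n ≤ N} ‖S̄^f_n - S^c_n‖ ^ p`. -/
def SDE.maxDev (M : ℕ) (δ p : ℝ) (N : ℕ) (w : ℕ → Vec D) : ℝ :=
  (Finset.range (N + 1)).sup' Finset.nonempty_range_add_one
    (fun n => ‖E.avg M δ w n - E.coarse M δ w n‖ ^ p)

/-- The time step `h_l = T M^{-l}` of level `l`. -/
def SDE.h (M l : ℕ) : ℝ := E.T / (M : ℝ) ^ l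

/-- The payoff correction sampled at level `l` from the increments `w` of step `h_l`: it is
`P(S_{h_0}(T))` for `l = 0` and `(P(S^f) + P(S^a)) / 2 - P(S^c)` at time `T` for `l ≥ 1`. -/
def SDE.correction (M : ℕ) (P : Vec d → ℝ) (l : ℕ) (w : ℕ → Vec D) : ℝ :=
  match l with
  | 0 => P (E.path (E.h M 0) w 1)
  | l + 1 =>
      (P (E.fine M (E.h M (l + 1)) w (M ^ l)) + P (E.anti M (E.h M (l + 1)) w (M ^ l))) / 2
        - P (E.coarse M (E.h M (l + 1)) w (M ^ l))

end Coefficients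

section Probability

variable {Ω : Type*} [MeasurableSpace Ω] {d D : ℕ}

/-- `W` is a `D`-dimensional Brownian motion with correlation matrix `R`. -/
structure IsBrownian (R : Matrix (Fin D) (Fin D) ℝ) (μ : Measure Ω)
    (W : ℝ≥0 → Ω → Vec D) : Prop where
  measurable : ∀ t, Measurable (W t)
  start : ∀ᵐ ω ∂μ, W 0 ω = 0
  indep : HasIndepIncrements W μ
  law : ∀ s t, s ≤ t →
    μ.map (fun ω => W t ω - W s ω) = multivariateGaussian 0 (((t : ℝ) - (s : ℝ)) • R)
  continuous : ∀ᵐ ω ∂μ, Continuous fun t => W t ω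

/-- The increments `W((k+1)h) - W(kh)`, `k = 0, 1, …`. -/
def increments (W : ℝ≥0 → Ω → Vec D) (h : ℝ) (ω : Ω) (k : ℕ) : Vec D :=
  W (((k : ℝ) + 1) * h).toNNReal ω - W ((k : ℝ) * h).toNNReal ω

variable (E : SDE d D)

/-- The generator at time `t`,
`∑_i a_i ∂_i f + (1/2) ∑_{i,k} (b corr bᵀ)_{ik} ∂_i ∂_k f`. -/
def SDE.generator (f : Vec d → ℝ) (t : ℝ) (x : Vec d) : ℝ :=
  ∑ i, E.a i x t * fderiv ℝ f x (EuclideanSpace.single i (1 : ℝ)) +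
    (1 / 2) * ∑ i, ∑ k, (∑ j, ∑ m, E.b i j x t * E.corr j m * E.b k m x t) *
      iteratedFDeriv ℝ 2 f x
        ![EuclideanSpace.single i (1 : ℝ), EuclideanSpace.single k (1 : ℝ)]

/-- `S` is a (weak) solution of the SDE on `[0, T]`: it has continuous paths, starts at `init` and
solves the associated martingale problem. -/
def SDE.IsSolution (μ : Measure Ω) (S : ℝ → Ω → Vec d) : Prop :=
  (∀ᵐ ω ∂μ, S 0 ω = E.init) ∧
  (∀ᵐ ω ∂μ, ContinuousOn (fun t => S t ω) (Set.Icc 0 E.T)) ∧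
  ∃ F : Filtration (Set.Icc (0 : ℝ) E.T) (inferInstance : MeasurableSpace Ω),
    (∀ t : Set.Icc (0 : ℝ) E.T, Measurable[F t] (S t)) ∧
    ∀ f : Vec d → ℝ, ContDiff ℝ ((⊤ : ℕ∞) : WithTop ℕ∞) f → HasCompactSupport f →
      Martingale (fun (t : Set.Icc (0 : ℝ) E.T) ω =>
        f (S t ω) - f (S 0 ω) - ∫ s in (0 : ℝ)..t, E.generator f s (S s ω)) F μ

/-- The random payoff correction of level `l`, sampled from the path `W`. -/
def SDE.sample (M : ℕ) (P : Vec d → ℝ) (l : ℕ) (W : ℝ≥0 → Ω → Vec D) (ω : Ω) : ℝ :=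
  E.correction M P l (increments W (E.h M l) ω)

/-- `V_l`, the variance of the level-`l` correction. -/
def SDE.V (M : ℕ) (P : Vec d → ℝ) (μ : Measure Ω) (l : ℕ) (W : ℝ≥0 → Ω → Vec D) : ℝ :=
  Var[E.sample M P l W; μ]

/-- The payoff `P(S_{h_l}(T))` of the scheme with time step `h_l`. -/
def SDE.payoff (M : ℕ) (P : Vec d → ℝ) (l : ℕ) (W : ℝ≥0 → Ω → Vec D) (ω : Ω) : ℝ :=
  P (E.path (E.h M l) (increments W (E.h M l) ω) (M ^ l))

/-- The finest level `L = ⌈log(√2 c₁ T / ε) / log M⌉` (and `0` if this is negative). -/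
def SDE.finestLevel (M : ℕ) (c₁ ε : ℝ) : ℕ :=
  ⌈Real.log (Real.sqrt 2 * c₁ * E.T / ε) / Real.log M⌉₊

/-- The sample numbers `N_l = ⌈(2/ε²) √(V_l h_l) ∑_{k ≤ L} √(V_k / h_k)⌉`, at least one per
level, for given level variances `V`. -/
def SDE.numSamples (M : ℕ) (V : ℕ → ℝ) (ε : ℝ) (L l : ℕ) : ℕ :=
  max 1 ⌈2 / ε ^ 2 * Real.sqrt (V l * E.h M l) *
    ∑ k ∈ Finset.range (L + 1), Real.sqrt (V k / E.h M k)⌉₊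

/-- The sample numbers above, for the finest level and the level variances of the scheme; all
samples of level `l` have the same variance, that of sample `0`. -/
def SDE.samples (M : ℕ) (P : Vec d → ℝ) (c₁ ε : ℝ) (μ : Measure Ω)
    (W : ℕ → ℕ → ℝ≥0 → Ω → Vec D) : ℕ → ℕ :=
  E.numSamples M (fun l => E.V M P μ l (W l 0)) ε (E.finestLevel M c₁ ε)

/-- The multilevel estimator `∑_{l ≤ L} (1/N_l) ∑_{r < N_l} (correction of sample r at level l)`;
sample `r` of level `l` is computed from the path `W l r`. -/
def SDE.estimator (M : ℕ) (P : Vec d → ℝ) (L : ℕ) (N : ℕ → ℕ)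
    (W : ℕ → ℕ → ℝ≥0 → Ω → Vec D) (ω : Ω) : ℝ :=
  ∑ l ∈ Finset.range (L + 1),
    (1 / (N l : ℝ)) * ∑ r ∈ Finset.range (N l), E.sample M P l (W l r) ω

/-- The computational cost `∑_{l ≤ L} N_l (2 h_l⁻¹ + h_{l-1}⁻¹)`, where `h_{l-1} = M h_l`. A sample
at level `l ≥ 1` takes `T / h_l` time steps for each of the fine and the antithetic path, and
`T / h_{l-1}` for the coarse path. -/
def SDE.cost (M L : ℕ) (N : ℕ → ℕ) : ℝ :=
  ∑ l ∈ Finset.range (L + 1), (N l : ℝ) * (2 * (E.h M l)⁻¹ + (M * E.h M l)⁻¹)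

end Probability

end MLMC

end

set_option linter.unusedSectionVars false
set_option linter.unusedSimpArgs false

/-! Everything is estimated on a canonical space of independent standardized Gaussian vectors; the
increments of a Brownian motion with step `h` have the law of these vectors times `√h`. Sizes are
counted in powers of `rootMesh N = N ^ (-1/2)`, in all moments at once (`BigO`): an increment has
order 1, a time step order 2, and orders add under products.

Expand the fine path over one coarse step around the beginning of that step
(`SDE.finePt_expansion`). The result is one coarse step of the scheme started from the fine path,
plus three errors: a term with the discrete Lévy areas (order 2, centered), a drift remainder (order
4) and a martingale remainder (order 3, centered). A stability theorem
(`SDE.integral_partialSups_dev_le`), which combines a moment bound for martingales, Doob's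
inequality and a discrete Gronwall argument, turns errors of order `r + 2`, or of order `r + 1` when
centered, into order `r` for the maximal deviation. The Lévy areas therefore restrict the fine path
itself to `r = 1`, that is, to strong order one half.

Reversing the increments inside each block preserves their law and the coarse path, but changes the
sign of every Lévy area (`SDE.area_reverseBlocks`). In the average of the fine and antithetic paths
the areas survive only multiplied by the difference of a Lipschitz coefficient at the two paths,
which gains one order. Replacing the average of a smooth coefficient at two points by its value at
their midpoint costs the square of their distance, hence order 2. All centered errors thus have
order 3 and all drift errors order 4, so `r = 2` (`bigO_avg_sub_coarse`): this is (1).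

For (2), expanding `P` at the midpoint of the two fine paths bounds the correction by the square of
their distance plus the deviation of the average from the coarse path, both of order 2
(`bigO_payoff_correction`).

For (3), the expectations of the corrections telescope to that of the finest level. The mean square
error is variance plus squared bias; the sample numbers make the first at most `ε² / 2` and the
finest level does the same for the second. Since `V_l ≤ C h_l²`, the sum of the `√(V_l / h_l)` is
bounded by a geometric series, so the cost is of order `ε⁻²`. -/

noncomputable section

namespace MLMC

/-! ### Calculus of orders of magnitude in all moments. -/

section Moments

variable {Ω : Type*} [MeasurableSpace Ω] {μ : Measure Ω}
  {F : Type*} [NormedAddCommGroup F] [MeasurableSpace F] [BorelSpace F]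
  {G : Type*} [NormedAddCommGroup G] [MeasurableSpace G] [BorelSpace G]

/-- `f` is measurable and all its absolute moments are finite. -/
def AllMoments (μ : Measure Ω) (f : Ω → F) : Prop :=
  Measurable f ∧ ∀ p : ℕ, Integrable (fun ω => ‖f ω‖ ^ p) μ

theorem AllMoments.of_le {f : Ω → F} {g : Ω → G} (hf : AllMoments μ f) (hg : Measurable g)
    (K : ℝ) (h : ∀ ω, ‖g ω‖ ≤ K * ‖f ω‖) : AllMoments μ g := by
  refine ⟨hg, fun p => ((hf.2 p).const_mul (K ^ p)).mono' (hg.norm.pow_const p).aestronglyMeasurable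
    (Filter.Eventually.of_forall fun ω => ?_)⟩
  rw [Real.norm_of_nonneg (by positivity), ← mul_pow]
  exact pow_le_pow_left₀ (norm_nonneg _) (h ω) p

theorem AllMoments.add [SecondCountableTopology F] {f g : Ω → F} (hf : AllMoments μ f)
    (hg : AllMoments μ g) : AllMoments μ (fun ω => f ω + g ω) := by
  refine ⟨hf.1.add hg.1, fun p => (((hf.2 p).add (hg.2 p)).const_mul (2 ^ (p - 1))).mono'
    ((hf.1.add hg.1).norm.pow_const p).aestronglyMeasurable
    (Filter.Eventually.of_forall fun ω => ?_)⟩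
  rw [Real.norm_of_nonneg (by positivity)]
  exact (pow_le_pow_left₀ (norm_nonneg _) (norm_add_le _ _) p).trans
    (add_pow_le (norm_nonneg _) (norm_nonneg _) p)

/-- Finiteness of all moments is asked for because only this is stable under products: the moment of
order `p` of a product uses those of order `2 p` of the factors. -/
theorem AllMoments.mul {f g : Ω → ℝ} (hf : AllMoments μ f)
    (hg : AllMoments μ g) : AllMoments μ (fun ω => f ω * g ω) := by
  refine ⟨hf.1.mul hg.1, fun p => ((hf.2 (2 * p)).add (hg.2 (2 * p))).mono'
    ((hf.1.mul hg.1).norm.pow_const p).aestronglyMeasurable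
    (Filter.Eventually.of_forall fun ω => ?_)⟩
  rw [Real.norm_of_nonneg (by positivity), norm_mul, mul_pow]
  simp only [Pi.add_apply]
  rw [mul_comm 2 p, pow_mul, pow_mul]
  nlinarith [sq_nonneg (‖f ω‖ ^ p - ‖g ω‖ ^ p), sq_nonneg (‖f ω‖ ^ p), sq_nonneg (‖g ω‖ ^ p)]

theorem allMoments_const [IsFiniteMeasure μ] (c : F) : AllMoments μ (fun _ => c) :=
  ⟨measurable_const, fun _ => integrable_const _⟩

theorem AllMoments.neg {f : Ω → ℝ} (hf : AllMoments μ f) : AllMoments μ (fun ω => -f ω) :=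
  hf.of_le hf.1.neg 1 (by simp)

theorem AllMoments.sub {f g : Ω → ℝ} (hf : AllMoments μ f) (hg : AllMoments μ g) :
    AllMoments μ (fun ω => f ω - g ω) := by
  simpa [sub_eq_add_neg] using hf.add hg.neg

theorem AllMoments.const_mul {f : Ω → ℝ} (hf : AllMoments μ f) (c : ℝ) :
    AllMoments μ (fun ω => c * f ω) :=
  hf.of_le (hf.1.const_mul c) |c| (by simp [abs_mul])

theorem AllMoments.sum [IsFiniteMeasure μ] [SecondCountableTopology F] {κ : Type*} (s : Finset κ)
    {f : κ → Ω → F} (hf : ∀ k ∈ s, AllMoments μ (f k)) :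
    AllMoments μ (fun ω => ∑ k ∈ s, f k ω) := by
  classical
  induction s using Finset.induction_on with
  | empty => simpa using allMoments_const (0 : F)
  | insert a s ha ih =>
    simp only [Finset.sum_insert ha]
    exact (hf a (by simp)).add (ih fun k hk => hf k (by simp [hk]))

theorem AllMoments.pow [IsFiniteMeasure μ] {f : Ω → ℝ} (hf : AllMoments μ f) (n : ℕ) :
    AllMoments μ (fun ω => f ω ^ n) := by
  induction n with
  | zero => simpa using allMoments_const (1 : ℝ)
  | succ n ih => simpa [pow_succ] using ih.mul hf

theorem AllMoments.norm {f : Ω → F} (hf : AllMoments μ f) : AllMoments μ (fun ω => ‖f ω‖) :=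
  hf.of_le hf.1.norm 1 (by simp)

theorem AllMoments.abs {f : Ω → ℝ} (hf : AllMoments μ f) : AllMoments μ (fun ω => |f ω|) :=
  hf.norm

theorem AllMoments.max {f g : Ω → ℝ} (hf : AllMoments μ f) (hg : AllMoments μ g) :
    AllMoments μ (fun ω => max (f ω) (g ω)) := by
  refine (hf.abs.add hg.abs).of_le (hf.1.max hg.1) 1 fun ω => ?_
  simp only [Real.norm_eq_abs, one_mul]
  rw [abs_of_nonneg (add_nonneg (abs_nonneg (f ω)) (abs_nonneg (g ω)))]
  rcases max_cases (f ω) (g ω) with ⟨h, -⟩ | ⟨h, -⟩ <;> rw [h]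
  · exact le_add_of_nonneg_right (abs_nonneg _)
  · exact le_add_of_nonneg_left (abs_nonneg _)

theorem AllMoments.integrable {f : Ω → ℝ} (hf : AllMoments μ f) : Integrable f μ := by
  have := hf.2 1
  simp only [pow_one] at this
  exact (integrable_norm_iff hf.1.aestronglyMeasurable).1 this

theorem AllMoments.comp {Ω' : Type*} [MeasurableSpace Ω'] {μ' : Measure Ω'} {f : Ω → F}
    (hf : AllMoments μ f) {φ : Ω' → Ω} (hφ : MeasurePreserving φ μ' μ) :
    AllMoments μ' (fun ω => f (φ ω)) :=
  ⟨hf.1.comp hφ.measurable, fun p =>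
    (hφ.integrable_comp (hf.1.norm.pow_const p).aestronglyMeasurable).2 (hf.2 p)⟩

/-- The `p`-th absolute moments of the family `X` are at most of the order of the `p`-th power of
`η ^ r`, for every `p`. -/
def BigO {ι : Type*} (μ : Measure Ω) (η : ι → ℝ) (r : ℕ) (X : ι → Ω → F) : Prop :=
  ∃ C : ℕ → ℝ, ∀ i, AllMoments μ (X i) ∧ ∀ p : ℕ, ∫ ω, ‖X i ω‖ ^ p ∂μ ≤ C p * (η i ^ r) ^ p

variable {ι : Type*} {η : ι → ℝ} {r s : ℕ}

theorem BigO.allMoments {X : ι → Ω → F} (h : BigO μ η r X) (i : ι) : AllMoments μ (X i) := by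
  obtain ⟨C, hC⟩ := h
  exact (hC i).1

theorem BigO.of_le_scaled {X : ι → Ω → F} {Y : ι → Ω → G} (h : BigO μ η r X)
    (hη : ∀ i, 0 ≤ η i) (hY : ∀ i, Measurable (Y i)) (K : ℝ)
    (hK : ∀ i ω, ‖Y i ω‖ ≤ K * η i ^ s * ‖X i ω‖) : BigO μ η (r + s) Y := by
  obtain ⟨C, hC⟩ := h
  refine ⟨fun p => |K| ^ p * C p, fun i => ⟨(hC i).1.of_le (hY i) (K * η i ^ s) (hK i),
    fun p => ?_⟩⟩
  have h0 := (hC i).1.of_le (hY i) (K * η i ^ s) (hK i)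
  have hi := hη i
  calc ∫ ω, ‖Y i ω‖ ^ p ∂μ ≤ ∫ ω, (|K| * η i ^ s) ^ p * ‖X i ω‖ ^ p ∂μ := by
        refine integral_mono (h0.2 p) (((hC i).1.2 p).const_mul _) fun ω => ?_
        simp only
        rw [← mul_pow]
        refine pow_le_pow_left₀ (norm_nonneg _) ((hK i ω).trans ?_) p
        gcongr
        exact le_abs_self K
    _ = (|K| * η i ^ s) ^ p * ∫ ω, ‖X i ω‖ ^ p ∂μ := integral_const_mul _ _
    _ ≤ (|K| * η i ^ s) ^ p * (C p * (η i ^ r) ^ p) := by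
        gcongr
        exact (hC i).2 p
    _ = _ := by rw [pow_add]; ring

theorem BigO.of_le {X : ι → Ω → F} {Y : ι → Ω → G} (h : BigO μ η r X)
    (hη : ∀ i, 0 ≤ η i) (hY : ∀ i, Measurable (Y i)) (K : ℝ)
    (hK : ∀ i ω, ‖Y i ω‖ ≤ K * ‖X i ω‖) : BigO μ η r Y :=
  h.of_le_scaled (s := 0) hη hY K (by simpa using hK)

theorem BigO.add [SecondCountableTopology F] {X Y : ι → Ω → F} (hX : BigO μ η r X)
    (hY : BigO μ η r Y) : BigO μ η r (fun i ω => X i ω + Y i ω) := by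
  obtain ⟨C, hC⟩ := hX
  obtain ⟨C', hC'⟩ := hY
  refine ⟨fun p => 2 ^ (p - 1) * (C p + C' p), fun i => ⟨(hC i).1.add (hC' i).1, fun p => ?_⟩⟩
  calc ∫ ω, ‖X i ω + Y i ω‖ ^ p ∂μ
      ≤ ∫ ω, 2 ^ (p - 1) * (‖X i ω‖ ^ p + ‖Y i ω‖ ^ p) ∂μ := by
        refine integral_mono (((hC i).1.add (hC' i).1).2 p)
          ((((hC i).1.2 p).add ((hC' i).1.2 p)).const_mul _) fun ω => ?_
        exact (pow_le_pow_left₀ (norm_nonneg _) (norm_add_le _ _) p).trans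
          (add_pow_le (norm_nonneg _) (norm_nonneg _) p)
    _ = 2 ^ (p - 1) * (∫ ω, ‖X i ω‖ ^ p ∂μ + ∫ ω, ‖Y i ω‖ ^ p ∂μ) := by
        rw [integral_const_mul, integral_add ((hC i).1.2 p) ((hC' i).1.2 p)]
    _ ≤ 2 ^ (p - 1) * (C p * (η i ^ r) ^ p + C' p * (η i ^ r) ^ p) := by
        gcongr
        · exact (hC i).2 p
        · exact (hC' i).2 p
    _ = _ := by ring

theorem bigO_const [IsProbabilityMeasure μ] {c : ι → F} (K : ℝ) (hη : ∀ i, 0 ≤ η i)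
    (h : ∀ i, ‖c i‖ ≤ K * η i ^ r) : BigO μ η r (fun i (_ : Ω) => c i) := by
  refine ⟨fun p => |K| ^ p, fun i => ⟨allMoments_const _, fun p => ?_⟩⟩
  simp only [integral_const, probReal_univ, smul_eq_mul, one_mul, ← mul_pow]
  have := hη i
  refine pow_le_pow_left₀ (norm_nonneg _) ((h i).trans ?_) p
  gcongr
  exact le_abs_self K

theorem BigO.mul {X Y : ι → Ω → ℝ} (hη : ∀ i, 0 < η i) (hX : BigO μ η r X)
    (hY : BigO μ η s Y) : BigO μ η (r + s) (fun i ω => X i ω * Y i ω) := by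
  obtain ⟨C, hC⟩ := hX
  obtain ⟨C', hC'⟩ := hY
  refine ⟨fun p => C (2 * p) + C' (2 * p), fun i => ⟨(hC i).1.mul (hC' i).1, fun p => ?_⟩⟩
  have hi := hη i
  set a := (η i ^ r) ^ p with ha
  set b := (η i ^ s) ^ p with hb
  have ha0 : 0 < a := by positivity
  have hb0 : 0 < b := by positivity
  have h1 : (η i ^ r) ^ (2 * p) = a ^ 2 := by rw [ha]; ring
  have h2 : (η i ^ s) ^ (2 * p) = b ^ 2 := by rw [hb]; ring
  have e1 := (hC i).2 (2 * p)
  have e2 := (hC' i).2 (2 * p)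
  rw [h1] at e1
  rw [h2] at e2
  -- Young's inequality with weights `b / a` and `a / b`, chosen so that both terms come out of size
  -- `a * b`. This is why `η` has to be strictly positive.
  calc ∫ ω, ‖X i ω * Y i ω‖ ^ p ∂μ
      ≤ ∫ ω, ((b / a) * ‖X i ω‖ ^ (2 * p) + (a / b) * ‖Y i ω‖ ^ (2 * p)) ∂μ := by
        refine integral_mono (((hC i).1.mul (hC' i).1).2 p)
          ((((hC i).1.2 _).const_mul _).add (((hC' i).1.2 _).const_mul _)) fun ω => ?_
        simp only
        rw [norm_mul, mul_pow, mul_comm 2 p, pow_mul, pow_mul]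
        set x := ‖X i ω‖ ^ p
        set y := ‖Y i ω‖ ^ p
        have hx : 0 ≤ x := by positivity
        have hy : 0 ≤ y := by positivity
        rw [div_mul_eq_mul_div, div_mul_eq_mul_div, div_add_div _ _ ha0.ne' hb0.ne',
          le_div_iff₀ (by positivity)]
        nlinarith [sq_nonneg (b * x - a * y), sq_nonneg (b * x), sq_nonneg (a * y)]
    _ = (b / a) * ∫ ω, ‖X i ω‖ ^ (2 * p) ∂μ + (a / b) * ∫ ω, ‖Y i ω‖ ^ (2 * p) ∂μ := by
        rw [integral_add (((hC i).1.2 _).const_mul _) (((hC' i).1.2 _).const_mul _),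
          integral_const_mul, integral_const_mul]
    _ ≤ (b / a) * (C (2 * p) * a ^ 2) + (a / b) * (C' (2 * p) * b ^ 2) := by gcongr
    _ = _ := by
        rw [pow_add, mul_pow, ← ha, ← hb]
        field_simp

theorem BigO.sum [IsProbabilityMeasure μ] [SecondCountableTopology F] {κ : Type*} (t : Finset κ)
    (hη : ∀ i, 0 ≤ η i) {X : κ → ι → Ω → F} (h : ∀ k ∈ t, BigO μ η r (X k)) :
    BigO μ η r (fun i ω => ∑ k ∈ t, X k i ω) := by
  classical
  induction t using Finset.induction_on with
  | empty => simpa using bigO_const (c := fun _ : ι => (0 : F)) (r := r) 0 hη (by simp)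
  | insert a t ha ih =>
    simp only [Finset.sum_insert ha]
    exact (h a (by simp)).add (ih fun k hk => h k (by simp [hk]))

theorem BigO.mono {X : ι → Ω → F} (h : BigO μ η r X) (hη : ∀ i, 0 ≤ η i) (hη1 : ∀ i, η i ≤ 1)
    (hs : s ≤ r) : BigO μ η s X := by
  obtain ⟨C, hC⟩ := h
  refine ⟨fun p => |C p|, fun i => ⟨(hC i).1, fun p => ((hC i).2 p).trans ?_⟩⟩
  have := hη i
  refine mul_le_mul (le_abs_self _) ?_ (by positivity) (abs_nonneg _)
  exact pow_le_pow_left₀ (by positivity) (pow_le_pow_of_le_one this (hη1 i) hs) p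

theorem BigO.const_mul {X : ι → Ω → ℝ} (h : BigO μ η r X) (hη : ∀ i, 0 ≤ η i) (c : ℝ) :
    BigO μ η r (fun i ω => c * X i ω) :=
  h.of_le hη (fun i => (h.allMoments i).1.const_mul c) |c| (by simp [abs_mul])

theorem BigO.neg {X : ι → Ω → ℝ} (h : BigO μ η r X) (hη : ∀ i, 0 ≤ η i) :
    BigO μ η r (fun i ω => -X i ω) := by
  simpa using h.const_mul hη (-1)

theorem BigO.norm {X : ι → Ω → F} (h : BigO μ η r X) (hη : ∀ i, 0 ≤ η i) :
    BigO μ η r (fun i ω => ‖X i ω‖) :=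
  h.of_le hη (fun i => (h.allMoments i).1.norm) 1 (by simp)

theorem BigO.comp {Ω' : Type*} [MeasurableSpace Ω'] {μ' : Measure Ω'} {X : ι → Ω → F}
    (h : BigO μ η r X) {φ : Ω' → Ω} (hφ : MeasurePreserving φ μ' μ) :
    BigO μ' η r (fun i ω => X i (φ ω)) := by
  obtain ⟨C, hC⟩ := h
  refine ⟨C, fun i => ⟨(hC i).1.comp hφ, fun p => le_of_eq_of_le ?_ ((hC i).2 p)⟩⟩
  rw [← hφ.map_eq, integral_map hφ.measurable.aemeasurable]
  rw [hφ.map_eq]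
  exact ((hC i).1.2 p).1

theorem BigO.reindex {κ : Type*} {X : ι → Ω → F} (h : BigO μ η r X) (g : κ → ι) :
    BigO μ (fun k => η (g k)) r (fun k => X (g k)) := by
  obtain ⟨C, hC⟩ := h
  exact ⟨C, fun k => hC (g k)⟩

end Moments

/-! ### Elementary inequalities for powers, running maxima and recursions. -/

section Inequalities

/-- The remainder satisfies `R (n + 1) = (1 + t) R n + n t²`, and `2 * 4 ^ n + 4 ^ n ≤ 4 ^ (n + 1)`.
-/
theorem abs_one_add_pow_sub_le (n : ℕ) (t : ℝ) (ht : |t| ≤ 1) :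
    |(1 + t) ^ n - 1 - n * t| ≤ 4 ^ n * t ^ 2 := by
  induction n with
  | zero => simp; positivity
  | succ n ih =>
    have e : (1 + t) ^ (n + 1) - 1 - ((n + 1 : ℕ) : ℝ) * t
        = (1 + t) * ((1 + t) ^ n - 1 - n * t) + n * t ^ 2 := by push_cast; ring
    have h1 : |1 + t| ≤ 2 := by
      rw [abs_le] at ht ⊢
      constructor <;> linarith
    have h2 : (n : ℝ) ≤ 4 ^ n := by
      exact_mod_cast (Nat.lt_pow_self (by norm_num : 1 < 4)).le
    rw [e]
    refine (abs_add_le _ _).trans ?_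
    rw [abs_mul, abs_of_nonneg (by positivity : (0 : ℝ) ≤ n * t ^ 2)]
    have h3 : |1 + t| * |(1 + t) ^ n - 1 - n * t| ≤ 2 * (4 ^ n * t ^ 2) :=
      mul_le_mul h1 ih (abs_nonneg _) (by norm_num)
    have h4 : (n : ℝ) * t ^ 2 ≤ 4 ^ n * t ^ 2 := by gcongr
    have h5 : (0 : ℝ) ≤ 4 ^ n * t ^ 2 := by positivity
    rw [pow_succ (4 : ℝ)]
    linarith

/-- For a martingale `x` with increment `y` the linear term integrates to zero and only quadratic
and higher terms remain. If `|y| < |x|`, expand in `y / x`; otherwise the left side and the possibly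
negative linear term are dominated by multiples of `y ^ (2 * (q + 1))`. -/
theorem pow_add_le_taylor (q : ℕ) (x y : ℝ) :
    (x + y) ^ (2 * (q + 1)) ≤ x ^ (2 * (q + 1)) + 2 * (q + 1) * x ^ (2 * q + 1) * y +
      (4 ^ (2 * (q + 1)) + 2 * (q + 1)) * (x ^ (2 * q) * y ^ 2 + y ^ (2 * (q + 1))) := by
  have hxx : 0 ≤ x ^ (2 * q) := by rw [pow_mul]; positivity
  have hyy : 0 ≤ y ^ (2 * (q + 1)) := by rw [pow_mul]; positivity
  have hx2 : 0 ≤ x ^ (2 * q) * y ^ 2 := by positivity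
  rcases lt_or_ge |y| |x| with h | h
  · have hx : x ≠ 0 := by
      rintro rfl
      simp only [abs_zero] at h
      exact absurd h (abs_nonneg y).not_gt
    have ht : |y / x| ≤ 1 := by
      rw [abs_div]
      exact div_le_one_of_le₀ h.le (abs_nonneg _)
    have key := (abs_le.1 (abs_one_add_pow_sub_le (2 * (q + 1)) (y / x) ht)).2
    have hp : 0 ≤ x ^ (2 * (q + 1)) := by rw [pow_mul]; positivity
    have e1 : (x + y) ^ (2 * (q + 1)) = x ^ (2 * (q + 1)) * (1 + y / x) ^ (2 * (q + 1)) := by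
      rw [← mul_pow]
      congr 1
      field_simp
    have e2 : x ^ (2 * (q + 1)) * (1 + ((2 * (q + 1) : ℕ) : ℝ) * (y / x) +
        4 ^ (2 * (q + 1)) * (y / x) ^ 2) = x ^ (2 * (q + 1)) + 2 * (q + 1) * x ^ (2 * q + 1) * y +
        4 ^ (2 * (q + 1)) * (x ^ (2 * q) * y ^ 2) := by
      rw [show 2 * (q + 1) = 2 * q + 1 + 1 by ring, pow_succ x (2 * q + 1), pow_succ x (2 * q)]
      push_cast
      field_simp
      ring
    rw [e1]
    have h6 : (1 + y / x) ^ (2 * (q + 1)) ≤ 1 + ((2 * (q + 1) : ℕ) : ℝ) * (y / x) +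
        4 ^ (2 * (q + 1)) * (y / x) ^ 2 := by linarith
    have h7 := mul_le_mul_of_nonneg_left h6 hp
    rw [e2] at h7
    have h8 : 0 ≤ (2 * ((q : ℝ) + 1)) * (x ^ (2 * q) * y ^ 2 + y ^ (2 * (q + 1))) := by positivity
    have h9 : 0 ≤ (4 : ℝ) ^ (2 * (q + 1)) * y ^ (2 * (q + 1)) := by positivity
    linarith
  · have ey : y ^ (2 * (q + 1)) = |y| ^ (2 * (q + 1)) := by rw [pow_mul, pow_mul, sq_abs]
    have h1 : (x + y) ^ (2 * (q + 1)) ≤ 4 ^ (2 * (q + 1)) * y ^ (2 * (q + 1)) := by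
      rw [ey, ← mul_pow, pow_mul, pow_mul, ← sq_abs (x + y)]
      refine pow_le_pow_left₀ (by positivity) (pow_le_pow_left₀ (abs_nonneg _) ?_ 2) _
      have := abs_add_le x y
      have := abs_nonneg y
      linarith
    have h2 : -(2 * (q + 1) * x ^ (2 * q + 1) * y) ≤ 2 * (q + 1) * y ^ (2 * (q + 1)) := by
      have : -(x ^ (2 * q + 1) * y) ≤ y ^ (2 * (q + 1)) := by
        refine (neg_le_abs _).trans ?_
        rw [ey, abs_mul, abs_pow, show 2 * (q + 1) = 2 * q + 1 + 1 by ring, pow_succ |y|]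
        gcongr
      have h3 : (0 : ℝ) ≤ 2 * (q + 1) := by positivity
      nlinarith
    have h4 : 0 ≤ x ^ (2 * (q + 1)) := by rw [pow_mul]; positivity
    have h5 : 0 ≤ (4 ^ (2 * (q + 1)) + 2 * ((q : ℝ) + 1)) * (x ^ (2 * q) * y ^ 2) := by positivity
    linarith

/-- Convexity of an even power, via Bernoulli's inequality in `y / x`; below `-2` the tangent is
negative. It makes even powers of a martingale submartingales. -/
theorem pow_add_ge_tangent (q : ℕ) (x y : ℝ) :
    x ^ (2 * (q + 1)) + 2 * (q + 1) * x ^ (2 * q + 1) * y ≤ (x + y) ^ (2 * (q + 1)) := by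
  rcases eq_or_ne x 0 with rfl | hx
  · simp only [ne_eq, Nat.mul_eq_zero, OfNat.ofNat_ne_zero, Nat.add_eq_zero_iff, one_ne_zero,
      and_false, or_self, not_false_eq_true, zero_pow, zero_add]
    simp only [pow_mul, ne_eq, Nat.add_eq_zero_iff, one_ne_zero, and_false, not_false_eq_true,
      zero_pow, mul_zero, zero_mul]
    positivity
  · have key : 1 + ((2 * (q + 1) : ℕ) : ℝ) * (y / x) ≤ (1 + y / x) ^ (2 * (q + 1)) := by
      rcases le_or_gt (-2) (y / x) with h | h
      · exact one_add_mul_le_pow h _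
      · have h0 : 0 ≤ (1 + y / x) ^ (2 * (q + 1)) := by rw [pow_mul]; positivity
        refine le_trans ?_ h0
        push_cast
        nlinarith
    have hp : 0 ≤ x ^ (2 * (q + 1)) := by rw [pow_mul]; positivity
    have e1 : (x + y) ^ (2 * (q + 1)) = x ^ (2 * (q + 1)) * (1 + y / x) ^ (2 * (q + 1)) := by
      rw [← mul_pow]
      congr 1
      field_simp
    rw [e1]
    refine le_trans (le_of_eq ?_) (mul_le_mul_of_nonneg_left key hp)
    rw [show 2 * (q + 1) = 2 * q + 1 + 1 by ring, pow_succ x (2 * q + 1)]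
    push_cast
    field_simp
    ring

theorem pow_mul_le_pow_add_pow (q : ℕ) {a b : ℝ} (ha : 0 ≤ a) (hb : 0 ≤ b) :
    a ^ q * b ≤ a ^ (q + 1) + b ^ (q + 1) := by
  rcases le_total a b with h | h
  · have : a ^ q * b ≤ b ^ q * b := by gcongr
    rw [pow_succ b]
    have : 0 ≤ a ^ (q + 1) := by positivity
    linarith
  · have : a ^ q * b ≤ a ^ q * a := by gcongr
    rw [pow_succ a]
    have : 0 ≤ b ^ (q + 1) := by positivity
    linarith

/-- Summation by parts: the running maximum increases only when `s` sits at it. This is a pathwise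
form of Doob's inequality, where the sum on the left is a discrete stochastic integral. -/
theorem sum_partialSups_mul_sub_le (s : ℕ → ℝ) (n : ℕ) :
    ∑ k ∈ Finset.range n, partialSups s k * (s (k + 1) - s k) ≤
      partialSups s n * s n - partialSups s n ^ 2 / 2 - s 0 ^ 2 / 2 := by
  induction n with
  | zero => simp; linarith
  | succ n ih =>
    rw [Finset.sum_range_succ, partialSups_add_one]
    rcases le_total (s (n + 1)) (partialSups s n) with h | h
    · rw [sup_eq_left.2 h]
      nlinarith
    · rw [sup_eq_right.2 h]
      nlinarith [sq_nonneg (s (n + 1) - partialSups s n)]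

theorem le_of_discrete_gronwall {φ : ℕ → ℝ} {a b : ℝ} (hb : 0 ≤ b) {N : ℕ}
    (h : ∀ n ≤ N, φ n ≤ a + b * ∑ k ∈ Finset.range n, φ k) :
    ∀ n ≤ N, φ n ≤ a * (1 + b) ^ n := by
  -- The induction bounds the right side of the hypothesis, which grows by `b * φ n` at each step,
  -- rather than `φ` itself.
  have key : ∀ n ≤ N, a + b * ∑ k ∈ Finset.range n, φ k ≤ a * (1 + b) ^ n := by
    intro n
    induction n with
    | zero => simp
    | succ n ih =>
      intro hn
      have h1 := ih (by omega)
      have h2 := h n (by omega)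
      rw [Finset.sum_range_succ, pow_succ]
      nlinarith
  exact fun n hn => (h n hn).trans (key n hn)

theorem one_add_div_pow_le_exp {b : ℝ} (hb : 0 ≤ b) {n N : ℕ} (hN : 1 ≤ N) (hn : n ≤ N) :
    (1 + b / N) ^ n ≤ Real.exp b := by
  have hN' : (0 : ℝ) < N := by exact_mod_cast hN
  have h0 : 0 ≤ b / N := by positivity
  calc (1 + b / N) ^ n ≤ (1 + b / N) ^ N := pow_le_pow_right₀ (by linarith) hn
    _ ≤ Real.exp (b / N) ^ N := by
        refine pow_le_pow_left₀ (by linarith) ?_ N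
        rw [add_comm]
        exact Real.add_one_le_exp _
    _ = Real.exp b := by
        rw [← Real.exp_nat_mul]
        congr 1
        field_simp

end Inequalities

/-! ### Moment and maximal inequalities for discrete martingales. -/

section Martingales

variable {A : Type*} [MeasurableSpace A] {ν : Measure (ℕ → A)} [IsProbabilityMeasure ν]

/-- `v` is orthogonal to every function of the first `k` coordinates with finite moments. -/
def Centered (ν : Measure (ℕ → A)) (k : ℕ) (v : (ℕ → A) → ℝ) : Prop :=
  ∀ X : (ℕ → A) → ℝ, AllMoments ν X → DependsOn X (Set.Iio k) → ∫ ω, X ω * v ω ∂ν = 0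

theorem Centered.add {k : ℕ} {v w : (ℕ → A) → ℝ} (hv : Centered ν k v) (hw : Centered ν k w)
    (mv : AllMoments ν v) (mw : AllMoments ν w) : Centered ν k (fun ω => v ω + w ω) := by
  intro X hX hd
  simp only [mul_add]
  rw [integral_add (hX.mul mv).integrable (hX.mul mw).integrable, hv X hX hd, hw X hX hd, add_zero]

theorem Centered.const_mul {k : ℕ} {v : (ℕ → A) → ℝ} (hv : Centered ν k v) (c : ℝ) :
    Centered ν k (fun ω => c * v ω) := by
  intro X hX hd
  simp only [mul_left_comm _ c]
  rw [integral_const_mul, hv X hX hd, mul_zero]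

theorem Centered.sum {κ : Type*} (s : Finset κ) {k : ℕ} {v : κ → (ℕ → A) → ℝ}
    (hv : ∀ i ∈ s, Centered ν k (v i)) (mv : ∀ i ∈ s, AllMoments ν (v i)) :
    Centered ν k (fun ω => ∑ i ∈ s, v i ω) := by
  intro X hX hd
  simp only [Finset.mul_sum]
  rw [integral_finsetSum _ fun i hi => (hX.mul (mv i hi)).integrable]
  exact Finset.sum_eq_zero fun i hi => hv i hi X hX hd

theorem dependsOn_sum {κ : Type*} (s : Finset κ) {S : Set ℕ} {v : κ → (ℕ → A) → ℝ}
    (hv : ∀ i ∈ s, DependsOn (v i) S) : DependsOn (fun ω => ∑ i ∈ s, v i ω) S :=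
  fun _ _ h => Finset.sum_congr rfl fun i hi => hv i hi h

theorem dependsOn_partial_sum {N : ℕ} {τ : ℕ → ℕ} (hτ : Monotone τ) {v : ℕ → (ℕ → A) → ℝ}
    (hd : ∀ k < N, DependsOn (v k) (Set.Iio (τ (k + 1)))) {n : ℕ} (hn : n ≤ N) :
    DependsOn (fun ω => ∑ k ∈ Finset.range n, v k ω) (Set.Iio (τ n)) := by
  refine dependsOn_sum _ fun k hk => ?_
  have hk' := Finset.mem_range.1 hk
  exact (hd k (by omega)).mono (Set.Iio_subset_Iio (hτ (by omega)))

/-- A crude form of Burkholder's inequality. The linear term of `pow_add_le_taylor` has mean zero,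
so one step multiplies the moment by `1 + c / N` and adds a multiple of `N ^ q` times the moment of
the increment. For increments of size `N ^ (-1/2)` the `N` added terms sum to a bounded quantity,
which is the square root gain over the triangle inequality. The function `τ` lets a single step
consume a whole block of coordinates. -/
theorem integral_sum_pow_le (q : ℕ) {N : ℕ} (hN : 1 ≤ N) {τ : ℕ → ℕ} (hτ : Monotone τ)
    {v : ℕ → (ℕ → A) → ℝ} (hm : ∀ k < N, AllMoments ν (v k))
    (hd : ∀ k < N, DependsOn (v k) (Set.Iio (τ (k + 1))))
    (hc : ∀ k < N, Centered ν (τ k) (v k)) (n : ℕ) (hn : n ≤ N) :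
    ∫ ω, (∑ k ∈ Finset.range n, v k ω) ^ (2 * (q + 1)) ∂ν ≤
      (1 + (4 ^ (2 * (q + 1)) + 2 * ((q : ℝ) + 1)) / N) ^ n *
        (2 * (4 ^ (2 * (q + 1)) + 2 * ((q : ℝ) + 1)) * (N : ℝ) ^ q) *
        ∑ k ∈ Finset.range n, ∫ ω, v k ω ^ (2 * (q + 1)) ∂ν := by
  set c : ℝ := 4 ^ (2 * (q + 1)) + 2 * ((q : ℝ) + 1) with hc0
  have hcpos : 0 < c := by positivity
  have hN' : (1 : ℝ) ≤ N := by exact_mod_cast hN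
  induction n with
  | zero => simp
  | succ n ih =>
    have ih' := ih (by omega)
    set S : (ℕ → A) → ℝ := fun ω => ∑ k ∈ Finset.range n, v k ω with hS
    have mS : AllMoments ν S := AllMoments.sum _ fun k hk =>
      hm k (by have := Finset.mem_range.1 hk; omega)
    have mv := hm n (by omega)
    have dS : DependsOn S (Set.Iio (τ n)) := dependsOn_partial_sum hτ hd (by omega)
    have hz : ∫ ω, (2 * ((q : ℝ) + 1) * S ω ^ (2 * q + 1)) * v n ω ∂ν = 0 :=
      hc n (by omega) _ ((mS.pow _).const_mul _) fun x y h => by simp only [dS h]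
    have hpt : ∀ ω, (S ω + v n ω) ^ (2 * (q + 1)) ≤ (2 * ((q : ℝ) + 1) * S ω ^ (2 * q + 1)) * v n ω
        + ((1 + c / N) * S ω ^ (2 * (q + 1)) + 2 * c * N ^ q * v n ω ^ (2 * (q + 1))) := by
      intro ω
      have h1 := pow_add_le_taylor q (S ω) (v n ω)
      rw [← hc0] at h1
      -- Weighting the increment by `N` before Young's inequality and dividing by `N` afterwards
      -- puts the factor `1 / N` on the moment of `S`, as Gronwall requires.
      have h2 := pow_mul_le_pow_add_pow q (sq_nonneg (S ω))
        (mul_nonneg (by positivity : (0 : ℝ) ≤ N) (sq_nonneg (v n ω)))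
      rw [mul_pow, ← pow_mul, ← pow_mul, ← pow_mul] at h2
      have h3 : S ω ^ (2 * q) * v n ω ^ 2 ≤
          S ω ^ (2 * (q + 1)) / N + (N : ℝ) ^ q * v n ω ^ (2 * (q + 1)) := by
        rw [← sub_nonneg]
        have : 0 ≤ (S ω ^ (2 * (q + 1)) + (N : ℝ) ^ (q + 1) * v n ω ^ (2 * (q + 1)) -
          S ω ^ (2 * q) * (N * v n ω ^ 2)) / N := div_nonneg (by linarith) (by linarith)
        refine this.trans (le_of_eq ?_)
        field_simp
        ring
      have h4 : v n ω ^ (2 * (q + 1)) ≤ (N : ℝ) ^ q * v n ω ^ (2 * (q + 1)) := by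
        refine le_mul_of_one_le_left ?_ (one_le_pow₀ hN')
        rw [pow_mul]; positivity
      have h5 : c * (S ω ^ (2 * q) * v n ω ^ 2 + v n ω ^ (2 * (q + 1))) ≤
          c * (S ω ^ (2 * (q + 1)) / N + (N : ℝ) ^ q * v n ω ^ (2 * (q + 1)) +
            (N : ℝ) ^ q * v n ω ^ (2 * (q + 1))) :=
        mul_le_mul_of_nonneg_left (add_le_add h3 h4) hcpos.le
      calc _ ≤ _ := h1
        _ ≤ _ := add_le_add le_rfl h5
        _ = _ := by ring
    have mp := (mS.pow (2 * (q + 1)))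
    have mvp := (mv.pow (2 * (q + 1)))
    have hi1 := ((((mS.pow (2 * q + 1)).const_mul (2 * ((q : ℝ) + 1))).mul mv)).integrable
    have hi2 := (mp.const_mul (1 + c / N)).integrable
    have hi3 := (mvp.const_mul (2 * c * N ^ q)).integrable
    have hstep : ∫ ω, (S ω + v n ω) ^ (2 * (q + 1)) ∂ν ≤
        (1 + c / N) * ∫ ω, S ω ^ (2 * (q + 1)) ∂ν +
          2 * c * N ^ q * ∫ ω, v n ω ^ (2 * (q + 1)) ∂ν := by
      refine (integral_mono ((mS.add mv).pow _).integrable (hi1.add (hi2.add hi3)) hpt).trans ?_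
      rw [integral_add' hi1 (hi2.add hi3), integral_add' hi2 hi3, hz, zero_add, integral_const_mul,
        integral_const_mul]
    simp only [Finset.sum_range_succ]
    refine hstep.trans ?_
    have hge : 1 ≤ (1 + c / N) ^ (n + 1) := one_le_pow₀ (by
      have : 0 ≤ c / N := by positivity
      linarith)
    have hvn : 0 ≤ ∫ ω, v n ω ^ (2 * (q + 1)) ∂ν := integral_nonneg fun ω => by
      simp only [pow_mul]; positivity
    calc _ ≤ (1 + c / N) * ((1 + c / N) ^ n * (2 * c * N ^ q) *
            ∑ k ∈ Finset.range n, ∫ ω, v k ω ^ (2 * (q + 1)) ∂ν) +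
          (1 + c / N) ^ (n + 1) * (2 * c * N ^ q * ∫ ω, v n ω ^ (2 * (q + 1)) ∂ν) := by
          refine add_le_add (mul_le_mul_of_nonneg_left ih' (by positivity))
            (le_mul_of_one_le_left (by positivity) hge)
      _ = _ := by ring

theorem allMoments_partialSups {s : ℕ → (ℕ → A) → ℝ} (n : ℕ)
    (h : ∀ k ≤ n, AllMoments ν (s k)) :
    AllMoments ν (fun ω => partialSups (fun k => s k ω) n) := by
  induction n with
  | zero => simpa using h 0 le_rfl
  | succ n ih =>
    simp only [partialSups_add_one]
    exact (ih fun k hk => h k (by omega)).max (h (n + 1) le_rfl)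

theorem dependsOn_partialSups {s : ℕ → (ℕ → A) → ℝ} (n : ℕ) {S : Set ℕ}
    (h : ∀ k ≤ n, DependsOn (s k) S) :
    DependsOn (fun ω => partialSups (fun k => s k ω) n) S := by
  induction n with
  | zero => simpa using h 0 le_rfl
  | succ n ih =>
    intro x y hxy
    simp only [partialSups_add_one]
    have h1 := ih (fun k hk => h k (by omega)) hxy
    simp only at h1
    rw [h1, h (n + 1) le_rfl hxy]

/-- Doob's maximal inequality for the even powers of a martingale. -/
theorem integral_partialSups_sq_le (q : ℕ) {N : ℕ} {τ : ℕ → ℕ} (hτ : Monotone τ)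
    {v : ℕ → (ℕ → A) → ℝ} (hm : ∀ k < N, AllMoments ν (v k))
    (hd : ∀ k < N, DependsOn (v k) (Set.Iio (τ (k + 1))))
    (hc : ∀ k < N, Centered ν (τ k) (v k)) (n : ℕ) (hn : n ≤ N) :
    ∫ ω, partialSups (fun m => (∑ k ∈ Finset.range m, v k ω) ^ (2 * (q + 1))) n ^ 2 ∂ν ≤
      4 * ∫ ω, (∑ k ∈ Finset.range n, v k ω) ^ (4 * (q + 1)) ∂ν := by
  set S : ℕ → (ℕ → A) → ℝ := fun m ω => ∑ k ∈ Finset.range m, v k ω with hS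
  set s : ℕ → (ℕ → A) → ℝ := fun m ω => S m ω ^ (2 * (q + 1)) with hs
  set P : ℕ → (ℕ → A) → ℝ := fun m ω => partialSups (fun j => s j ω) m with hP
  have mS : ∀ m ≤ N, AllMoments ν (S m) := fun m hm' => AllMoments.sum _ fun k hk =>
    hm k (by have := Finset.mem_range.1 hk; omega)
  have ms : ∀ m ≤ N, AllMoments ν (s m) := fun m hm' => (mS m hm').pow _
  have mP : ∀ m ≤ N, AllMoments ν (P m) := fun m hm' =>
    allMoments_partialSups m fun k hk => ms k (by omega)
  have dS : ∀ m ≤ N, DependsOn (S m) (Set.Iio (τ m)) := fun m hm' =>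
    dependsOn_partial_sum hτ hd hm'
  have ds : ∀ m ≤ N, DependsOn (s m) (Set.Iio (τ m)) := fun m hm' x y h => by
    simp only [hs, dS m hm' h]
  have dP : ∀ m ≤ N, DependsOn (P m) (Set.Iio (τ m)) := fun m hm' =>
    dependsOn_partialSups m fun k hk =>
      (ds k (by omega)).mono (Set.Iio_subset_Iio (hτ hk))
  have hPnn : ∀ m ω, 0 ≤ P m ω := fun m ω => by
    refine le_trans ?_ (le_partialSups_of_le (fun j => s j ω) (Nat.zero_le m))
    simp only [hs, pow_mul]; positivity
  -- Submartingale property of the even powers, tested against the nonnegative and adapted running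
  -- maximum: the tangent term has mean zero.
  have hsub : ∀ k < n, 0 ≤ ∫ ω, P k ω * (s (k + 1) ω - s k ω) ∂ν := by
    intro k hk
    have hz : ∫ ω, (P k ω * (2 * ((q : ℝ) + 1) * S k ω ^ (2 * q + 1))) * v k ω ∂ν = 0 := by
      refine hc k (by omega) _ ((mP k (by omega)).mul (((mS k (by omega)).pow _).const_mul _)) ?_
      intro x y h
      simp only [dP k (by omega) h, dS k (by omega) h]
    rw [← hz]
    refine integral_mono ((((mP k (by omega)).mul (((mS k (by omega)).pow _).const_mul _))).mul
      (hm k (by omega))).integrable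
      ((mP k (by omega)).mul ((ms (k + 1) (by omega)).sub (ms k (by omega)))).integrable
      fun ω => ?_
    have h1 := pow_add_ge_tangent q (S k ω) (v k ω)
    have h2 : S (k + 1) ω = S k ω + v k ω := Finset.sum_range_succ _ _
    simp only [hs, h2]
    rw [mul_assoc]
    exact mul_le_mul_of_nonneg_left (by linarith) (hPnn k ω)
  -- Summation by parts bounds `P² / 2` by `P s` minus the discrete integral; absorbing `P s ≤ P² /
  -- 4 + s²` gives the usual constant `4` of Doob's inequality in `L²`.
  have hpt : ∀ ω, P n ω ^ 2 ≤ 4 * S n ω ^ (4 * (q + 1)) -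
      4 * ∑ k ∈ Finset.range n, P k ω * (s (k + 1) ω - s k ω) := by
    intro ω
    have h1 := sum_partialSups_mul_sub_le (fun j => s j ω) n
    have h2 : S n ω ^ (4 * (q + 1)) = s n ω ^ 2 := by simp only [hs]; ring
    rw [h2]
    change ∑ k ∈ Finset.range n, P k ω * (s (k + 1) ω - s k ω) ≤
      P n ω * s n ω - P n ω ^ 2 / 2 - s 0 ω ^ 2 / 2 at h1
    nlinarith [sq_nonneg (P n ω - 2 * s n ω), sq_nonneg (s 0 ω)]
  have mterm : ∀ k ∈ Finset.range n, AllMoments ν (fun ω => P k ω * (s (k + 1) ω - s k ω)) :=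
    fun k hk => by
      have := Finset.mem_range.1 hk
      exact (mP k (by omega)).mul ((ms (k + 1) (by omega)).sub (ms k (by omega)))
  have i1 := (((mS n hn).pow (4 * (q + 1))).const_mul 4).integrable
  have i2 := ((AllMoments.sum _ mterm).const_mul 4).integrable
  refine (integral_mono ((mP n hn).pow 2).integrable (i1.sub i2) hpt).trans ?_
  rw [integral_sub' i1 i2, integral_const_mul, integral_const_mul,
    integral_finsetSum _ fun k hk => (mterm k hk).integrable]
  have := Finset.sum_nonneg fun k hk => hsub k (Finset.mem_range.1 hk)
  linarith

end Martingales

theorem abs_sum_pow_le {κ : Type*} (s : Finset κ) (f : κ → ℝ) (n : ℕ) :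
    |∑ i ∈ s, f i| ^ (n + 1) ≤ (s.card : ℝ) ^ n * ∑ i ∈ s, |f i| ^ (n + 1) := by
  refine (pow_le_pow_left₀ (abs_nonneg _) (Finset.abs_sum_le_sum_abs _ _) _).trans ?_
  rcases s.eq_empty_or_nonempty with rfl | hs
  · simp
  · have hc : (0 : ℝ) < s.card := by exact_mod_cast hs.card_pos
    have := pow_sum_div_card_le_sum_pow (s := s) (f := fun i => |f i|) (fun i _ => abs_nonneg _) n
    rwa [div_le_iff₀ (by positivity), mul_comm] at this

theorem norm_le_sum_abs {d : ℕ} (x : Vec d) : ‖x‖ ≤ ∑ i, |x i| := by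
  rw [EuclideanSpace.norm_eq]
  refine Real.sqrt_le_iff.2 ⟨Finset.sum_nonneg fun i _ => abs_nonneg _, ?_⟩
  simp only [Real.norm_eq_abs]
  exact Finset.sum_sq_le_sq_sum_of_nonneg fun i _ => abs_nonneg _

theorem abs_apply_le_norm {d : ℕ} (x : Vec d) (i : Fin d) : |x i| ≤ ‖x‖ := by
  simpa using PiLp.norm_apply_le x i

/-! ### Gronwall estimate in `L^p` for the maximum of a perturbed recursion. -/

section Stability

variable {A : Type*} [MeasurableSpace A] {ν : Measure (ℕ → A)} [IsProbabilityMeasure ν]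

/-- Discrete Gronwall inequality in `L^p`, `p = 4 (q + 1)`, for a recursion with a drift part `u`
and a martingale part `v`. -/
theorem integral_partialSups_norm_pow_le (q d : ℕ) {K : ℝ} (hK : 0 ≤ K) : ∃ C : ℝ,
    ∀ (N : ℕ), 1 ≤ N → ∀ (τ : ℕ → ℕ), Monotone τ → ∀ (e : ℕ → (ℕ → A) → Vec d)
      (u v : ℕ → Fin d → (ℕ → A) → ℝ) (ρ : ℝ), 0 ≤ ρ →
      (∀ k ≤ N, AllMoments ν (e k)) → (∀ k < N, ∀ i, AllMoments ν (u k i)) →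
      (∀ k < N, ∀ i, AllMoments ν (v k i)) →
      (∀ k < N, ∀ i, DependsOn (v k i) (Set.Iio (τ (k + 1)))) →
      (∀ k < N, ∀ i, Centered ν (τ k) (v k i)) →
      (∀ ω, e 0 ω = 0) →
      (∀ k < N, ∀ ω i, e (k + 1) ω i = e k ω i + u k i ω + v k i ω) →
      (∀ k < N, ∀ i, ∫ ω, |u k i ω| ^ (4 * (q + 1)) ∂ν ≤
        K / (N : ℝ) ^ (4 * (q + 1)) * (∫ ω, ‖e k ω‖ ^ (4 * (q + 1)) ∂ν + ρ)) →
      (∀ k < N, ∀ i, ∫ ω, |v k i ω| ^ (4 * (q + 1)) ∂ν ≤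
        K / (N : ℝ) ^ (2 * (q + 1)) * (∫ ω, ‖e k ω‖ ^ (4 * (q + 1)) ∂ν + ρ)) →
      ∫ ω, partialSups (fun k => ‖e k ω‖) N ^ (4 * (q + 1)) ∂ν ≤ C * ρ := by
  -- The constant of `integral_sum_pow_le` with `2 * q + 1` in place of `q`. The exponent is `4 * (q
  -- + 1)` because Doob's inequality is applied in `L²` to the powers `2 * (q + 1)`.
  set c : ℝ := 4 ^ (2 * ((2 * q + 1) + 1)) + 2 * (((2 * q + 1 : ℕ) : ℝ) + 1) with hc0
  set b : ℝ := Real.exp c * (2 * c) with hb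
  set B : ℝ := d ^ (4 * q + 3) * (d * (2 ^ (4 * q + 3) * (K + 4 * (b * K)))) with hB
  have hcp : 0 < c := by positivity
  have hbp : 0 < b := by positivity
  have hBp : 0 ≤ B := by positivity
  refine ⟨B * Real.exp B, ?_⟩
  intro N hN τ hτ e u v ρ hρ me mu mv dv cv e0 erec hu hv
  have hN' : (1 : ℝ) ≤ N := by exact_mod_cast hN
  have hNp : (0 : ℝ) < N := by linarith
  set φ : ℕ → ℝ := fun k => ∫ ω, ‖e k ω‖ ^ (4 * (q + 1)) ∂ν with hφ
  set Φ : ℕ → ℝ := fun n => ∫ ω, partialSups (fun k => ‖e k ω‖) n ^ (4 * (q + 1)) ∂ν with hΦ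
  have mmax : ∀ n ≤ N, AllMoments ν (fun ω => partialSups (fun k => ‖e k ω‖) n) := fun n hn =>
    allMoments_partialSups n fun k hk => (me k (by omega)).norm
  have hφΦ : ∀ n ≤ N, φ n ≤ Φ n := fun n hn => by
    refine integral_mono ((me n hn).norm.pow _).integrable ((mmax n hn).pow _).integrable fun ω => ?_
    exact pow_le_pow_left₀ (norm_nonneg _) (le_partialSups (fun k => ‖e k ω‖) n) _
  have hφ0 : ∀ n, 0 ≤ φ n := fun n => integral_nonneg fun ω => by positivity
  have esum : ∀ n ≤ N, ∀ ω i, e n ω i =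
      ∑ k ∈ Finset.range n, u k i ω + ∑ k ∈ Finset.range n, v k i ω := by
    intro n
    induction n with
    | zero => intro _ ω i; simp [e0 ω]
    | succ n ih =>
      intro hn ω i
      rw [erec n (by omega), ih (by omega), Finset.sum_range_succ, Finset.sum_range_succ]
      ring
  set P : Fin d → ℕ → (ℕ → A) → ℝ := fun i n ω =>
    partialSups (fun m => (∑ k ∈ Finset.range m, v k i ω) ^ (2 * (q + 1))) n with hP
  have mP : ∀ i, ∀ n ≤ N, AllMoments ν (P i n) := fun i n hn => by
    refine allMoments_partialSups (s := fun m ω => (∑ k ∈ Finset.range m, v k i ω) ^ (2 * (q + 1)))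
      n fun m hm => (AllMoments.sum _ fun k hk => mv k ?_ i).pow _
    have := Finset.mem_range.1 hk
    omega
  -- The maximum is attained at some `m ≤ n`. There the drift sum is bounded by Hölder's inequality,
  -- at the price `N ^ (4 * q + 3)`, and the martingale sum by its running maximum.
  have hpt : ∀ n ≤ N, ∀ ω, partialSups (fun k => ‖e k ω‖) n ^ (4 * (q + 1)) ≤
      d ^ (4 * q + 3) * ∑ i, 2 ^ (4 * q + 3) *
        ((N : ℝ) ^ (4 * q + 3) * ∑ k ∈ Finset.range n, |u k i ω| ^ (4 * (q + 1)) + P i n ω ^ 2) := by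
    intro n hn ω
    obtain ⟨m, hm, h⟩ := exists_partialSups_eq (fun k => ‖e k ω‖) n
    rw [h]
    have h1 : ‖e m ω‖ ≤ abs (∑ i, abs (e m ω i)) := (norm_le_sum_abs _).trans (le_abs_self _)
    refine (pow_le_pow_left₀ (norm_nonneg _) h1 _).trans ?_
    refine (abs_sum_pow_le Finset.univ (fun i => |e m ω i|) (4 * q + 3)).trans ?_
    simp only [Finset.card_univ, Fintype.card_fin, abs_abs]
    gcongr with i
    rw [esum m (by omega)]
    refine (pow_le_pow_left₀ (abs_nonneg _) (abs_add_le _ _) _).trans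
      ((add_pow_le (abs_nonneg _) (abs_nonneg _) _).trans ?_)
    rw [show 4 * q + 3 + 1 - 1 = 4 * q + 3 by omega]
    refine mul_le_mul_of_nonneg_left (add_le_add ?_ ?_) (by positivity)
    · refine (abs_sum_pow_le _ _ _).trans ?_
      rw [Finset.card_range]
      have : (m : ℝ) ≤ N := by exact_mod_cast hm.trans hn
      refine mul_le_mul (pow_le_pow_left₀ (by positivity) this _) ?_
        (Finset.sum_nonneg fun _ _ => by positivity) (by positivity)
      exact Finset.sum_le_sum_of_subset_of_nonneg (Finset.range_subset_range.2 hm)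
        fun _ _ _ => by positivity
    · have h2 : (∑ k ∈ Finset.range m, v k i ω) ^ (2 * (q + 1)) ≤ P i n ω :=
        le_partialSups_of_le (fun m => (∑ k ∈ Finset.range m, v k i ω) ^ (2 * (q + 1))) hm
      have h3 : |∑ k ∈ Finset.range m, v k i ω| ^ (4 * q + 3 + 1) =
          ((∑ k ∈ Finset.range m, v k i ω) ^ (2 * (q + 1))) ^ 2 := by
        rw [show 4 * q + 3 + 1 = 2 * (2 * (q + 1)) by ring, pow_mul, sq_abs, ← pow_mul, ← pow_mul,
          mul_comm 2]
      rw [h3]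
      refine pow_le_pow_left₀ ?_ h2 2
      rw [pow_mul]; positivity
  -- Both parts reduce to `1 / N` times a sum of `Φ k + ρ`: the powers `N ^ (4 * q + 3)` and `N ^ (2
  -- * q + 1)` lost in summation are each one short of those in the assumed bounds for `u` and `v`.
  have hstep : ∀ n ≤ N, Φ n ≤ B * ρ + B / N * ∑ k ∈ Finset.range n, Φ k := by
    intro n hn
    have mup : ∀ i, ∀ k ∈ Finset.range n, AllMoments ν (fun ω => |u k i ω| ^ (4 * (q + 1))) :=
      fun i k hk => ((mu k (by have := Finset.mem_range.1 hk; omega) i).abs).pow _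
    have m1 : ∀ i, AllMoments ν (fun ω => (N : ℝ) ^ (4 * q + 3) *
        ∑ k ∈ Finset.range n, |u k i ω| ^ (4 * (q + 1))) := fun i =>
      (AllMoments.sum _ (mup i)).const_mul _
    have m2 : ∀ i, AllMoments ν (fun ω => P i n ω ^ 2) := fun i => (mP i n hn).pow 2
    have m3 : ∀ i, AllMoments ν (fun ω => 2 ^ (4 * q + 3) *
        ((N : ℝ) ^ (4 * q + 3) * ∑ k ∈ Finset.range n, |u k i ω| ^ (4 * (q + 1)) + P i n ω ^ 2)) :=
      fun i => ((m1 i).add (m2 i)).const_mul _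
    have hsum0 : 0 ≤ ∑ k ∈ Finset.range n, (Φ k + ρ) := Finset.sum_nonneg fun k hk => by
      have := hφΦ k (by have := Finset.mem_range.1 hk; omega)
      have := hφ0 k
      linarith
    have hui : ∀ i, (N : ℝ) ^ (4 * q + 3) * ∑ k ∈ Finset.range n,
        ∫ ω, |u k i ω| ^ (4 * (q + 1)) ∂ν ≤ K / N * ∑ k ∈ Finset.range n, (Φ k + ρ) := by
      intro i
      have : ∑ k ∈ Finset.range n, ∫ ω, |u k i ω| ^ (4 * (q + 1)) ∂ν ≤
          ∑ k ∈ Finset.range n, K / (N : ℝ) ^ (4 * (q + 1)) * (Φ k + ρ) := by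
        refine Finset.sum_le_sum fun k hk => (hu k (by have := Finset.mem_range.1 hk; omega) i).trans ?_
        have := hφΦ k (by have := Finset.mem_range.1 hk; omega)
        gcongr
      refine (mul_le_mul_of_nonneg_left this (by positivity)).trans (le_of_eq ?_)
      rw [← Finset.mul_sum, ← mul_assoc]
      congr 1
      rw [show 4 * (q + 1) = 4 * q + 3 + 1 by ring, pow_succ]
      field_simp
      ring
    have hvi : ∀ i, ∫ ω, P i n ω ^ 2 ∂ν ≤
        4 * (b * K) / N * ∑ k ∈ Finset.range n, (Φ k + ρ) := by
      intro i
      refine (integral_partialSups_sq_le q hτ (fun k hk => mv k hk i) (fun k hk => dv k hk i)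
        (fun k hk => cv k hk i) n hn).trans ?_
      have h1 := integral_sum_pow_le (2 * q + 1) hN hτ (fun k hk => mv k hk i)
        (fun k hk => dv k hk i) (fun k hk => cv k hk i) n hn
      rw [← hc0] at h1
      simp only [show 2 * (2 * q + 1 + 1) = 4 * (q + 1) by ring] at h1
      have h2 : ∑ k ∈ Finset.range n, ∫ ω, v k i ω ^ (4 * (q + 1)) ∂ν ≤
          ∑ k ∈ Finset.range n, K / (N : ℝ) ^ (2 * (q + 1)) * (Φ k + ρ) := by
        refine Finset.sum_le_sum fun k hk => ?_
        have h3 := hv k (by have := Finset.mem_range.1 hk; omega) i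
        have h4 : ∀ ω, |v k i ω| ^ (4 * (q + 1)) = v k i ω ^ (4 * (q + 1)) := fun ω =>
          Even.pow_abs (by rw [show 4 * (q + 1) = 2 * (2 * (q + 1)) by ring]; exact even_two_mul _) _
        simp only [h4] at h3
        refine h3.trans ?_
        have := hφΦ k (by have := Finset.mem_range.1 hk; omega)
        gcongr
      have h5 : (1 + c / N) ^ n * (2 * c * (N : ℝ) ^ (2 * q + 1)) ≤ b * (N : ℝ) ^ (2 * q + 1) := by
        rw [hb, mul_assoc (Real.exp c)]
        gcongr
        exact one_add_div_pow_le_exp hcp.le hN hn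
      have h6 : 0 ≤ ∑ k ∈ Finset.range n, ∫ ω, v k i ω ^ (4 * (q + 1)) ∂ν :=
        Finset.sum_nonneg fun k _ => integral_nonneg fun ω => by
          rw [show 4 * (q + 1) = 2 * (2 * (q + 1)) by ring]
          simp only [pow_mul]; positivity
      calc _ ≤ 4 * (b * (N : ℝ) ^ (2 * q + 1) *
            ∑ k ∈ Finset.range n, K / (N : ℝ) ^ (2 * (q + 1)) * (Φ k + ρ)) := by
            refine mul_le_mul_of_nonneg_left (h1.trans ?_) (by norm_num)
            exact mul_le_mul h5 h2 h6 (by positivity)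
        _ = _ := by
            rw [← Finset.mul_sum, ← mul_assoc, ← mul_assoc]
            congr 1
            rw [show 2 * (q + 1) = 2 * q + 1 + 1 by ring, pow_succ (N : ℝ) (2 * q + 1)]
            field_simp
    have hint : Φ n ≤ d ^ (4 * q + 3) * ∑ i : Fin d, 2 ^ (4 * q + 3) *
        ((N : ℝ) ^ (4 * q + 3) * ∑ k ∈ Finset.range n, ∫ ω, |u k i ω| ^ (4 * (q + 1)) ∂ν +
          ∫ ω, P i n ω ^ 2 ∂ν) := by
      refine (integral_mono ((mmax n hn).pow _).integrable
        ((AllMoments.sum Finset.univ fun i _ => m3 i).const_mul _).integrable (hpt n hn)).trans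
        (le_of_eq ?_)
      rw [integral_const_mul, integral_finsetSum _ fun i _ => (m3 i).integrable]
      congr 1
      refine Finset.sum_congr rfl fun i _ => ?_
      rw [integral_const_mul, integral_add (m1 i).integrable (m2 i).integrable,
        integral_const_mul, integral_finsetSum _ fun k hk => (mup i k hk).integrable]
    refine hint.trans ?_
    calc _ ≤ (d : ℝ) ^ (4 * q + 3) * ∑ i : Fin d, 2 ^ (4 * q + 3) *
          (K / N * ∑ k ∈ Finset.range n, (Φ k + ρ) +
            4 * (b * K) / N * ∑ k ∈ Finset.range n, (Φ k + ρ)) := by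
          refine mul_le_mul_of_nonneg_left (Finset.sum_le_sum fun i _ =>
            mul_le_mul_of_nonneg_left (add_le_add (hui i) (hvi i)) ?_) ?_ <;> positivity
      _ = B / N * ∑ k ∈ Finset.range n, (Φ k + ρ) := by
          rw [Finset.sum_const, Finset.card_univ, Fintype.card_fin, nsmul_eq_mul, hB]
          ring
      _ = B * ρ * (n / N) + B / N * ∑ k ∈ Finset.range n, Φ k := by
          rw [Finset.sum_add_distrib, Finset.sum_const, Finset.card_range, nsmul_eq_mul]
          ring
      _ ≤ _ := by
          have : (n : ℝ) / N ≤ 1 := by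
            rw [div_le_one hNp]
            exact_mod_cast hn
          exact add_le_add (mul_le_of_le_one_right (by positivity) this) le_rfl
  refine (le_of_discrete_gronwall (by positivity) hstep N le_rfl).trans ?_
  have := one_add_div_pow_le_exp hBp hN le_rfl
  calc B * ρ * (1 + B / N) ^ N ≤ B * ρ * Real.exp B := by gcongr
    _ = _ := by ring

end Stability

/-! ### Independence of disjoint sets of coordinates under a product measure. -/

section Independence

variable {A : Type*} [MeasurableSpace A] [Nonempty A] {Q : ℕ → Measure A}
  [∀ n, IsProbabilityMeasure (Q n)]

theorem integral_mul_of_dependsOn {s t : Finset ℕ} (hst : Disjoint s t) {F G : (ℕ → A) → ℝ}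
    (mF : Measurable F) (mG : Measurable G) (dF : DependsOn F s) (dG : DependsOn G t) :
    ∫ ω, F ω * G ω ∂(Measure.infinitePi Q) =
      (∫ ω, F ω ∂(Measure.infinitePi Q)) * ∫ ω, G ω ∂(Measure.infinitePi Q) := by
  classical
  have hind : iIndepFun (fun (i : ℕ) (ω : ℕ → A) => ω i) (Measure.infinitePi Q) := by
    rw [iIndepFun_iff_map_fun_eq_infinitePi_map (fun i => measurable_pi_apply i)]
    simp only [Measure.infinitePi_map_eval, Measure.map_id']
  have h := hind.indepFun_finset s t hst (fun i => measurable_pi_apply i)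
  -- Filling the other coordinates with an arbitrary value exhibits `F` and `G` as measurable
  -- functions of finitely many coordinates.
  let ext (u : Finset ℕ) (y : u → A) (i : ℕ) : A :=
    if h : i ∈ u then y ⟨i, h⟩ else Classical.arbitrary A
  have mext : ∀ u : Finset ℕ, Measurable (ext u) := fun u => by
    refine measurable_pi_lambda _ fun i => ?_
    by_cases h : i ∈ u
    · simp only [ext, h, dite_true]
      exact measurable_pi_apply _
    · simp only [ext, h, dite_false]
      exact measurable_const
  have hF : F = (fun y => F (ext s y)) ∘ fun (ω : ℕ → A) (i : s) => ω i := by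
    funext ω
    refine dF fun i hi => ?_
    simp only [ext, Finset.mem_coe.1 hi, dite_true]
  have hG : G = (fun y => G (ext t y)) ∘ fun (ω : ℕ → A) (i : t) => ω i := by
    funext ω
    refine dG fun i hi => ?_
    simp only [ext, Finset.mem_coe.1 hi, dite_true]
  have hFG : IndepFun F G (Measure.infinitePi Q) := by
    rw [hF, hG]
    exact h.comp (mF.comp (mext s)) (mG.comp (mext t))
  exact hFG.integral_fun_mul_eq_mul_integral mF.aestronglyMeasurable mG.aestronglyMeasurable

theorem integral_mul_of_dependsOn_Iio_Ico {j l : ℕ} {F G : (ℕ → A) → ℝ}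
    (mF : Measurable F) (mG : Measurable G) (dF : DependsOn F (Set.Iio j))
    (dG : DependsOn G (Set.Ico j l)) :
    ∫ ω, F ω * G ω ∂(Measure.infinitePi Q) =
      (∫ ω, F ω ∂(Measure.infinitePi Q)) * ∫ ω, G ω ∂(Measure.infinitePi Q) := by
  refine integral_mul_of_dependsOn (s := Finset.range j) (t := Finset.Ico j l) ?_ mF mG
    (by simpa using dF) (by simpa using dG)
  rw [Finset.disjoint_left]
  intro a ha hb
  simp only [Finset.mem_range, Finset.mem_Ico] at ha hb
  omega

/-- The basic martingale increment: a factor known at time `j` times a mean-zero factor that uses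
only later coordinates. Allowing `k < j` makes increments inside a block centered with respect to
the start of the block. -/
theorem centered_mul {k j l : ℕ} (hkj : k ≤ j) {g ψ : (ℕ → A) → ℝ}
    (mg : AllMoments (Measure.infinitePi Q) g) (mψ : Measurable ψ) (dg : DependsOn g (Set.Iio j))
    (dψ : DependsOn ψ (Set.Ico j l)) (hψ : ∫ ω, ψ ω ∂(Measure.infinitePi Q) = 0) :
    Centered (Measure.infinitePi Q) k (fun ω => g ω * ψ ω) := by
  intro X hX hd
  simp only [← mul_assoc]
  rw [integral_mul_of_dependsOn_Iio_Ico (F := fun ω => X ω * g ω) (hX.1.mul mg.1) mψ ?_ dψ, hψ,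
    mul_zero]
  intro x y h
  simp only [dg h, hd.mono (Set.Iio_subset_Iio hkj) h]

/-- Independence splits the moment of a product without raising the exponent, unlike `BigO.mul`;
Gronwall's inequality needs the same exponent on both sides. -/
theorem integral_mul_pow_of_dependsOn {j l : ℕ} {g ψ : (ℕ → A) → ℝ}
    (mg : Measurable g) (mψ : Measurable ψ) (dg : DependsOn g (Set.Iio j))
    (dψ : DependsOn ψ (Set.Ico j l)) (p : ℕ) :
    ∫ ω, |g ω * ψ ω| ^ p ∂(Measure.infinitePi Q) =
      (∫ ω, |g ω| ^ p ∂(Measure.infinitePi Q)) * ∫ ω, |ψ ω| ^ p ∂(Measure.infinitePi Q) := by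
  simp only [abs_mul, mul_pow]
  refine integral_mul_of_dependsOn_Iio_Ico (j := j) (l := l) (mg.abs.pow_const p)
    (mψ.abs.pow_const p) ?_ ?_
  · exact fun x y h => by simp only [dg h]
  · exact fun x y h => by simp only [dψ h]

end Independence

/-! ### The canonical Gaussian noise and the noise terms of the scheme. -/

section Noise

variable {d D : ℕ}

/-- The law of a sequence of independent centered Gaussian vectors with covariance `R`. -/
def noiseLaw (R : Matrix (Fin D) (Fin D) ℝ) : Measure (ℕ → Vec D) :=
  Measure.infinitePi fun _ => multivariateGaussian 0 R

instance (R : Matrix (Fin D) (Fin D) ℝ) : IsProbabilityMeasure (noiseLaw R) := by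
  unfold noiseLaw; infer_instance

variable {R : Matrix (Fin D) (Fin D) ℝ}

theorem measurePreserving_eval_noiseLaw (k : ℕ) :
    MeasurePreserving (fun ω : ℕ → Vec D => ω k) (noiseLaw R) (multivariateGaussian 0 R) :=
  measurePreserving_eval_infinitePi _ k

theorem allMoments_multivariateGaussian :
    AllMoments (multivariateGaussian (0 : Vec D) R) (fun x => x) := by
  refine ⟨measurable_id, fun p => ?_⟩
  rcases Nat.eq_zero_or_pos p with rfl | hp
  · simp
  · have := (IsGaussian.memLp_id (multivariateGaussian (0 : Vec D) R) p (by simp)).integrable_norm_pow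
      hp.ne'
    simpa using this

theorem allMoments_eval (k : ℕ) : AllMoments (noiseLaw R) (fun ω => ω k) :=
  allMoments_multivariateGaussian.comp (measurePreserving_eval_noiseLaw k)

theorem bigO_eval {ι : Type*} (η : ι → ℝ) (κ : ι → ℕ) :
    BigO (noiseLaw R) η 0 (fun i ω => ω (κ i)) := by
  refine ⟨fun p => ∫ x, ‖x‖ ^ p ∂(multivariateGaussian (0 : Vec D) R), fun i =>
    ⟨allMoments_eval _, fun p => ?_⟩⟩
  simp only [pow_zero, one_pow, mul_one]
  rw [← (measurePreserving_eval_noiseLaw (R := R) (κ i)).map_eq,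
    integral_map (measurable_pi_apply _).aemeasurable (by fun_prop)]

theorem allMoments_coord (k : ℕ) (a : Fin D) : AllMoments (noiseLaw R) (fun ω => ω k a) :=
  (allMoments_eval k).of_le (by fun_prop) 1 fun ω => by
    simpa using abs_apply_le_norm (ω k) a

theorem integral_coord (k : ℕ) (a : Fin D) : ∫ ω, ω k a ∂(noiseLaw R) = 0 := by
  have h1 : ∫ x, x a ∂(multivariateGaussian (0 : Vec D) R) = 0 := by
    have := ContinuousLinearMap.integral_comp_comm (EuclideanSpace.proj (𝕜 := ℝ) a)
      (IsGaussian.integrable_fun_id (μ := multivariateGaussian (0 : Vec D) R))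
    simpa using this
  rw [← (measurePreserving_eval_noiseLaw (R := R) k).map_eq,
    integral_map (measurable_pi_apply _).aemeasurable (by fun_prop)] at h1
  exact h1

theorem integral_coord_mul (hR : R.PosSemidef) (k l : ℕ) (a b : Fin D) :
    ∫ ω, ω k a * ω l b ∂(noiseLaw R) = if k = l then R a b else 0 := by
  split_ifs with h
  · subst h
    have h1 := covariance_eval_multivariateGaussian (μ := (0 : Vec D)) hR a b
    have m : ∀ a : Fin D, AllMoments (multivariateGaussian (0 : Vec D) R) (fun x => x a) := fun a =>
      allMoments_multivariateGaussian.of_le (by fun_prop) 1 fun x => by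
        simpa using abs_apply_le_norm x a
    have h0 : ∀ a : Fin D, ∫ x, x a ∂(multivariateGaussian (0 : Vec D) R) = 0 := fun a => by
      have := ContinuousLinearMap.integral_comp_comm (EuclideanSpace.proj (𝕜 := ℝ) a)
        (IsGaussian.integrable_fun_id (μ := multivariateGaussian (0 : Vec D) R))
      simpa using this
    simp only [covariance, h0, sub_zero] at h1
    rw [← h1, ← (measurePreserving_eval_noiseLaw (R := R) k).map_eq,
      integral_map (measurable_pi_apply _).aemeasurable (by fun_prop)]
  · have := integral_mul_of_dependsOn (Q := fun _ => multivariateGaussian (0 : Vec D) R)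
      (s := {k}) (t := {l}) (by simpa using h) (F := fun ω => ω k a) (G := fun ω => ω l b)
      (by fun_prop) (by fun_prop) (fun x y h => by simp [h k (by simp)])
      (fun x y h => by simp [h l (by simp)])
    rw [noiseLaw, this]
    have h0 := integral_coord (R := R) k a
    rw [noiseLaw] at h0
    rw [h0, zero_mul]

/-- The sum of the `L` consecutive terms of `w` starting at index `j`. -/
def partialIncr (w : ℕ → Vec D) (j L : ℕ) : Vec D := ∑ m ∈ Finset.range L, w (j + m)

/-- The increments with time step `c` generated by a sequence of standardized ones. -/
def scaled (c : ℝ) (ω : ℕ → Vec D) (k : ℕ) : Vec D := Real.sqrt c • ω k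

theorem measurable_scaled (c : ℝ) : Measurable (scaled c : (ℕ → Vec D) → ℕ → Vec D) := by
  unfold scaled; fun_prop

theorem measurable_partialIncr_scaled (c : ℝ) (j L : ℕ) :
    Measurable (fun ω : ℕ → Vec D => partialIncr (scaled c ω) j L) := by
  unfold partialIncr scaled; fun_prop

theorem dependsOn_partialIncr_scaled (c : ℝ) (j L : ℕ) :
    DependsOn (fun ω : ℕ → Vec D => partialIncr (scaled c ω) j L) (Set.Ico j (j + L)) := by
  intro x y h
  refine Finset.sum_congr rfl fun m hm => ?_
  have := Finset.mem_range.1 hm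
  simp only [scaled, h (j + m) (by simp; omega)]

theorem bigO_partialIncr_scaled {ι : Type*} {η : ι → ℝ} (hη : ∀ i, 0 ≤ η i) {c : ι → ℝ} (K : ℝ)
    (hc : ∀ i, Real.sqrt (c i) ≤ K * η i) (j : ι → ℕ) (L : ℕ) :
    BigO (noiseLaw R) η 1 (fun i ω => partialIncr (scaled (c i) ω) (j i) L) := by
  refine BigO.sum _ hη (X := fun m i ω => scaled (c i) ω (j i + m)) fun m _ => ?_
  have h0 := bigO_eval (R := R) η (fun i => j i + m)
  have := h0.of_le_scaled (s := 1) (Y := fun i ω => scaled (c i) ω (j i + m)) hη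
    (fun i => (measurable_pi_apply _).comp (measurable_scaled _)) K fun i ω => ?_
  · simpa using this
  · rw [scaled, norm_smul, Real.norm_of_nonneg (Real.sqrt_nonneg _), pow_one]
    exact mul_le_mul_of_nonneg_right (hc i) (norm_nonneg _)

theorem bigO_partialIncr_scaled_apply {ι : Type*} {η : ι → ℝ} (hη : ∀ i, 0 ≤ η i) {c : ι → ℝ}
    (K : ℝ) (hc : ∀ i, Real.sqrt (c i) ≤ K * η i) (j : ι → ℕ) (L : ℕ) (a : Fin D) :
    BigO (noiseLaw R) η 1 (fun i ω => partialIncr (scaled (c i) ω) (j i) L a) :=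
  (bigO_partialIncr_scaled (R := R) hη K hc j L).of_le hη (fun i => by
    have := measurable_partialIncr_scaled (D := D) (c i) (j i) L
    fun_prop) 1 fun i ω => by
    simpa using abs_apply_le_norm (partialIncr (scaled (c i) ω) (j i) L) a

theorem integral_partialIncr_scaled (c : ℝ) (j L : ℕ) (a : Fin D) :
    ∫ ω, partialIncr (scaled c ω) j L a ∂(noiseLaw R) = 0 := by
  simp only [partialIncr, scaled, WithLp.ofLp_sum, Finset.sum_apply, PiLp.smul_apply, smul_eq_mul]
  rw [integral_finsetSum _ fun m _ => ((allMoments_coord _ _).const_mul _).integrable]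
  simp [integral_const_mul, integral_coord]

theorem integral_partialIncr_scaled_mul (hR : R.PosSemidef) {c : ℝ} (hc : 0 ≤ c) (j L : ℕ)
    (a b : Fin D) :
    ∫ ω, partialIncr (scaled c ω) j L a * partialIncr (scaled c ω) j L b ∂(noiseLaw R) =
      R a b * (L * c) := by
  simp only [partialIncr, scaled, WithLp.ofLp_sum, Finset.sum_apply, PiLp.smul_apply, smul_eq_mul,
    Finset.sum_mul_sum]
  have key : ∀ m m' (ω : ℕ → Vec D), Real.sqrt c * ω (j + m) a * (Real.sqrt c * ω (j + m') b) =
      c * (ω (j + m) a * ω (j + m') b) := fun m m' ω => by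
    nth_rewrite 3 [← Real.mul_self_sqrt hc]
    ring
  simp only [key]
  have mm : ∀ m m', AllMoments (noiseLaw R) (fun ω => c * (ω (j + m) a * ω (j + m') b)) :=
    fun m m' => ((allMoments_coord _ _).mul (allMoments_coord _ _)).const_mul _
  rw [integral_finsetSum _ fun m _ => (AllMoments.sum _ fun m' _ => mm m m').integrable]
  have : ∀ m ∈ Finset.range L, ∫ ω, ∑ m' ∈ Finset.range L, c * (ω (j + m) a * ω (j + m') b)
      ∂(noiseLaw R) = c * R a b := fun m hm => by
    rw [integral_finsetSum _ fun m' _ => (mm m m').integrable]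
    simp only [integral_const_mul, integral_coord_mul hR, add_right_inj, mul_ite, mul_zero]
    rw [Finset.sum_ite_eq, if_pos hm]
  rw [Finset.sum_congr rfl this]
  simp
  ring

variable (E : SDE d D)

/-- The coefficients of the noise terms in the scheme, indexed by the terms `w_j` and
`w_j w_k - corr_jk h`. -/
def SDE.coef (i : Fin d) : Fin D ⊕ Fin D × Fin D → Vec d → ℝ → ℝ
  | Sum.inl j => E.b i j
  | Sum.inr (j, k) => E.hCoeff i j k

/-- The noise terms `w_j` and `w_j w_k - corr_jk h` of the scheme. -/
def SDE.noise (h : ℝ) (w : Vec D) : Fin D ⊕ Fin D × Fin D → ℝ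
  | Sum.inl j => w j
  | Sum.inr (j, k) => w j * w k - E.corr j k * h

theorem SDE.step_apply (x : Vec d) (t h : ℝ) (w : Vec D) (i : Fin d) :
    E.step x t h w i = E.a i x t * h + ∑ α, E.coef i α x t * E.noise h w α := by
  simp only [SDE.step, SDE.coef, SDE.noise, Fintype.sum_sum_type, Fintype.sum_prod_type, add_assoc]

theorem SDE.measurable_noise (h : ℝ) (α : Fin D ⊕ Fin D × Fin D) :
    Measurable (fun w => E.noise h w α) := by
  rcases α with j | ⟨j, k⟩ <;> simp only [SDE.noise] <;> fun_prop

theorem SDE.integral_noise (hR : E.corr.PosSemidef) {c : ℝ} (hc : 0 ≤ c) (j L : ℕ)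
    (α : Fin D ⊕ Fin D × Fin D) :
    ∫ ω, E.noise (L * c) (partialIncr (scaled c ω) j L) α ∂(noiseLaw E.corr) = 0 := by
  have mm : ∀ a, AllMoments (noiseLaw E.corr) (fun ω => partialIncr (scaled c ω) j L a) :=
    fun a => by
      simp only [partialIncr, scaled, WithLp.ofLp_sum, Finset.sum_apply, PiLp.smul_apply,
        smul_eq_mul]
      exact AllMoments.sum _ fun m _ => (allMoments_coord _ _).const_mul _
  rcases α with a | ⟨a, b⟩
  · exact integral_partialIncr_scaled c j L a
  · simp only [SDE.noise]
    rw [integral_sub ((mm a).mul (mm b)).integrable (integrable_const _),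
      integral_partialIncr_scaled_mul hR hc]
    simp

/-- The quadratic noise terms are one order smaller than the increments, which makes up for their
coefficients being merely Lipschitz. -/
theorem SDE.bigO_noise_inr {ι : Type*} {η : ι → ℝ} (hη : ∀ i, 0 < η i) {c : ι → ℝ}
    (hc0 : ∀ i, 0 ≤ c i) {K : ℝ} (hc : ∀ i, Real.sqrt (c i) ≤ K * η i) (j : ι → ℕ)
    (L : ℕ) (β : Fin D × Fin D) :
    BigO (noiseLaw E.corr) η 2
      (fun i ω => E.noise (L * c i) (partialIncr (scaled (c i) ω) (j i) L) (Sum.inr β)) := by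
  obtain ⟨a, b⟩ := β
  have hη0 : ∀ i, 0 ≤ η i := fun i => (hη i).le
  have h2 := bigO_partialIncr_scaled_apply (R := E.corr) hη0 K hc j L
  have h3 : BigO (noiseLaw E.corr) η 2 (fun i (_ : ℕ → Vec D) => E.corr a b * (L * c i)) := by
    refine bigO_const (|E.corr a b| * (L * K ^ 2)) hη0 fun i => ?_
    have h6 : 0 ≤ L * c i := mul_nonneg (Nat.cast_nonneg L) (hc0 i)
    rw [Real.norm_eq_abs, abs_mul, abs_of_nonneg h6]
    have h4 : c i ≤ K ^ 2 * η i ^ 2 := by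
      rw [← mul_pow, ← Real.sq_sqrt (hc0 i)]
      exact pow_le_pow_left₀ (Real.sqrt_nonneg _) (hc i) 2
    calc _ ≤ |E.corr a b| * (L * (K ^ 2 * η i ^ 2)) := by gcongr
      _ = _ := by ring
  have h5 := ((h2 a).mul hη (h2 b)).add (h3.neg hη0)
  simpa only [SDE.noise, sub_eq_add_neg] using h5

theorem SDE.bigO_noise {ι : Type*} {η : ι → ℝ} (hη : ∀ i, 0 < η i) (hη1 : ∀ i, η i ≤ 1)
    {c : ι → ℝ} (hc0 : ∀ i, 0 ≤ c i) {K : ℝ} (hc : ∀ i, Real.sqrt (c i) ≤ K * η i) (j : ι → ℕ)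
    (L : ℕ) (α : Fin D ⊕ Fin D × Fin D) :
    BigO (noiseLaw E.corr) η 1
      (fun i ω => E.noise (L * c i) (partialIncr (scaled (c i) ω) (j i) L) α) := by
  rcases α with a | β
  · exact bigO_partialIncr_scaled_apply (fun i => (hη i).le) K hc j L a
  · exact (E.bigO_noise_inr hη hc0 hc j L β).mono (fun i => (hη i).le) hη1 (by norm_num)

end Noise

/-! ### Lipschitz, growth and Taylor bounds for the coefficients. -/

section Coefficients

variable {d D : ℕ}

/-- A coefficient which is Lipschitz in space and time, of linear growth. -/
structure LipCoef (T K : ℝ) (f : Vec d → ℝ → ℝ) : Prop where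
  lip : ∀ t ∈ Set.Icc 0 T, ∀ x y, |f x t - f y t| ≤ K * ‖x - y‖
  growth : ∀ t ∈ Set.Icc 0 T, ∀ x, |f x t| ≤ K * (1 + ‖x‖)
  time : LipschitzInTime T K f

/-- A Lipschitz coefficient which is twice differentiable in space, with a uniform bound for the
remainder of the first order Taylor expansion. -/
structure SmoothCoef (T K : ℝ) (f : Vec d → ℝ → ℝ) : Prop extends LipCoef T K f where
  contDiff : ∀ t ∈ Set.Icc 0 T, ContDiff ℝ 2 fun x => f x t
  fderiv_le : ∀ t ∈ Set.Icc 0 T, ∀ x, ‖fderiv ℝ (fun y => f y t) x‖ ≤ K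
  taylor : ∀ t ∈ Set.Icc 0 T, ∀ x y,
    |f y t - f x t - fderiv ℝ (fun y => f y t) x (y - x)| ≤ K * ‖y - x‖ ^ 2

theorem LipCoef.mono {T K K' : ℝ} {f : Vec d → ℝ → ℝ} (h : LipCoef T K f) (hK : K ≤ K') :
    LipCoef T K' f where
  lip t ht x y := (h.lip t ht x y).trans (by gcongr)
  growth t ht x := (h.growth t ht x).trans (by gcongr)
  time x s hs t ht := (h.time x s hs t ht).trans (by gcongr)

theorem SmoothCoef.mono {T K K' : ℝ} {f : Vec d → ℝ → ℝ} (h : SmoothCoef T K f) (hK : K ≤ K') :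
    SmoothCoef T K' f where
  toLipCoef := h.toLipCoef.mono hK
  contDiff := h.contDiff
  fderiv_le t ht x := (h.fderiv_le t ht x).trans hK
  taylor t ht x y := (h.taylor t ht x y).trans (by gcongr)

theorem abs_sub_le_of_norm_fderiv_le {f : Vec d → ℝ} {K : ℝ} (hf : Differentiable ℝ f)
    (h : ∀ x, ‖fderiv ℝ f x‖ ≤ K) (x y : Vec d) : |f x - f y| ≤ K * ‖x - y‖ := by
  simpa using convex_univ.norm_image_sub_le_of_norm_fderiv_le (𝕜 := ℝ) (f := f)
    (fun z _ => hf z) (fun z _ => h z) (Set.mem_univ y) (Set.mem_univ x)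

/-- The derivative is `K`-Lipschitz, so on the segment it differs from its value at `x` by at most
`K * ‖y - x‖`, and the mean value inequality applies. The optimal factor `1 / 2` is not needed. -/
theorem HasTwoBoundedDerivs.taylor {f : Vec d → ℝ} {K : ℝ} (h : HasTwoBoundedDerivs K f)
    (x y : Vec d) : |f y - f x - fderiv ℝ f x (y - x)| ≤ K * ‖y - x‖ ^ 2 := by
  have hd : Differentiable ℝ f := h.1.differentiable (by norm_num)
  have hd2 : Differentiable ℝ (fderiv ℝ f) :=
    (h.1.fderiv_right (m := 1) (by norm_num)).differentiable (by norm_num)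
  have h2 : ∀ z, ‖fderiv ℝ (fderiv ℝ f) z‖ ≤ K := fun z => by
    have := (h.2 z).2
    rwa [← norm_iteratedFDeriv_fderiv, norm_iteratedFDeriv_one] at this
  have hlip : ∀ z, ‖fderiv ℝ f z - fderiv ℝ f x‖ ≤ K * ‖z - x‖ := fun z =>
    convex_univ.norm_image_sub_le_of_norm_fderiv_le (𝕜 := ℝ)
      (fun z _ => hd2 z) (fun z _ => h2 z) (Set.mem_univ x) (Set.mem_univ z)
  have hK : 0 ≤ K := (norm_nonneg (fderiv ℝ f x)).trans (h.2 x).1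
  have := (convex_segment x y).norm_image_sub_le_of_norm_fderiv_le' (𝕜 := ℝ) (f := f)
    (C := K * ‖y - x‖) (φ := fderiv ℝ f x) (fun z _ => hd z) (fun z hz => ?_)
    (left_mem_segment ℝ x y) (right_mem_segment ℝ x y)
  · rw [Real.norm_eq_abs] at this
    exact this.trans (le_of_eq (by ring))
  · refine (hlip z).trans (mul_le_mul_of_nonneg_left ?_ hK)
    obtain ⟨a, ha, rfl⟩ := (segment_eq_image' ℝ x y ▸ hz :
      z ∈ (fun θ : ℝ => x + θ • (y - x)) '' Set.Icc 0 1)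
    simp only [add_sub_cancel_left, norm_smul, Real.norm_of_nonneg ha.1]
    exact mul_le_of_le_one_left (norm_nonneg _) ha.2

/-- Linear growth follows by comparing `f x t` with `f 0 t` and then with `f 0 0`. -/
theorem exists_growth {T L L' : ℝ} (hT : 0 < T) {f : Vec d → ℝ → ℝ}
    (h1 : LipschitzInTime T L f) (h2 : ∀ t ∈ Set.Icc 0 T, ∀ x y, |f x t - f y t| ≤ L' * ‖x - y‖) :
    ∃ K, 0 ≤ K ∧ LipCoef T K f := by
  refine ⟨|f 0 0| + |L| * T + |L'| + |L|, by positivity, ?_, ?_, ?_⟩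
  · intro t ht x y
    refine (h2 t ht x y).trans (mul_le_mul_of_nonneg_right ?_ (norm_nonneg _))
    have := le_abs_self L'
    have : 0 ≤ |f 0 0| + |L| * T + |L| := by positivity
    linarith
  · intro t ht x
    have e1 := h1 0 0 ⟨le_rfl, hT.le⟩ t ht
    have e2 := h2 t ht x 0
    simp only [norm_zero, add_zero, mul_one, sub_zero] at e1 e2
    have e3 : L * |t| ≤ |L| * T := by
      rw [abs_of_nonneg ht.1]
      exact mul_le_mul (le_abs_self L) ht.2 ht.1 (abs_nonneg _)
    have e4 : L' * ‖x‖ ≤ |L'| * ‖x‖ := mul_le_mul_of_nonneg_right (le_abs_self L') (norm_nonneg _)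
    have e5 : |f x t| ≤ |f x t - f 0 t| + (|f 0 t - f 0 0| + |f 0 0|) := by
      have a1 := abs_add_le (f x t - f 0 t) (f 0 t)
      have a2 := abs_add_le (f 0 t - f 0 0) (f 0 0)
      simp only [sub_add_cancel] at a1 a2
      linarith
    have e6 : 0 ≤ (|f 0 0| + |L| * T + |L|) * ‖x‖ := by positivity
    have e7 := abs_nonneg L
    have e8 := abs_nonneg L'
    nlinarith
  · intro x s hs t ht
    refine (h1 x s hs t ht).trans ?_
    have : L ≤ |f 0 0| + |L| * T + |L'| + |L| := by
      have := le_abs_self L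
      have : 0 ≤ |f 0 0| + |L| * T + |L'| := by positivity
      linarith
    gcongr

theorem exists_smoothCoef {T L : ℝ} (hT : 0 < T) {f : Vec d → ℝ → ℝ}
    (h1 : LipschitzInTime T L f) (h2 : ∀ t ∈ Set.Icc 0 T, HasTwoBoundedDerivs L fun x => f x t) :
    ∃ K, 0 ≤ K ∧ SmoothCoef T K f := by
  obtain ⟨K, hK, hf⟩ := exists_growth hT h1 fun t ht x y =>
    abs_sub_le_of_norm_fderiv_le ((h2 t ht).1.differentiable (by norm_num))
      (fun z => ((h2 t ht).2 z).1) x y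
  refine ⟨K + |L|, by positivity, hf.mono (by simp), fun t ht => (h2 t ht).1,
    fun t ht x => ((h2 t ht).2 x).1.trans ?_, fun t ht x y => ((h2 t ht).taylor x y).trans ?_⟩
  · have := le_abs_self L
    linarith
  · have := le_abs_self L
    have : L ≤ K + |L| := by linarith
    gcongr

theorem exists_forall_le {ι : Type*} [Fintype ι] {p : ι → ℝ → Prop}
    (hmono : ∀ i K K', K ≤ K' → p i K → p i K') (h : ∀ i, ∃ K, 0 ≤ K ∧ p i K) :
    ∃ K, 0 ≤ K ∧ ∀ i, p i K := by
  choose K hK hp using h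
  exact ⟨∑ i, K i, Finset.sum_nonneg fun i _ => hK i, fun i => hmono i (K i) _
    (Finset.single_le_sum (fun i _ => hK i) (Finset.mem_univ i)) (hp i)⟩

variable {E : SDE d D}

theorem SDE.Regular.exists_bound (h : E.Regular) (hT : 0 < E.T) :
    ∃ K, 0 ≤ K ∧ (∀ i, SmoothCoef E.T K (E.a i)) ∧ (∀ i j, SmoothCoef E.T K (E.b i j)) ∧
      ∀ i α, LipCoef E.T K (E.coef i α) := by
  obtain ⟨L, ha, hb, hh, hder⟩ := h
  obtain ⟨K1, hK1, h1⟩ := exists_forall_le (p := fun i K => SmoothCoef E.T K (E.a i))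
    (fun i K K' hKK hp => hp.mono hKK)
    fun i => exists_smoothCoef hT (ha i) fun t ht => (hder t ht).1 i
  obtain ⟨K2, hK2, h2⟩ := exists_forall_le
    (p := fun (x : Fin d × Fin D) K => SmoothCoef E.T K (E.b x.1 x.2))
    (fun i K K' hKK hp => hp.mono hKK)
    fun x => exists_smoothCoef hT (hb x.1 x.2) fun t ht => (hder t ht).2.1 x.1 x.2
  -- The bound on `fderiv` alone says nothing at a point of non-differentiability, where `fderiv` is
  -- `0`. Differentiability of `hCoeff` comes from `b` being `C²`.
  have hdiff : ∀ i j k, ∀ t ∈ Set.Icc 0 E.T, Differentiable ℝ fun x => E.hCoeff i j k x t := by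
    intro i j k t ht
    unfold SDE.hCoeff
    refine Differentiable.const_mul (Differentiable.fun_sum fun l _ => ?_) _
    refine Differentiable.mul (((hder t ht).2.1 l k).1.differentiable (by norm_num)) ?_
    have : Differentiable ℝ (fderiv ℝ fun y => E.b i j y t) :=
      (((hder t ht).2.1 i j).1.fderiv_right (m := 1) (by norm_num)).differentiable (by norm_num)
    fun_prop
  obtain ⟨K3, hK3, h3⟩ := exists_forall_le
    (p := fun (x : Fin d × Fin D × Fin D) K => LipCoef E.T K (E.hCoeff x.1 x.2.1 x.2.2))
    (fun i K K' hKK hp => hp.mono hKK)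
    fun x => exists_growth hT (hh x.1 x.2.1 x.2.2) fun t ht =>
      abs_sub_le_of_norm_fderiv_le (hdiff _ _ _ t ht) ((hder t ht).2.2 _ _ _)
  refine ⟨K1 + K2 + K3, by positivity, fun i => (h1 i).mono (by linarith),
    fun i j => (h2 (i, j)).mono (by linarith), fun i α => ?_⟩
  rcases α with j | ⟨j, k⟩
  · exact (h2 (i, j)).toLipCoef.mono (by linarith)
  · exact (h3 (i, j, k)).mono (by linarith)

theorem LipCoef.continuous {T K : ℝ} {f : Vec d → ℝ → ℝ} (h : LipCoef T K f) {t : ℝ}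
    (ht : t ∈ Set.Icc 0 T) : Continuous fun x => f x t := by
  refine (LipschitzWith.of_dist_le_mul (K := K.toNNReal) fun x y => ?_).continuous
  rw [Real.dist_eq, dist_eq_norm]
  exact (h.lip t ht x y).trans (mul_le_mul_of_nonneg_right (Real.le_coe_toNNReal K) (norm_nonneg _))

section

variable {Ω : Type*} [MeasurableSpace Ω] {μ : Measure Ω} [IsProbabilityMeasure μ]

theorem LipCoef.allMoments {T K : ℝ} {f : Vec d → ℝ → ℝ} (h : LipCoef T K f) {t : ℝ}
    (ht : t ∈ Set.Icc 0 T) {y : Ω → Vec d} (hy : AllMoments μ y) :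
    AllMoments μ (fun ω => f (y ω) t) := by
  refine ((allMoments_const (1 : ℝ)).add hy.norm).of_le
    ((h.continuous ht).measurable.comp hy.1) K fun ω => ?_
  rw [Real.norm_of_nonneg (by positivity : 0 ≤ 1 + ‖y ω‖)]
  exact h.growth t ht (y ω)

theorem LipCoef.bigO {T K : ℝ} {f : Vec d → ℝ → ℝ} (h : LipCoef T K f) {ι : Type*} {η : ι → ℝ}
    (hη : ∀ i, 0 ≤ η i) {t : ι → ℝ} (ht : ∀ i, t i ∈ Set.Icc 0 T) {y : ι → Ω → Vec d}
    (hy : BigO μ η 0 y) : BigO μ η 0 (fun i ω => f (y i ω) (t i)) := by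
  refine ((bigO_const (c := fun _ : ι => (1 : ℝ)) 1 hη (by simp)).add (hy.norm hη)).of_le hη
    (fun i => (h.continuous (ht i)).measurable.comp (hy.allMoments i).1) K fun i ω => ?_
  rw [Real.norm_of_nonneg (by positivity : 0 ≤ 1 + ‖y i ω‖)]
  exact h.growth (t i) (ht i) (y i ω)

theorem LipCoef.bigO_sub {T K : ℝ} {f : Vec d → ℝ → ℝ} (h : LipCoef T K f) {ι : Type*} {η : ι → ℝ}
    (hη : ∀ i, 0 ≤ η i) {t : ι → ℝ} (ht : ∀ i, t i ∈ Set.Icc 0 T) {y z : ι → Ω → Vec d} {r : ℕ}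
    (my : ∀ i, Measurable (y i)) (mz : ∀ i, Measurable (z i))
    (hyz : BigO μ η r (fun i ω => y i ω - z i ω)) :
    BigO μ η r (fun i ω => f (y i ω) (t i) - f (z i ω) (t i)) :=
  hyz.of_le hη (fun i => ((h.continuous (ht i)).measurable.comp (my i)).sub
    ((h.continuous (ht i)).measurable.comp (mz i))) K fun i _ => h.lip (t i) (ht i) _ _

/-- The stability estimate only yields exponents `4 * (q + 1)`. Every `p` lies below `4 * (p + 1)`,
and after scaling by `s` one has `x ^ p ≤ 1 + x ^ (4 * (p + 1))`. -/
theorem bigO_of_forall_large {ι : Type*} {η : ι → ℝ} (hη : ∀ i, 0 < η i) {r : ℕ} {X : ι → Ω → ℝ}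
    (hX : ∀ i, AllMoments μ (X i))
    (h : ∀ q : ℕ, ∃ C, ∀ i, ∫ ω, |X i ω| ^ (4 * (q + 1)) ∂μ ≤ C * (η i ^ r) ^ (4 * (q + 1))) :
    BigO μ η r X := by
  choose C hC using h
  refine ⟨fun p => 1 + C p, fun i => ⟨hX i, fun p => ?_⟩⟩
  have hs : 0 < η i ^ r := pow_pos (hη i) r
  set s := η i ^ r with hs0
  have hpt : ∀ ω, ‖X i ω‖ ^ p ≤ s ^ p * (1 + |X i ω| ^ (4 * (p + 1)) / s ^ (4 * (p + 1))) := by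
    intro ω
    have h1 : (|X i ω| / s) ^ p ≤ 1 + (|X i ω| / s) ^ (4 * (p + 1)) := by
      have h0 : 0 ≤ |X i ω| / s := by positivity
      rcases le_total (|X i ω| / s) 1 with h | h
      · have := pow_le_one₀ h0 h (n := p)
        have : 0 ≤ (|X i ω| / s) ^ (4 * (p + 1)) := by positivity
        linarith
      · have := pow_le_pow_right₀ h (by omega : p ≤ 4 * (p + 1))
        linarith
    rw [div_pow, div_pow] at h1
    rw [Real.norm_eq_abs]
    calc |X i ω| ^ p = s ^ p * (|X i ω| ^ p / s ^ p) := by field_simp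
      _ ≤ _ := by gcongr
  have m1 : AllMoments μ (fun ω => |X i ω| ^ (4 * (p + 1)) / s ^ (4 * (p + 1))) := by
    simp only [div_eq_inv_mul]
    exact ((hX i).abs.pow _).const_mul _
  have m2 := ((allMoments_const (μ := μ) (1 : ℝ)).add m1).const_mul (s ^ p)
  refine (integral_mono ((hX i).2 p) m2.integrable hpt).trans ?_
  rw [integral_const_mul, integral_add (integrable_const _) m1.integrable, integral_div]
  simp only [integral_const, probReal_univ, smul_eq_mul, mul_one]
  rw [mul_comm]
  gcongr
  rw [div_le_iff₀ (by positivity)]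
  exact hC p i

end

end Coefficients

/-! ### Time steps and their order of magnitude. -/

section Mesh

/-- The order of magnitude `N ^ (-1/2)` of a Brownian increment over one of `N` time steps. -/
def rootMesh (N : ℕ+) : ℝ := (Real.sqrt (N : ℕ))⁻¹

/-- The pairs `(N, n)` of a number of time steps and the index `n < N` of one of them. -/
abbrev StepIdx : Type := Σ N : ℕ+, Fin N

theorem rootMesh_pos (N : ℕ+) : 0 < rootMesh N := by
  have : (0 : ℝ) < (N : ℕ) := by exact_mod_cast N.pos
  unfold rootMesh
  positivity

theorem rootMesh_le_one (N : ℕ+) : rootMesh N ≤ 1 := by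
  unfold rootMesh
  refine inv_le_one_of_one_le₀ ?_
  rw [Real.one_le_sqrt]
  exact_mod_cast N.pos

theorem rootMesh_sq (N : ℕ+) : rootMesh N ^ 2 = 1 / (N : ℕ) := by
  unfold rootMesh
  rw [inv_pow, Real.sq_sqrt (Nat.cast_nonneg _), one_div]

variable {d D : ℕ} (E : SDE d D) (M : ℕ)

/-- The fine time step, for `N` coarse steps of `M` fine steps each. -/
def SDE.mesh (N : ℕ+) : ℝ := E.T / ((N : ℕ) * M)

variable {E M}

theorem SDE.mesh_nonneg (hT : 0 < E.T) (N : ℕ+) : 0 ≤ E.mesh M N := by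
  unfold SDE.mesh; positivity

theorem SDE.mul_mesh (hM : 1 ≤ M) (N : ℕ+) : M * E.mesh M N = E.T * rootMesh N ^ 2 := by
  have hM' : (M : ℝ) ≠ 0 := by positivity
  have : ((N : ℕ) : ℝ) ≠ 0 := by exact_mod_cast N.ne_zero
  rw [rootMesh_sq, SDE.mesh]
  field_simp

theorem SDE.mesh_le (hT : 0 < E.T) (hM : 1 ≤ M) (N : ℕ+) : E.mesh M N ≤ E.T * rootMesh N ^ 2 := by
  rw [← E.mul_mesh hM]
  have : (1 : ℝ) ≤ M := by exact_mod_cast hM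
  exact le_mul_of_one_le_left (E.mesh_nonneg hT N) this

theorem SDE.sqrt_mesh_le (hT : 0 < E.T) (hM : 1 ≤ M) (N : ℕ+) :
    Real.sqrt (E.mesh M N) ≤ Real.sqrt E.T * rootMesh N := by
  refine (Real.sqrt_le_sqrt (E.mesh_le hT hM N)).trans ?_
  rw [Real.sqrt_mul hT.le, Real.sqrt_sq (rootMesh_pos N).le]

theorem SDE.time_mem (hT : 0 < E.T) (hM : 1 ≤ M) {N : ℕ+} {k : ℕ} (hk : k ≤ N * M) :
    (k : ℝ) * E.mesh M N ∈ Set.Icc 0 E.T := by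
  have hM' : (0 : ℝ) < M := by positivity
  have hN : (0 : ℝ) < (N : ℕ) := by exact_mod_cast N.pos
  have hk' : (k : ℝ) ≤ (N : ℕ) * M := by exact_mod_cast hk
  refine ⟨mul_nonneg (Nat.cast_nonneg k) (E.mesh_nonneg hT N), ?_⟩
  rw [SDE.mesh, ← mul_div_assoc, div_le_iff₀ (by positivity), mul_comm]
  exact mul_le_mul_of_nonneg_left hk' hT.le

theorem SDE.coarse_time_mem (hT : 0 < E.T) (hM : 1 ≤ M) {N : ℕ+} {n : ℕ} (hn : n ≤ N) :
    (n : ℝ) * (M * E.mesh M N) ∈ Set.Icc 0 E.T := by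
  have := SDE.time_mem (E := E) hT hM (N := N) (k := n * M) (Nat.mul_le_mul_right M hn)
  rwa [Nat.cast_mul, mul_assoc] at this

end Mesh

/-! ### Stability of the scheme under perturbations. -/

section StepStability

variable {d D : ℕ} {E : SDE d D} {M : ℕ}

/-- The coarse increment of index `n`. -/
def SDE.coarseIncr (E : SDE d D) (M : ℕ) (N : ℕ+) (n : ℕ) (ω : ℕ → Vec D) : Vec D :=
  partialIncr (scaled (E.mesh M N) ω) (n * M) M

/-- Two adapted sequences follow the scheme up to perturbations `U` and `V`. Over `N` steps, drift
errors add up to `N` times their size and centered errors to `√N` times theirs, a loss of two orders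
and of one order. The difference of the two scheme steps is absorbed by Gronwall: the coefficients
are Lipschitz and the noise of the step is centered and independent of the past. -/
theorem SDE.integral_partialSups_dev_le (hT : 0 < E.T) (hcorr : E.corr.PosSemidef) (hM : 1 ≤ M)
    {K : ℝ} (hK : 0 ≤ K) (ha : ∀ i, LipCoef E.T K (E.a i)) (hc : ∀ i α, LipCoef E.T K (E.coef i α))
    (r : ℕ) (y z : ℕ+ → ℕ → (ℕ → Vec D) → Vec d) (U V : Fin d → ℕ+ → ℕ → (ℕ → Vec D) → ℝ)
    (my : ∀ N : ℕ+, ∀ n ≤ (N : ℕ), AllMoments (noiseLaw E.corr) (y N n))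
    (mz : ∀ N : ℕ+, ∀ n ≤ (N : ℕ), AllMoments (noiseLaw E.corr) (z N n))
    (dy : ∀ N : ℕ+, ∀ n ≤ (N : ℕ), DependsOn (y N n) (Set.Iio (n * M)))
    (dz : ∀ N : ℕ+, ∀ n ≤ (N : ℕ), DependsOn (z N n) (Set.Iio (n * M)))
    (hU : ∀ i, BigO (noiseLaw E.corr) (fun x : StepIdx => rootMesh x.1) (r + 2)
      (fun x => U i x.1 x.2))
    (hV : ∀ i, BigO (noiseLaw E.corr) (fun x : StepIdx => rootMesh x.1) (r + 1)
      (fun x => V i x.1 x.2))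
    (dV : ∀ i, ∀ N : ℕ+, ∀ n < (N : ℕ), DependsOn (V i N n) (Set.Iio ((n + 1) * M)))
    (cV : ∀ i, ∀ N : ℕ+, ∀ n < (N : ℕ), Centered (noiseLaw E.corr) (n * M) (V i N n))
    (h0 : ∀ N ω, y N 0 ω = z N 0 ω)
    (hrec : ∀ N : ℕ+, ∀ n < (N : ℕ), ∀ ω i, y N (n + 1) ω i - z N (n + 1) ω i =
      y N n ω i - z N n ω i +
      (E.step (y N n ω) (n * (M * E.mesh M N)) (M * E.mesh M N) (E.coarseIncr M N n ω) i -
        E.step (z N n ω) (n * (M * E.mesh M N)) (M * E.mesh M N) (E.coarseIncr M N n ω) i) +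
      U i N n ω + V i N n ω) :
    BigO (noiseLaw E.corr) rootMesh r
      (fun N ω => partialSups (fun n => ‖y N n ω - z N n ω‖) (N : ℕ)) := by
  set ν := noiseLaw E.corr with hν
  set ψ : Fin D ⊕ Fin D × Fin D → ℕ+ → ℕ → (ℕ → Vec D) → ℝ := fun α N n ω =>
    E.noise (M * E.mesh M N) (E.coarseIncr M N n ω) α with hψ
  have Oψ : ∀ α, BigO ν (fun x : StepIdx => rootMesh x.1) 1 (fun x => ψ α x.1 x.2) := fun α =>
    E.bigO_noise (fun x => rootMesh_pos x.1) (fun x => rootMesh_le_one x.1)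
      (c := fun x : StepIdx => E.mesh M x.1) (fun x => E.mesh_nonneg hT x.1)
      (fun x => E.sqrt_mesh_le hT hM x.1) (fun x => x.2 * M) M α
  have dψ : ∀ α N n, DependsOn (ψ α N n) (Set.Ico (n * M) ((n + 1) * M)) := fun α N n x y h => by
    simp only [hψ, SDE.coarseIncr]
    have := dependsOn_partialIncr_scaled (D := D) (E.mesh M N) (n * M) M
      (fun i hi => h i (by rwa [add_one_mul]))
    simp only at this
    rw [this]
  have Iψ : ∀ α N n, ∫ ω, ψ α N n ω ∂ν = 0 := fun α N n =>
    E.integral_noise hcorr (E.mesh_nonneg hT N) (n * M) M α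
  have me : ∀ N : ℕ+, ∀ n ≤ (N : ℕ), AllMoments ν (fun ω => y N n ω - z N n ω) := fun N n hn => by
    have := (my N n hn).add (AllMoments.of_le (mz N n hn) (mz N n hn).1.neg 1 (by simp))
    simpa [sub_eq_add_neg] using this
  have htime : ∀ N : ℕ+, ∀ n ≤ (N : ℕ), (n : ℝ) * (M * E.mesh M N) ∈ Set.Icc 0 E.T := fun N n hn =>
    E.coarse_time_mem hT hM hn
  refine bigO_of_forall_large rootMesh_pos (fun N => allMoments_partialSups _ fun k hk =>
    (me N k hk).norm) fun q => ?_
  choose CU hCU using hU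
  choose CV hCV using hV
  choose Cψ hCψ using Oψ
  set p := 4 * (q + 1) with hp
  set card : ℝ := ((Finset.univ : Finset (Fin D ⊕ Fin D × Fin D)).card : ℝ) with hcard
  set KU : ℝ := ∑ i, |CU i p| with hKU
  set KV : ℝ := ∑ i, |CV i p| with hKV
  set Kψ : ℝ := card ^ (4 * q + 3) * ∑ α, (K ^ p * |Cψ α p|) with hKψ
  have hKU0 : 0 ≤ KU := by positivity
  have hKV0 : 0 ≤ KV := by positivity
  have hKψ0 : 0 ≤ Kψ := by positivity
  set K' : ℝ := 2 ^ (p - 1) * ((K * E.T) ^ p + KU + Kψ + KV) with hK'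
  have hK'0 : 0 ≤ K' := by positivity
  obtain ⟨C, hC⟩ := integral_partialSups_norm_pow_le (ν := ν) q d hK'0
  refine ⟨C, fun N => ?_⟩
  have hη := rootMesh_pos N
  have hNp : (0 : ℝ) < (N : ℕ) := by exact_mod_cast N.pos
  set ρ : ℝ := (rootMesh N ^ r) ^ p with hρ
  have hρ0 : 0 ≤ ρ := by positivity
  have e2 : (rootMesh N ^ 2) ^ p = 1 / ((N : ℕ) : ℝ) ^ p := by rw [rootMesh_sq, div_pow, one_pow]
  have e1 : (rootMesh N ^ 1) ^ p = 1 / ((N : ℕ) : ℝ) ^ (2 * (q + 1)) := by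
    rw [pow_one, hp, show 4 * (q + 1) = 2 * (2 * (q + 1)) by ring, pow_mul, rootMesh_sq, div_pow,
      one_pow]
  set e : ℕ → (ℕ → Vec D) → Vec d := fun n ω => y N n ω - z N n ω with he
  set u : ℕ → Fin d → (ℕ → Vec D) → ℝ := fun n i ω =>
    (E.a i (y N n ω) (n * (M * E.mesh M N)) - E.a i (z N n ω) (n * (M * E.mesh M N))) *
      (M * E.mesh M N) + U i N n ω with hu
  set g : ℕ → Fin d → Fin D ⊕ Fin D × Fin D → (ℕ → Vec D) → ℝ := fun n i α ω =>
    E.coef i α (y N n ω) (n * (M * E.mesh M N)) - E.coef i α (z N n ω) (n * (M * E.mesh M N))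
    with hg
  set v : ℕ → Fin d → (ℕ → Vec D) → ℝ := fun n i ω => ∑ α, g n i α ω * ψ α N n ω + V i N n ω with hv
  have mU : ∀ n < (N : ℕ), ∀ i, AllMoments ν (U i N n) := fun n hn i => (hCU i ⟨N, n, hn⟩).1
  have mV : ∀ n < (N : ℕ), ∀ i, AllMoments ν (V i N n) := fun n hn i => (hCV i ⟨N, n, hn⟩).1
  have mψ : ∀ n < (N : ℕ), ∀ α, AllMoments ν (ψ α N n) := fun n hn α => (hCψ α ⟨N, n, hn⟩).1
  have ma : ∀ n < (N : ℕ), ∀ i, AllMoments ν (fun ω =>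
      E.a i (y N n ω) (n * (M * E.mesh M N)) - E.a i (z N n ω) (n * (M * E.mesh M N))) :=
    fun n hn i => ((ha i).allMoments (htime N n hn.le) (my N n hn.le)).sub
      ((ha i).allMoments (htime N n hn.le) (mz N n hn.le))
  have mg : ∀ n < (N : ℕ), ∀ i α, AllMoments ν (g n i α) :=
    fun n hn i α => ((hc i α).allMoments (htime N n hn.le) (my N n hn.le)).sub
      ((hc i α).allMoments (htime N n hn.le) (mz N n hn.le))
  have dg : ∀ n < (N : ℕ), ∀ i α, DependsOn (g n i α) (Set.Iio (n * M)) := fun n hn i α x x' h => by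
    simp only [hg, dy N n hn.le h, dz N n hn.le h]
  have mgψ : ∀ n < (N : ℕ), ∀ i α, AllMoments ν (fun ω => g n i α ω * ψ α N n ω) :=
    fun n hn i α => (mg n hn i α).mul (mψ n hn α)
  refine hC N N.pos (fun n => n * M) (fun a b h => Nat.mul_le_mul_right M h) e u v ρ hρ0
    (me N) ?_ ?_ ?_ ?_ ?_ ?_ ?_ ?_ |>.trans' (le_of_eq ?_)
  · intro n hn i
    refine AllMoments.add ?_ (mU n hn i)
    exact (ma n hn i).mul (allMoments_const _)
  · exact fun n hn i => (AllMoments.sum _ fun α _ => mgψ n hn i α).add (mV n hn i)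
  · intro n hn i x x' h
    have h1 : ∀ α, g n i α x = g n i α x' := fun α =>
      (dg n hn i α).mono (Set.Iio_subset_Iio (Nat.mul_le_mul_right M (Nat.le_succ n))) h
    have h2 : ∀ α, ψ α N n x = ψ α N n x' := fun α => (dψ α N n).mono Set.Ico_subset_Iio_self h
    simp only [hv, h1, h2, dV i N n hn h]
  · intro n hn i
    refine Centered.add (Centered.sum _ (fun α _ => ?_) fun α _ => mgψ n hn i α) (cV i N n hn)
      (AllMoments.sum _ fun α _ => mgψ n hn i α) (mV n hn i)
    exact centered_mul le_rfl (mg n hn i α) (mψ n hn α).1 (dg n hn i α) (dψ α N n) (Iψ α N n)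
  · intro ω
    simp [he, h0 N ω]
  · intro n hn ω i
    simp only [he, PiLp.sub_apply]
    rw [hrec N n hn ω i, SDE.step_apply, SDE.step_apply]
    simp only [hu, hv, hg, hψ, sub_mul, Finset.sum_sub_distrib]
    ring
  · intro n hn i
    have i1 := ((me N n hn.le).norm.pow p).integrable
    have i2 := ((mU n hn i).abs.pow p).integrable
    have hpt : ∀ ω, |u n i ω| ^ p ≤ 2 ^ (p - 1) * ((K * E.T) ^ p / (N : ℕ) ^ p * ‖e n ω‖ ^ p +
        |U i N n ω| ^ p) := by
      intro ω
      refine (pow_le_pow_left₀ (abs_nonneg _) (abs_add_le _ _) p).trans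
        ((add_pow_le (abs_nonneg _) (abs_nonneg _) p).trans ?_)
      gcongr
      rw [abs_mul, E.mul_mesh hM, rootMesh_sq, abs_of_nonneg (by positivity : 0 ≤ E.T * (1 / (N : ℕ) : ℝ)),
        ← div_pow, ← mul_pow]
      have h1 := (ha i).lip _ (htime N n hn.le) (y N n ω) (z N n ω)
      rw [E.mul_mesh hM, rootMesh_sq] at h1
      refine pow_le_pow_left₀ (by positivity) ?_ p
      calc _ ≤ K * ‖y N n ω - z N n ω‖ * (E.T * (1 / (N : ℕ))) := by gcongr
        _ = _ := by simp only [he]; ring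
    have hUb : ∫ ω, |U i N n ω| ^ p ∂ν ≤ KU * ((1 / ((N : ℕ) : ℝ) ^ p) * ρ) := by
      refine ((hCU i ⟨N, n, hn⟩).2 p).trans ?_
      simp only
      rw [pow_add, mul_pow, e2, ← hρ, mul_comm ρ]
      refine mul_le_mul_of_nonneg_right ((le_abs_self _).trans ?_) (by positivity)
      exact Finset.single_le_sum (f := fun i => |CU i p|) (fun i _ => abs_nonneg _)
        (Finset.mem_univ i)
    have hφ : 0 ≤ ∫ ω, ‖e n ω‖ ^ p ∂ν := integral_nonneg fun ω => by positivity
    calc _ ≤ 2 ^ (p - 1) * ((K * E.T) ^ p / (N : ℕ) ^ p * ∫ ω, ‖e n ω‖ ^ p ∂ν +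
          ∫ ω, |U i N n ω| ^ p ∂ν) := by
          refine (integral_mono ?_ (((i1.const_mul _).add i2).const_mul _) hpt).trans (le_of_eq ?_)
          · refine AllMoments.integrable (AllMoments.pow (AllMoments.abs ?_) p)
            refine AllMoments.add ?_ (mU n hn i)
            exact (ma n hn i).mul (allMoments_const _)
          · rw [integral_const_mul, integral_add' (i1.const_mul _) i2, integral_const_mul]
      _ ≤ 2 ^ (p - 1) * ((K * E.T) ^ p / (N : ℕ) ^ p * ∫ ω, ‖e n ω‖ ^ p ∂ν +
          KU * ((1 / ((N : ℕ) : ℝ) ^ p) * ρ)) := by gcongr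
      _ = 2 ^ (p - 1) / (N : ℕ) ^ p * ((K * E.T) ^ p * ∫ ω, ‖e n ω‖ ^ p ∂ν + KU * ρ) := by ring
      _ ≤ 2 ^ (p - 1) / (N : ℕ) ^ p * (((K * E.T) ^ p + KU + Kψ + KV) *
          (∫ ω, ‖e n ω‖ ^ p ∂ν + ρ)) := by
          gcongr
          have : 0 ≤ (K * E.T) ^ p := by positivity
          nlinarith [mul_nonneg this hρ0, mul_nonneg hKU0 hφ,
            mul_nonneg (add_nonneg hKψ0 hKV0) (add_nonneg hφ hρ0)]
      _ = _ := by rw [hK']; ring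
  · intro n hn i
    have hφ : 0 ≤ ∫ ω, ‖e n ω‖ ^ p ∂ν := integral_nonneg fun ω => by positivity
    have i1 : ∀ α, Integrable (fun ω => |g n i α ω * ψ α N n ω| ^ p) ν := fun α =>
      ((mgψ n hn i α).abs.pow p).integrable
    have i2 := ((mV n hn i).abs.pow p).integrable
    have hpt : ∀ ω, |v n i ω| ^ p ≤ 2 ^ (p - 1) * (card ^ (4 * q + 3) *
        ∑ α, |g n i α ω * ψ α N n ω| ^ p + |V i N n ω| ^ p) := by
      intro ω
      refine (pow_le_pow_left₀ (abs_nonneg _) (abs_add_le _ _) p).trans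
        ((add_pow_le (abs_nonneg _) (abs_nonneg _) p).trans ?_)
      gcongr
      exact abs_sum_pow_le _ _ (4 * q + 3)
    -- The coefficient difference depends on the past and the noise on the current block, so the
    -- moment factorizes and the exponent `p` of `e` is kept.
    have hgψ : ∀ α, ∫ ω, |g n i α ω * ψ α N n ω| ^ p ∂ν ≤
        (K ^ p * |Cψ α p|) * (1 / ((N : ℕ) : ℝ) ^ (2 * (q + 1)) * ∫ ω, ‖e n ω‖ ^ p ∂ν) := by
      intro α
      rw [hν, noiseLaw, integral_mul_pow_of_dependsOn (mg n hn i α).1 (mψ n hn α).1 (dg n hn i α)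
        (dψ α N n) p]
      change (∫ ω, |g n i α ω| ^ p ∂ν) * ∫ ω, |ψ α N n ω| ^ p ∂ν ≤
        (K ^ p * |Cψ α p|) * (1 / ((N : ℕ) : ℝ) ^ (2 * (q + 1)) * ∫ ω, ‖e n ω‖ ^ p ∂ν)
      have h1 : ∫ ω, |g n i α ω| ^ p ∂ν ≤ K ^ p * ∫ ω, ‖e n ω‖ ^ p ∂ν := by
        rw [← integral_const_mul]
        refine integral_mono ((mg n hn i α).abs.pow p).integrable
          (((me N n hn.le).norm.pow p).integrable.const_mul _) fun ω => ?_
        simp only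
        rw [← mul_pow]
        exact pow_le_pow_left₀ (abs_nonneg _) ((hc i α).lip _ (htime N n hn.le) _ _) p
      have h2 : ∫ ω, |ψ α N n ω| ^ p ∂ν ≤ |Cψ α p| * (1 / ((N : ℕ) : ℝ) ^ (2 * (q + 1))) := by
        refine ((hCψ α ⟨N, n, hn⟩).2 p).trans ?_
        simp only
        rw [e1]
        exact mul_le_mul_of_nonneg_right (le_abs_self _) (by positivity)
      calc _ ≤ (K ^ p * ∫ ω, ‖e n ω‖ ^ p ∂ν) * (|Cψ α p| * (1 / ((N : ℕ) : ℝ) ^ (2 * (q + 1)))) :=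
            mul_le_mul h1 h2 (integral_nonneg fun ω => by positivity) (by positivity)
        _ = _ := by ring
    have hVb : ∫ ω, |V i N n ω| ^ p ∂ν ≤ KV * ((1 / ((N : ℕ) : ℝ) ^ (2 * (q + 1))) * ρ) := by
      refine ((hCV i ⟨N, n, hn⟩).2 p).trans ?_
      simp only
      rw [pow_add, mul_pow, e1, ← hρ, mul_comm ρ]
      refine mul_le_mul_of_nonneg_right ((le_abs_self _).trans ?_) (by positivity)
      exact Finset.single_le_sum (f := fun i => |CV i p|) (fun i _ => abs_nonneg _)
        (Finset.mem_univ i)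
    have i3 : Integrable (fun ω => ∑ α, |g n i α ω * ψ α N n ω| ^ p) ν :=
      integrable_finsetSum _ fun α _ => i1 α
    calc _ ≤ 2 ^ (p - 1) * (card ^ (4 * q + 3) * ∑ α, ∫ ω, |g n i α ω * ψ α N n ω| ^ p ∂ν +
          ∫ ω, |V i N n ω| ^ p ∂ν) := by
          refine (integral_mono ?_ (((i3.const_mul _).add i2).const_mul _) hpt).trans (le_of_eq ?_)
          · exact (((AllMoments.sum _ fun α _ => mgψ n hn i α).add (mV n hn i)).abs.pow p).integrable
          · rw [integral_const_mul, integral_add' (i3.const_mul _) i2, integral_const_mul,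
              integral_finsetSum _ fun α _ => i1 α]
      _ ≤ 2 ^ (p - 1) * (card ^ (4 * q + 3) * ∑ α, (K ^ p * |Cψ α p|) *
            (1 / ((N : ℕ) : ℝ) ^ (2 * (q + 1)) * ∫ ω, ‖e n ω‖ ^ p ∂ν) +
          KV * ((1 / ((N : ℕ) : ℝ) ^ (2 * (q + 1))) * ρ)) := by
          refine mul_le_mul_of_nonneg_left (add_le_add (mul_le_mul_of_nonneg_left
            (Finset.sum_le_sum fun α _ => hgψ α) ?_) hVb) ?_ <;> positivity
      _ = 2 ^ (p - 1) / (N : ℕ) ^ (2 * (q + 1)) * (Kψ * ∫ ω, ‖e n ω‖ ^ p ∂ν + KV * ρ) := by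
          rw [← Finset.sum_mul, hKψ]; ring
      _ ≤ 2 ^ (p - 1) / (N : ℕ) ^ (2 * (q + 1)) * (((K * E.T) ^ p + KU + Kψ + KV) *
          (∫ ω, ‖e n ω‖ ^ p ∂ν + ρ)) := by
          gcongr
          have : 0 ≤ (K * E.T) ^ p := by positivity
          nlinarith [mul_nonneg hKψ0 hρ0, mul_nonneg hKV0 hφ,
            mul_nonneg (add_nonneg this hKU0) (add_nonneg hφ hρ0)]
      _ = _ := by rw [hK']; ring
  · refine integral_congr_ae (Filter.Eventually.of_forall fun ω => ?_)
    simp only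
    congr 1
    refine abs_of_nonneg ?_
    exact (norm_nonneg _).trans (le_partialSups_of_le (fun n => ‖y N n ω - z N n ω‖) (Nat.zero_le _))

end StepStability

/-! ### Passage from coordinates to vectors. -/

section Vectors

variable {Ω : Type*} [MeasurableSpace Ω] {μ : Measure Ω} [IsProbabilityMeasure μ] {d : ℕ}

theorem measurable_vec {f : Ω → Vec d} (h : ∀ i, Measurable fun ω => f ω i) : Measurable f :=
  (MeasurableEquiv.toLp 2 (Fin d → ℝ)).measurable.comp (measurable_pi_lambda _ h)

theorem allMoments_vec {f : Ω → Vec d} (h : ∀ i, AllMoments μ fun ω => f ω i) : AllMoments μ f := by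
  refine (AllMoments.sum Finset.univ fun i _ => (h i).abs).of_le
    (measurable_vec fun i => (h i).1) 1 fun ω => ?_
  rw [one_mul]
  exact (norm_le_sum_abs (f ω)).trans (le_abs_self _)

theorem AllMoments.apply {f : Ω → Vec d} (h : AllMoments μ f) (i : Fin d) :
    AllMoments μ fun ω => f ω i :=
  h.of_le (by have := h.1; fun_prop) 1 fun ω => by simpa using abs_apply_le_norm (f ω) i

variable {ι : Type*} {η : ι → ℝ} {r : ℕ}

theorem bigO_vec (hη : ∀ i, 0 ≤ η i) {X : ι → Ω → Vec d}
    (h : ∀ k, BigO μ η r fun i ω => X i ω k) : BigO μ η r X := by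
  refine (BigO.sum Finset.univ hη fun k _ => (h k).norm hη).of_le hη
    (fun i => measurable_vec fun k => ((h k).allMoments i).1) 1 fun i ω => ?_
  rw [one_mul]
  exact (norm_le_sum_abs (X i ω)).trans (le_abs_self _)

theorem BigO.vec_neg (hη : ∀ i, 0 ≤ η i) {X : ι → Ω → Vec d} (h : BigO μ η r X) :
    BigO μ η r fun i ω => -X i ω :=
  h.of_le hη (fun i => (h.allMoments i).1.neg) 1 (by simp)

theorem BigO.vec_sub (hη : ∀ i, 0 ≤ η i) {X Y : ι → Ω → Vec d} (hX : BigO μ η r X)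
    (hY : BigO μ η r Y) : BigO μ η r fun i ω => X i ω - Y i ω := by
  simpa only [sub_eq_add_neg] using hX.add (hY.vec_neg hη)

theorem BigO.sub (hη : ∀ i, 0 ≤ η i) {X Y : ι → Ω → ℝ} (hX : BigO μ η r X)
    (hY : BigO μ η r Y) : BigO μ η r fun i ω => X i ω - Y i ω := by
  simpa only [sub_eq_add_neg] using hX.add (hY.neg hη)

end Vectors

/-! ### The paths on the canonical space and their uniform moments. -/

section Paths

variable {d D : ℕ} {E : SDE d D} {M : ℕ}

theorem SDE.path_congr {h : ℝ} {w w' : ℕ → Vec D} {k : ℕ} (hw : ∀ j < k, w j = w' j) :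
    E.path h w k = E.path h w' k := by
  induction k with
  | zero => rfl
  | succ k ih =>
    simp only [SDE.path]
    rw [ih fun j hj => hw j (by omega), hw k (by omega)]

section

variable {Ω : Type*} [MeasurableSpace Ω] {μ : Measure Ω} [IsProbabilityMeasure μ]

theorem SDE.allMoments_noise {w : Ω → Vec D} (hw : AllMoments μ w) (h : ℝ)
    (α : Fin D ⊕ Fin D × Fin D) : AllMoments μ fun ω => E.noise h (w ω) α := by
  rcases α with j | ⟨j, k⟩
  · exact hw.apply j
  · exact ((hw.apply j).mul (hw.apply k)).sub (allMoments_const _)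

theorem SDE.allMoments_step {K : ℝ} (ha : ∀ i, LipCoef E.T K (E.a i))
    (hc : ∀ i α, LipCoef E.T K (E.coef i α)) {t : ℝ} (ht : t ∈ Set.Icc 0 E.T) (h : ℝ)
    {x : Ω → Vec d} (hx : AllMoments μ x) {w : Ω → Vec D} (hw : AllMoments μ w) :
    AllMoments μ fun ω => E.step (x ω) t h (w ω) := by
  refine allMoments_vec fun i => ?_
  simp only [SDE.step_apply]
  exact (((ha i).allMoments ht hx).mul (allMoments_const _)).add (AllMoments.sum _ fun α _ =>
    ((hc i α).allMoments ht hx).mul (E.allMoments_noise hw h α))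

theorem SDE.allMoments_path {K : ℝ} (ha : ∀ i, LipCoef E.T K (E.a i))
    (hc : ∀ i α, LipCoef E.T K (E.coef i α)) {h : ℝ} {n : ℕ}
    (ht : ∀ k < n, (k : ℝ) * h ∈ Set.Icc 0 E.T) {w : Ω → ℕ → Vec D}
    (hw : ∀ k < n, AllMoments μ fun ω => w ω k) {k : ℕ} (hk : k ≤ n) :
    AllMoments μ fun ω => E.path h (w ω) k := by
  induction k with
  | zero => exact allMoments_const _
  | succ k ih =>
    exact (ih (by omega)).add
      (E.allMoments_step ha hc (ht k hk) h (ih (by omega)) (hw k hk))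

end

theorem SDE.allMoments_coarseIncr (N : ℕ+) (n : ℕ) :
    AllMoments (noiseLaw E.corr) (E.coarseIncr M N n) := by
  unfold SDE.coarseIncr partialIncr scaled
  refine AllMoments.sum _ fun m _ => ?_
  exact (allMoments_eval _).of_le (by fun_prop) (Real.sqrt (E.mesh M N)) fun ω => by
    rw [norm_smul, Real.norm_of_nonneg (Real.sqrt_nonneg _)]

variable (E M) in
/-- The coarse path on the canonical space. -/
def SDE.coarsePt (N : ℕ+) (n : ℕ) (ω : ℕ → Vec D) : Vec d :=
  E.coarse M (E.mesh M N) (scaled (E.mesh M N) ω) n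

variable (E M) in
/-- The fine path on the canonical space, `m` fine steps after the coarse step `n`. -/
def SDE.finePt (N : ℕ+) (n m : ℕ) (ω : ℕ → Vec D) : Vec d :=
  E.path (E.mesh M N) (scaled (E.mesh M N) ω) (n * M + m)

theorem SDE.coarsePt_succ (N : ℕ+) (n : ℕ) (ω : ℕ → Vec D) :
    E.coarsePt M N (n + 1) ω = E.coarsePt M N n ω +
      E.step (E.coarsePt M N n ω) (n * (M * E.mesh M N)) (M * E.mesh M N) (E.coarseIncr M N n ω) :=
  rfl

theorem SDE.dependsOn_coarsePt (N : ℕ+) (n : ℕ) :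
    DependsOn (E.coarsePt M N n) (Set.Iio (n * M)) := by
  intro x y h
  refine SDE.path_congr fun j hj => Finset.sum_congr rfl fun m hm => ?_
  have hm' := Finset.mem_range.1 hm
  have : j * M + m < n * M := by
    calc j * M + m < j * M + M := by omega
      _ = (j + 1) * M := by ring
      _ ≤ n * M := Nat.mul_le_mul_right M hj
  simp only [scaled, h _ (Set.mem_Iio.2 this)]

theorem SDE.dependsOn_finePt (N : ℕ+) (n m : ℕ) :
    DependsOn (E.finePt M N n m) (Set.Iio (n * M + m)) := by
  intro x y h
  refine SDE.path_congr fun j hj => ?_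
  simp only [scaled, h _ (Set.mem_Iio.2 hj)]

theorem SDE.allMoments_coarsePt (hT : 0 < E.T) (hM : 1 ≤ M) {K : ℝ}
    (ha : ∀ i, LipCoef E.T K (E.a i)) (hc : ∀ i α, LipCoef E.T K (E.coef i α)) {N : ℕ+} {n : ℕ}
    (hn : n ≤ N) : AllMoments (noiseLaw E.corr) (E.coarsePt M N n) :=
  E.allMoments_path ha hc (fun _ hk => E.coarse_time_mem hT hM (by omega))
    (fun _ _ => E.allMoments_coarseIncr _ _) hn

theorem SDE.allMoments_finePt (hT : 0 < E.T) (hM : 1 ≤ M) {K : ℝ}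
    (ha : ∀ i, LipCoef E.T K (E.a i)) (hc : ∀ i α, LipCoef E.T K (E.coef i α)) {N : ℕ+} {n m : ℕ}
    (hn : n * M + m ≤ N * M) : AllMoments (noiseLaw E.corr) (E.finePt M N n m) := by
  refine E.allMoments_path ha hc (w := scaled (E.mesh M N)) (n := N * M)
    (fun k hk => E.time_mem hT hM (by omega)) (fun k _ => ?_) hn
  exact (allMoments_eval _).of_le (by unfold scaled; fun_prop) (Real.sqrt (E.mesh M N)) fun ω => by
    rw [scaled, norm_smul, Real.norm_of_nonneg (Real.sqrt_nonneg _)]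

/-- Uniform moment bounds for the coarse path. -/
theorem SDE.bigO_coarsePt_sub_init (hT : 0 < E.T) (hcorr : E.corr.PosSemidef) (hM : 1 ≤ M)
    {K : ℝ} (hK : 0 ≤ K) (ha : ∀ i, LipCoef E.T K (E.a i))
    (hc : ∀ i α, LipCoef E.T K (E.coef i α)) :
    BigO (noiseLaw E.corr) rootMesh 0
      (fun N ω => partialSups (fun n => ‖E.coarsePt M N n ω - E.init‖) (N : ℕ)) := by
  have hη : ∀ x : StepIdx, 0 < rootMesh x.1 := fun x => rootMesh_pos x.1
  have hη0 : ∀ x : StepIdx, 0 ≤ rootMesh x.1 := fun x => (hη x).le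
  have hη1 : ∀ x : StepIdx, rootMesh x.1 ≤ 1 := fun x => rootMesh_le_one x.1
  have htime : ∀ x : StepIdx, ((x.2 : ℕ) : ℝ) * (M * E.mesh M x.1) ∈ Set.Icc 0 E.T := fun x =>
    E.coarse_time_mem hT hM x.2.2.le
  have hψ : ∀ α, BigO (noiseLaw E.corr) (fun x : StepIdx => rootMesh x.1) 1
      (fun x ω => E.noise (M * E.mesh M x.1) (E.coarseIncr M x.1 x.2 ω) α) := fun α =>
    E.bigO_noise hη hη1 (c := fun x : StepIdx => E.mesh M x.1) (fun x => E.mesh_nonneg hT x.1)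
      (fun x => E.sqrt_mesh_le hT hM x.1) (fun x => x.2 * M) M α
  have hinit : BigO (noiseLaw E.corr) (fun x : StepIdx => rootMesh x.1) 0
      (fun x (_ : ℕ → Vec D) => E.init) := bigO_const ‖E.init‖ hη0 (by simp)
  -- Stability with `r = 0`, against the constant sequence `init`: its defect in the recursion is
  -- the scheme step taken at `init`, whose drift has order 2 and whose noise is centered of order
  -- 1.
  refine E.integral_partialSups_dev_le hT hcorr hM hK ha hc 0 (E.coarsePt M) (fun _ _ _ => E.init)
    (fun i N n _ => E.a i E.init (n * (M * E.mesh M N)) * (M * E.mesh M N))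
    (fun i N n ω => ∑ α, E.coef i α E.init (n * (M * E.mesh M N)) *
      E.noise (M * E.mesh M N) (E.coarseIncr M N n ω) α)
    (fun N n hn => E.allMoments_coarsePt hT hM ha hc hn) (fun N n _ => allMoments_const _)
    (fun N n _ => E.dependsOn_coarsePt N n) (fun N n _ => fun _ _ _ => rfl) ?_ ?_ ?_ ?_
    (fun _ _ => rfl) ?_
  · intro i
    refine ((ha i).bigO hη0 htime hinit).mul hη (s := 2)
      (bigO_const (c := fun x : StepIdx => M * E.mesh M x.1) E.T hη0 fun x => ?_)
    rw [E.mul_mesh hM, Real.norm_of_nonneg (by have := hη0 x; positivity)]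
  · exact fun i => BigO.sum _ hη0 fun α _ => ((hc i α).bigO hη0 htime hinit).mul hη (hψ α)
  · intro i N n hn x y h
    have := dependsOn_partialIncr_scaled (D := D) (E.mesh M N) (n * M) M
      (fun i hi => h i (by rw [Set.mem_Iio, add_one_mul]; exact hi.2))
    simp only at this
    simp only [SDE.coarseIncr, this]
  · intro i N n hn
    have hd : ∀ α, DependsOn (fun ω => E.noise (M * E.mesh M N) (E.coarseIncr M N n ω) α)
        (Set.Ico (n * M) (n * M + M)) := fun α x y h => by
      have := dependsOn_partialIncr_scaled (D := D) (E.mesh M N) (n * M) M h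
      simp only at this
      simp only [SDE.coarseIncr, this]
    refine Centered.sum _ (fun α _ => ?_) fun α _ =>
      (allMoments_const _).mul ((hψ α).allMoments ⟨N, n, hn⟩)
    exact centered_mul le_rfl (allMoments_const _) ((hψ α).allMoments ⟨N, n, hn⟩).1
      (fun _ _ _ => rfl) (hd α) (E.integral_noise hcorr (E.mesh_nonneg hT N) (n * M) M α)
  · intro N n hn ω i
    rw [SDE.coarsePt_succ, PiLp.add_apply, E.step_apply E.init]
    ring

/-- The fine path is the coarse path of a grid with `N M` steps and blocks of length one, so it
inherits the moment bound. -/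
theorem SDE.finePt_eq_coarsePt (N : ℕ+) (n m : ℕ) (ω : ℕ → Vec D) {M' : ℕ+} (hM' : (M' : ℕ) = M) :
    E.finePt M N n m ω = E.coarsePt 1 (N * M') (n * M + m) ω := by
  have h1 : E.mesh 1 (N * M') = E.mesh M N := by
    simp [SDE.mesh, PNat.mul_coe, hM']
  have h2 : ∀ w : ℕ → Vec D, sumBlocks 1 w = w := fun w => by
    funext k
    simp [sumBlocks]
  simp only [SDE.finePt, SDE.coarsePt, SDE.coarse, h1, h2, Nat.cast_one, one_mul]

theorem SDE.bigO_finePt (hT : 0 < E.T) (hcorr : E.corr.PosSemidef) (hM : 1 ≤ M)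
    {K : ℝ} (hK : 0 ≤ K) (ha : ∀ i, LipCoef E.T K (E.a i))
    (hc : ∀ i α, LipCoef E.T K (E.coef i α)) {m : ℕ} (hm : m ≤ M) :
    BigO (noiseLaw E.corr) (fun x : StepIdx => rootMesh x.1) 0
      (fun x => E.finePt M x.1 x.2 m) := by
  have hle : ∀ x : StepIdx, (x.2 : ℕ) * M + m ≤ x.1 * M := fun x => by
    calc (x.2 : ℕ) * M + m ≤ x.2 * M + M := by omega
      _ = (x.2 + 1) * M := by ring
      _ ≤ x.1 * M := Nat.mul_le_mul_right M x.2.2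
  have hη0 : ∀ x : StepIdx, 0 ≤ rootMesh x.1 := fun x => (rootMesh_pos x.1).le
  obtain ⟨M', hM'⟩ : ∃ M' : ℕ+, (M' : ℕ) = M := ⟨⟨M, hM⟩, rfl⟩
  obtain ⟨C, hC⟩ := E.bigO_coarsePt_sub_init hT hcorr le_rfl hK ha hc
  -- At order `0` the bound does not involve the mesh, so it does not matter that the grid has `N M`
  -- steps rather than `N`.
  have h1 : BigO (noiseLaw E.corr) (fun x : StepIdx => rootMesh x.1) 0
      (fun x => fun ω => partialSups (fun n =>
        ‖E.coarsePt 1 (x.1 * M') n ω - E.init‖) ((x.1 * M' : ℕ+) : ℕ)) :=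
    ⟨C, fun x => ⟨(hC _).1, fun p => by simpa using (hC (x.1 * M')).2 p⟩⟩
  have h2 := (bigO_const (μ := noiseLaw E.corr) (c := fun _ : StepIdx => ‖E.init‖) (r := 0)
    ‖E.init‖ hη0 (by simp)).add h1
  refine h2.of_le hη0 (fun x => (E.allMoments_finePt hT hM ha hc (hle x)).1) 1 fun x ω => ?_
  rw [one_mul, E.finePt_eq_coarsePt _ _ _ _ hM']
  have h3 := le_partialSups_of_le (fun n => ‖E.coarsePt 1 (x.1 * M') n ω - E.init‖)
    (by simpa [PNat.mul_coe, hM'] using hle x : (x.2 : ℕ) * M + m ≤ ((x.1 * M' : ℕ+) : ℕ))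
  refine le_trans ?_ (le_abs_self _)
  have h4 := norm_add_le E.init (E.coarsePt 1 (x.1 * M') (x.2 * M + m) ω - E.init)
  rw [add_sub_cancel] at h4
  linarith

end Paths

variable {d D : ℕ}

/-- The standing assumptions, with a common bound `K` for all the coefficients. -/
structure SDE.Admissible (E : SDE d D) (M : ℕ) (K : ℝ) : Prop where
  hT : 0 < E.T
  hcorr : E.corr.PosSemidef
  hM : 1 ≤ M
  hK : 0 ≤ K
  ha : ∀ i, SmoothCoef E.T K (E.a i)
  hb : ∀ i j, SmoothCoef E.T K (E.b i j)
  hc : ∀ i α, LipCoef E.T K (E.coef i α)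

/-! ### Expansion of the fine path over one coarse step. -/

section Blocks

variable (E : SDE d D) (M : ℕ)

/-- The Brownian increment over the first `m` fine steps of the coarse step `n`. -/
def SDE.blockIncr (N : ℕ+) (n m : ℕ) (ω : ℕ → Vec D) : Vec D :=
  partialIncr (scaled (E.mesh M N) ω) (n * M) m

/-- The increment over the fine step `m` of the coarse step `n`. -/
def SDE.fineIncr (N : ℕ+) (n m : ℕ) (ω : ℕ → Vec D) : Vec D :=
  partialIncr (scaled (E.mesh M N) ω) (n * M + m) 1

/-- The time at the beginning of the fine step `m` of the coarse step `n`. -/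
def SDE.fineTime (N : ℕ+) (n m : ℕ) : ℝ := ((n * M + m : ℕ) : ℝ) * E.mesh M N

/-- The time at the beginning of the coarse step `n`. -/
def SDE.coarseTime (N : ℕ+) (n : ℕ) : ℝ := (n : ℝ) * (M * E.mesh M N)

/-- The increment `b(S_n, t_n) (W - W(t_n))` of the fine path with frozen coefficient. -/
def SDE.frozen (N : ℕ+) (n m : ℕ) (ω : ℕ → Vec D) : Vec d :=
  WithLp.toLp 2 fun l => ∑ k, E.b l k (E.finePt M N n 0 ω) (E.coarseTime M N n) *
    E.blockIncr M N n m ω k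

/-- The remainder of the first order expansion of a coefficient along the fine path. -/
def SDE.remainder (f : Vec d → ℝ → ℝ) (N : ℕ+) (n m : ℕ) (ω : ℕ → Vec D) : ℝ :=
  f (E.finePt M N n m ω) (E.fineTime M N n m) - f (E.finePt M N n 0 ω) (E.coarseTime M N n) -
    fderiv ℝ (fun y => f y (E.coarseTime M N n)) (E.finePt M N n 0 ω) (E.frozen M N n m ω)

/-- The variation of a coefficient along the fine path. -/
def SDE.variation (f : Vec d → ℝ → ℝ) (N : ℕ+) (n m : ℕ) (ω : ℕ → Vec D) : ℝ :=
  f (E.finePt M N n m ω) (E.fineTime M N n m) - f (E.finePt M N n 0 ω) (E.coarseTime M N n)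

/-- The drift part of the remainder of the fine path over a coarse step. -/
def SDE.driftRem (i : Fin d) (N : ℕ+) (n m : ℕ) (ω : ℕ → Vec D) : ℝ :=
  ∑ l ∈ Finset.range m, E.remainder M (E.a i) N n l ω * E.mesh M N

/-- The martingale part of the remainder of the fine path over a coarse step. -/
def SDE.martRem (i : Fin d) (N : ℕ+) (n m : ℕ) (ω : ℕ → Vec D) : ℝ :=
  ∑ l ∈ Finset.range m,
    (fderiv ℝ (fun y => E.a i y (E.coarseTime M N n)) (E.finePt M N n 0 ω) (E.frozen M N n l ω) *
      E.mesh M N +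
    ∑ j, E.remainder M (E.b i j) N n l ω * E.fineIncr M N n l ω j +
    ∑ β : Fin D × Fin D, E.variation M (E.coef i (Sum.inr β)) N n l ω *
      E.noise (E.mesh M N) (E.fineIncr M N n l ω) (Sum.inr β))

/-- The discrete Lévy areas. -/
def SDE.area (N : ℕ+) (n m : ℕ) (β : Fin D × Fin D) (ω : ℕ → Vec D) : ℝ :=
  ∑ l ∈ Finset.range m, (E.blockIncr M N n l ω β.2 * E.fineIncr M N n l ω β.1 -
    E.blockIncr M N n l ω β.1 * E.fineIncr M N n l ω β.2)

/-- The contribution of the discrete Lévy areas to the fine path over a coarse step. -/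
def SDE.areaTerm (i : Fin d) (N : ℕ+) (n m : ℕ) (ω : ℕ → Vec D) : ℝ :=
  ∑ β : Fin D × Fin D, E.coef i (Sum.inr β) (E.finePt M N n 0 ω) (E.coarseTime M N n) *
    E.area M N n m β ω

variable {E M}

theorem SDE.noise_inl (h : ℝ) (w : Vec D) (j : Fin D) : E.noise h w (Sum.inl j) = w j := rfl

theorem SDE.noise_inr (h : ℝ) (w : Vec D) (β : Fin D × Fin D) :
    E.noise h w (Sum.inr β) = w β.1 * w β.2 - E.corr β.1 β.2 * h := rfl

theorem SDE.coef_inl (i : Fin d) (j : Fin D) : E.coef i (Sum.inl j) = E.b i j := rfl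

theorem SDE.fineIncr_eq (N : ℕ+) (n m : ℕ) (ω : ℕ → Vec D) :
    E.fineIncr M N n m ω = scaled (E.mesh M N) ω (n * M + m) := by
  simp [SDE.fineIncr, partialIncr]

theorem SDE.blockIncr_succ (N : ℕ+) (n m : ℕ) (ω : ℕ → Vec D) :
    E.blockIncr M N n (m + 1) ω = E.blockIncr M N n m ω + E.fineIncr M N n m ω := by
  rw [SDE.fineIncr_eq, SDE.blockIncr, SDE.blockIncr, partialIncr, Finset.sum_range_succ]
  rfl

theorem SDE.finePt_succ (N : ℕ+) (n m : ℕ) (ω : ℕ → Vec D) :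
    E.finePt M N n (m + 1) ω = E.finePt M N n m ω +
      E.step (E.finePt M N n m ω) (E.fineTime M N n m) (E.mesh M N) (E.fineIncr M N n m ω) := by
  rw [SDE.fineIncr_eq]
  rfl

theorem SDE.fderiv_frozen (g : Vec d → ℝ) (N : ℕ+) (n m : ℕ) (ω : ℕ → Vec D) :
    fderiv ℝ g (E.finePt M N n 0 ω) (E.frozen M N n m ω) =
      ∑ k, (∑ l, E.b l k (E.finePt M N n 0 ω) (E.coarseTime M N n) *
        fderiv ℝ g (E.finePt M N n 0 ω) (EuclideanSpace.single l 1)) *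
        E.blockIncr M N n m ω k := by
  have h : E.frozen M N n m ω = ∑ l, (E.frozen M N n m ω l) • EuclideanSpace.single l (1 : ℝ) := by
    ext l
    simp [WithLp.ofLp_sum, Finset.sum_apply, Pi.single_apply]
  rw [h, map_sum]
  simp only [map_smul, smul_eq_mul, SDE.frozen, Finset.sum_mul]
  rw [Finset.sum_comm]
  refine Finset.sum_congr rfl fun k _ => Finset.sum_congr rfl fun l _ => by ring

/-- The first order variation of `b` along the frozen increment reproduces the Milstein
coefficients; the `2` undoes the `1 / 2` in `hCoeff`. -/
theorem SDE.fderiv_b_frozen (i : Fin d) (j : Fin D) (N : ℕ+) (n m : ℕ) (ω : ℕ → Vec D) :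
    fderiv ℝ (fun y => E.b i j y (E.coarseTime M N n)) (E.finePt M N n 0 ω) (E.frozen M N n m ω) =
      ∑ k, 2 * E.hCoeff i j k (E.finePt M N n 0 ω) (E.coarseTime M N n) *
        E.blockIncr M N n m ω k := by
  rw [E.fderiv_frozen]
  refine Finset.sum_congr rfl fun k _ => ?_
  rw [SDE.hCoeff]
  ring

/-- Expansion of one fine step around the beginning of the coarse step. -/
theorem SDE.fine_step_expansion (i : Fin d) (N : ℕ+) (n m : ℕ) (ω : ℕ → Vec D) :
    E.step (E.finePt M N n m ω) (E.fineTime M N n m) (E.mesh M N) (E.fineIncr M N n m ω) i =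
      E.a i (E.finePt M N n 0 ω) (E.coarseTime M N n) * E.mesh M N +
      ∑ j, E.b i j (E.finePt M N n 0 ω) (E.coarseTime M N n) * E.fineIncr M N n m ω j +
      ∑ β : Fin D × Fin D, E.coef i (Sum.inr β) (E.finePt M N n 0 ω) (E.coarseTime M N n) *
        (E.noise (E.mesh M N) (E.fineIncr M N n m ω) (Sum.inr β) +
          2 * E.blockIncr M N n m ω β.2 * E.fineIncr M N n m ω β.1) +
      E.remainder M (E.a i) N n m ω * E.mesh M N +
      (fderiv ℝ (fun y => E.a i y (E.coarseTime M N n)) (E.finePt M N n 0 ω)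
          (E.frozen M N n m ω) * E.mesh M N +
        ∑ j, E.remainder M (E.b i j) N n m ω * E.fineIncr M N n m ω j +
        ∑ β : Fin D × Fin D, E.variation M (E.coef i (Sum.inr β)) N n m ω *
          E.noise (E.mesh M N) (E.fineIncr M N n m ω) (Sum.inr β)) := by
  rw [SDE.step_apply, Fintype.sum_sum_type]
  -- Only `b` multiplies noise of order 1, so it is the coefficient whose first order variation must
  -- be kept explicitly; it yields the products `2 B_k w_j` of the past block increment `B` and the
  -- fine increment `w`.
  have hb : ∀ j, E.coef i (Sum.inl j) (E.finePt M N n m ω) (E.fineTime M N n m) *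
      E.noise (E.mesh M N) (E.fineIncr M N n m ω) (Sum.inl j) =
      E.b i j (E.finePt M N n 0 ω) (E.coarseTime M N n) * E.fineIncr M N n m ω j +
      E.remainder M (E.b i j) N n m ω * E.fineIncr M N n m ω j +
      ∑ k, E.coef i (Sum.inr (j, k)) (E.finePt M N n 0 ω) (E.coarseTime M N n) *
        (2 * E.blockIncr M N n m ω k * E.fineIncr M N n m ω j) := fun j => by
    have h1 : ∑ k, E.coef i (Sum.inr (j, k)) (E.finePt M N n 0 ω) (E.coarseTime M N n) *
        (2 * E.blockIncr M N n m ω k * E.fineIncr M N n m ω j) =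
        (∑ k, 2 * E.hCoeff i j k (E.finePt M N n 0 ω) (E.coarseTime M N n) *
          E.blockIncr M N n m ω k) * E.fineIncr M N n m ω j := by
      rw [Finset.sum_mul]
      refine Finset.sum_congr rfl fun k _ => ?_
      simp only [SDE.coef]
      ring
    rw [h1, SDE.remainder, E.fderiv_b_frozen]
    simp only [SDE.coef, SDE.noise]
    ring
  have hh : ∀ β, E.coef i (Sum.inr β) (E.finePt M N n m ω) (E.fineTime M N n m) *
      E.noise (E.mesh M N) (E.fineIncr M N n m ω) (Sum.inr β) =
      E.coef i (Sum.inr β) (E.finePt M N n 0 ω) (E.coarseTime M N n) *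
        E.noise (E.mesh M N) (E.fineIncr M N n m ω) (Sum.inr β) +
      E.variation M (E.coef i (Sum.inr β)) N n m ω *
        E.noise (E.mesh M N) (E.fineIncr M N n m ω) (Sum.inr β) := fun β => by
    rw [SDE.variation]
    ring
  have ha : E.a i (E.finePt M N n m ω) (E.fineTime M N n m) =
      E.a i (E.finePt M N n 0 ω) (E.coarseTime M N n) + E.remainder M (E.a i) N n m ω +
      fderiv ℝ (fun y => E.a i y (E.coarseTime M N n)) (E.finePt M N n 0 ω)
        (E.frozen M N n m ω) := by
    rw [SDE.remainder]
    ring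
  simp only [hb, hh, ha, mul_add, Finset.sum_add_distrib]
  rw [Fintype.sum_prod_type (f := fun β : Fin D × Fin D =>
    E.coef i (Sum.inr β) (E.finePt M N n 0 ω) (E.coarseTime M N n) *
      (2 * E.blockIncr M N n m ω β.2 * E.fineIncr M N n m ω β.1))]
  ring

/-- Expansion of the fine path over the first `m` fine steps of a coarse step. -/
theorem SDE.finePt_expansion (i : Fin d) (N : ℕ+) (n m : ℕ) (ω : ℕ → Vec D) :
    E.finePt M N n m ω i = E.finePt M N n 0 ω i +
      E.step (E.finePt M N n 0 ω) (E.coarseTime M N n) (m * E.mesh M N) (E.blockIncr M N n m ω) i +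
      E.areaTerm M i N n m ω + E.driftRem M i N n m ω + E.martRem M i N n m ω := by
  induction m with
  | zero =>
    simp only [SDE.step_apply, SDE.areaTerm, SDE.area, SDE.driftRem, SDE.martRem, SDE.blockIncr,
      partialIncr, Finset.range_zero, Finset.sum_empty, Nat.cast_zero, zero_mul, mul_zero,
      Finset.sum_const_zero, add_zero]
    rw [Finset.sum_eq_zero]
    · ring
    · rintro (j | ⟨j, k⟩) - <;> simp [SDE.noise]
  | succ m ih =>
    -- With `B` and `w` the block and fine increments, the product of the components `j` and `k` of
    -- `B + w` creates the cross terms `B_j w_k + w_j B_k`, while the fine step supplies `2 B_k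
    -- w_j`. The difference `B_k w_j - B_j w_k` is exactly the increment of the area.
    rw [SDE.finePt_succ, PiLp.add_apply, ih, E.fine_step_expansion]
    simp only [SDE.areaTerm, SDE.area, SDE.driftRem, SDE.martRem, Finset.sum_range_succ,
      SDE.step_apply, Fintype.sum_sum_type, SDE.blockIncr_succ, mul_add, Finset.sum_add_distrib]
    simp only [SDE.coef_inl, SDE.noise_inl, SDE.noise_inr, PiLp.add_apply, mul_add,
      Finset.sum_add_distrib, add_mul,
      mul_sub, Finset.sum_sub_distrib, Nat.cast_add, Nat.cast_one]
    have e : ∑ β : Fin D × Fin D, E.coef i (Sum.inr β) (E.finePt M N n 0 ω) (E.coarseTime M N n) *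
        (2 * E.blockIncr M N n m ω β.2 * E.fineIncr M N n m ω β.1) =
        ∑ β : Fin D × Fin D, E.coef i (Sum.inr β) (E.finePt M N n 0 ω) (E.coarseTime M N n) *
          (E.fineIncr M N n m ω β.1 * E.blockIncr M N n m ω β.2) +
        ∑ β : Fin D × Fin D, E.coef i (Sum.inr β) (E.finePt M N n 0 ω) (E.coarseTime M N n) *
          (E.blockIncr M N n m ω β.2 * E.fineIncr M N n m ω β.1) := by
      rw [← Finset.sum_add_distrib]
      exact Finset.sum_congr rfl fun β _ => by ring
    rw [e]
    simp only [one_mul]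
    ring

end Blocks

/-! ### Orders of the remainders, and which of them are centered. -/

section Orders

variable {d D : ℕ} {E : SDE d D} {M : ℕ} {K : ℝ}

/-- Families indexed by the coarse steps which are of the order `N ^ (-r / 2)` in all moments. -/
abbrev SDE.StepO (E : SDE d D) {F : Type*} [NormedAddCommGroup F] [MeasurableSpace F]
    [BorelSpace F] (r : ℕ) (X : StepIdx → (ℕ → Vec D) → F) : Prop :=
  BigO (noiseLaw E.corr) (fun x : StepIdx => rootMesh x.1) r X

theorem stepMesh_pos (x : StepIdx) : 0 < rootMesh x.1 := rootMesh_pos x.1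

theorem stepMesh_nonneg (x : StepIdx) : 0 ≤ rootMesh x.1 := (rootMesh_pos x.1).le

theorem stepMesh_le_one (x : StepIdx) : rootMesh x.1 ≤ 1 := rootMesh_le_one x.1

theorem SDE.fineTime_eq (N : ℕ+) (n m : ℕ) :
    E.fineTime M N n m = E.coarseTime M N n + m * E.mesh M N := by
  simp only [SDE.fineTime, SDE.coarseTime, Nat.cast_add, Nat.cast_mul]
  ring

namespace SDE.Admissible

variable (A : E.Admissible M K)
include A

theorem coarseTime_mem (x : StepIdx) : E.coarseTime M x.1 x.2 ∈ Set.Icc 0 E.T :=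
  E.coarse_time_mem A.hT A.hM x.2.2.le

theorem index_le {m : ℕ} (hm : m ≤ M) (x : StepIdx) : (x.2 : ℕ) * M + m ≤ x.1 * M := by
  calc (x.2 : ℕ) * M + m ≤ x.2 * M + M := by omega
    _ = (x.2 + 1) * M := by ring
    _ ≤ x.1 * M := Nat.mul_le_mul_right M x.2.2

theorem fineTime_mem {m : ℕ} (hm : m ≤ M) (x : StepIdx) :
    E.fineTime M x.1 x.2 m ∈ Set.Icc 0 E.T :=
  E.time_mem A.hT A.hM (A.index_le hm x)

theorem abs_fineTime_sub_le {m : ℕ} (hm : m ≤ M) (x : StepIdx) :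
    |E.fineTime M x.1 x.2 m - E.coarseTime M x.1 x.2| ≤ E.T * rootMesh x.1 ^ 2 := by
  have h := E.mesh_nonneg A.hT (M := M) x.1
  rw [E.fineTime_eq, add_sub_cancel_left, abs_of_nonneg (by positivity), ← E.mul_mesh A.hM]
  gcongr

theorem bigO_mesh : E.StepO 2 (fun x _ => E.mesh M x.1) :=
  bigO_const E.T stepMesh_nonneg fun x => by
    rw [Real.norm_of_nonneg (E.mesh_nonneg A.hT _)]
    exact E.mesh_le A.hT A.hM x.1

theorem bigO_blockIncr (m : ℕ) (k : Fin D) : E.StepO 1 (fun x ω => E.blockIncr M x.1 x.2 m ω k) :=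
  bigO_partialIncr_scaled_apply stepMesh_nonneg _ (fun x => E.sqrt_mesh_le A.hT A.hM x.1)
    (fun x : StepIdx => x.2 * M) m k

theorem bigO_fineIncr (m : ℕ) (k : Fin D) : E.StepO 1 (fun x ω => E.fineIncr M x.1 x.2 m ω k) :=
  bigO_partialIncr_scaled_apply stepMesh_nonneg _ (fun x => E.sqrt_mesh_le A.hT A.hM x.1)
    (fun x : StepIdx => x.2 * M + m) 1 k

theorem bigO_fine_noise_inr (m : ℕ) (β : Fin D × Fin D) : E.StepO 2 (fun x ω =>
    E.noise (E.mesh M x.1) (E.fineIncr M x.1 x.2 m ω) (Sum.inr β)) := by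
  have := E.bigO_noise_inr stepMesh_pos
    (fun x : StepIdx => E.mesh_nonneg A.hT (M := M) x.1) (fun x => E.sqrt_mesh_le A.hT A.hM x.1)
    (fun x : StepIdx => x.2 * M + m) 1 β
  simp only [Nat.cast_one, one_mul] at this
  exact this

theorem bigO_finePt {m : ℕ} (hm : m ≤ M) : E.StepO 0 (fun x => E.finePt M x.1 x.2 m) :=
  E.bigO_finePt A.hT A.hcorr A.hM A.hK (fun i => (A.ha i).toLipCoef) A.hc hm

theorem measurable_finePt {m : ℕ} (hm : m ≤ M) (x : StepIdx) :
    Measurable (E.finePt M x.1 x.2 m) :=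
  ((A.bigO_finePt hm).allMoments x).1

theorem bigO_coef_finePt {f : Vec d → ℝ → ℝ} (hf : LipCoef E.T K f) {m : ℕ} (hm : m ≤ M) :
    E.StepO 0 (fun x ω => f (E.finePt M x.1 x.2 m ω) (E.fineTime M x.1 x.2 m)) :=
  hf.bigO stepMesh_nonneg (A.fineTime_mem hm) (A.bigO_finePt hm)

theorem bigO_coef_init {f : Vec d → ℝ → ℝ} (hf : LipCoef E.T K f) :
    E.StepO 0 (fun x ω => f (E.finePt M x.1 x.2 0 ω) (E.coarseTime M x.1 x.2)) :=
  hf.bigO stepMesh_nonneg A.coarseTime_mem (A.bigO_finePt (Nat.zero_le M))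

theorem bigO_finePt_sub {m : ℕ} (hm : m ≤ M) :
    E.StepO 1 (fun x ω => E.finePt M x.1 x.2 m ω - E.finePt M x.1 x.2 0 ω) := by
  induction m with
  | zero =>
    simp only [sub_self]
    exact bigO_const 0 stepMesh_nonneg (by simp)
  | succ m ih =>
    have e : ∀ (x : StepIdx) ω, E.finePt M x.1 x.2 (m + 1) ω - E.finePt M x.1 x.2 0 ω =
        (E.finePt M x.1 x.2 m ω - E.finePt M x.1 x.2 0 ω) +
          E.step (E.finePt M x.1 x.2 m ω) (E.fineTime M x.1 x.2 m) (E.mesh M x.1)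
            (E.fineIncr M x.1 x.2 m ω) := fun x ω => by rw [E.finePt_succ]; abel
    simp only [e]
    refine (ih (by omega)).add (bigO_vec stepMesh_nonneg fun i => ?_)
    simp only [E.step_apply]
    refine BigO.add ((((A.bigO_coef_finePt (A.ha i).toLipCoef (by omega)).mul stepMesh_pos
      A.bigO_mesh).mono stepMesh_nonneg stepMesh_le_one (by norm_num)))
      (BigO.sum _ stepMesh_nonneg fun α _ => ?_)
    refine BigO.mul (r := 0) (s := 1) stepMesh_pos
      (A.bigO_coef_finePt (A.hc i α) (by omega)) ?_
    rcases α with k | β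
    · exact A.bigO_fineIncr m k
    · exact (A.bigO_fine_noise_inr m β).mono stepMesh_nonneg stepMesh_le_one (by norm_num)

theorem bigO_time_variation {f : Vec d → ℝ → ℝ} (hf : LipCoef E.T K f) {m l : ℕ} (hm : m ≤ M)
    (hl : l ≤ M) : E.StepO 2 (fun x ω => f (E.finePt M x.1 x.2 l ω) (E.fineTime M x.1 x.2 m) -
      f (E.finePt M x.1 x.2 l ω) (E.coarseTime M x.1 x.2)) := by
  have hX := A.bigO_finePt hl
  have hX1 : E.StepO 0 (fun x ω => 1 + ‖E.finePt M x.1 x.2 l ω‖) :=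
    (bigO_const (c := fun _ : StepIdx => (1 : ℝ)) 1 stepMesh_nonneg (by simp)).add
      (hX.norm stepMesh_nonneg)
  refine hX1.of_le_scaled (s := 2) stepMesh_nonneg (fun x => ?_) (K * E.T) fun x ω => ?_
  · exact ((hf.continuous (A.fineTime_mem hm x)).measurable.comp (A.measurable_finePt hl x)).sub
      ((hf.continuous (A.coarseTime_mem x)).measurable.comp (A.measurable_finePt hl x))
  · rw [Real.norm_of_nonneg (by positivity : 0 ≤ 1 + ‖E.finePt M x.1 x.2 l ω‖)]
    refine (hf.time _ _ (A.coarseTime_mem x) _ (A.fineTime_mem hm x)).trans ?_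
    have := A.hK
    calc _ ≤ K * (1 + ‖E.finePt M x.1 x.2 l ω‖) * (E.T * rootMesh x.1 ^ 2) := by
          gcongr
          exact A.abs_fineTime_sub_le hm x
      _ = _ := by ring

theorem bigO_variation {f : Vec d → ℝ → ℝ} (hf : LipCoef E.T K f) {m : ℕ} (hm : m ≤ M) :
    E.StepO 1 (fun x => E.variation M f x.1 x.2 m) := by
  have h1 := hf.bigO_sub stepMesh_nonneg (A.fineTime_mem hm) (A.measurable_finePt hm)
    (A.measurable_finePt (Nat.zero_le M)) (A.bigO_finePt_sub hm)
  have h2 := (A.bigO_time_variation hf hm (Nat.zero_le M)).mono stepMesh_nonneg stepMesh_le_one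
    (s := 1) (by norm_num)
  have := h1.add h2
  simp only [sub_add_sub_cancel] at this
  exact this

theorem bigO_frozen {m : ℕ} : E.StepO 1 (fun x => E.frozen M x.1 x.2 m) :=
  bigO_vec stepMesh_nonneg fun l => BigO.sum Finset.univ stepMesh_nonneg fun k _ =>
    BigO.mul (r := 0) (s := 1) stepMesh_pos (A.bigO_coef_init (A.hb l k).toLipCoef)
      (A.bigO_blockIncr m k)

/-- What freezing `b` drops at each fine step is the drift (order 2), the variation of `b` times an
increment (1 + 1) and the quadratic noise (order 2). -/
theorem bigO_finePt_sub_frozen {m : ℕ} (hm : m ≤ M) :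
    E.StepO 2 (fun x ω => E.finePt M x.1 x.2 m ω - E.finePt M x.1 x.2 0 ω -
      E.frozen M x.1 x.2 m ω) := by
  refine bigO_vec stepMesh_nonneg fun i => ?_
  induction m with
  | zero =>
    have : ∀ (x : StepIdx) ω, (E.finePt M x.1 x.2 0 ω - E.finePt M x.1 x.2 0 ω -
      E.frozen M x.1 x.2 0 ω) i = 0 := fun x ω => by
        simp [SDE.frozen, SDE.blockIncr, partialIncr]
    simp only [this]
    exact bigO_const 0 stepMesh_nonneg (by simp)
  | succ m ih =>
    have e : ∀ (x : StepIdx) ω, (E.finePt M x.1 x.2 (m + 1) ω - E.finePt M x.1 x.2 0 ω -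
        E.frozen M x.1 x.2 (m + 1) ω) i =
        (E.finePt M x.1 x.2 m ω - E.finePt M x.1 x.2 0 ω - E.frozen M x.1 x.2 m ω) i +
        (E.a i (E.finePt M x.1 x.2 m ω) (E.fineTime M x.1 x.2 m) * E.mesh M x.1 +
          (∑ j, E.variation M (E.b i j) x.1 x.2 m ω * E.fineIncr M x.1 x.2 m ω j +
          ∑ β, E.coef i (Sum.inr β) (E.finePt M x.1 x.2 m ω) (E.fineTime M x.1 x.2 m) *
            E.noise (E.mesh M x.1) (E.fineIncr M x.1 x.2 m ω) (Sum.inr β))) := fun x ω => by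
      rw [E.finePt_succ]
      simp only [PiLp.sub_apply, PiLp.add_apply, E.step_apply, Fintype.sum_sum_type, SDE.frozen,
        SDE.blockIncr_succ, mul_add, Finset.sum_add_distrib, SDE.variation, sub_mul,
        Finset.sum_sub_distrib, SDE.coef_inl, SDE.noise_inl]
      ring
    simp only [e]
    refine (ih (by omega)).add (BigO.add ?_ (BigO.add (BigO.sum _ stepMesh_nonneg fun j _ => ?_)
      (BigO.sum _ stepMesh_nonneg fun β _ => ?_)))
    · exact BigO.mul (r := 0) (s := 2) stepMesh_pos
        (A.bigO_coef_finePt (A.ha i).toLipCoef (by omega)) A.bigO_mesh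
    · exact BigO.mul (r := 1) (s := 1) stepMesh_pos
        (A.bigO_variation (A.hb i j).toLipCoef (by omega)) (A.bigO_fineIncr m j)
    · exact BigO.mul (r := 0) (s := 2) stepMesh_pos
        (A.bigO_coef_finePt (A.hc i _) (by omega)) (A.bigO_fine_noise_inr m β)

theorem bigO_fderiv {f : Vec d → ℝ → ℝ} (hf : SmoothCoef E.T K f) {r : ℕ}
    {v : StepIdx → (ℕ → Vec D) → Vec d} (hv : E.StepO r v) :
    E.StepO r (fun x ω => fderiv ℝ (fun y => f y (E.coarseTime M x.1 x.2))
      (E.finePt M x.1 x.2 0 ω) (v x ω)) := by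
  refine hv.of_le stepMesh_nonneg (fun x => ?_) K fun x ω => ?_
  · exact ((hf.contDiff _ (A.coarseTime_mem x)).continuous_fderiv_apply
      (by norm_num)).measurable.comp
      ((A.measurable_finePt (Nat.zero_le M) x).prodMk (hv.allMoments x).1)
  · exact (ContinuousLinearMap.le_opNorm _ _).trans
      (mul_le_mul_of_nonneg_right (hf.fderiv_le _ (A.coarseTime_mem x) _) (norm_nonneg _))

/-- Three errors of order 2: the change of time, the quadratic Taylor remainder in space, and the
derivative applied to the non-frozen part of the increment. -/
theorem bigO_remainder {f : Vec d → ℝ → ℝ} (hf : SmoothCoef E.T K f) {m : ℕ} (hm : m ≤ M) :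
    E.StepO 2 (fun x => E.remainder M f x.1 x.2 m) := by
  have hsub := A.bigO_finePt_sub hm
  have h1 := A.bigO_time_variation hf.toLipCoef hm hm
  have h3 := A.bigO_fderiv hf (A.bigO_finePt_sub_frozen hm)
  have h2 : E.StepO 2 (fun x ω => f (E.finePt M x.1 x.2 m ω) (E.coarseTime M x.1 x.2) -
      f (E.finePt M x.1 x.2 0 ω) (E.coarseTime M x.1 x.2) -
      fderiv ℝ (fun y => f y (E.coarseTime M x.1 x.2)) (E.finePt M x.1 x.2 0 ω)
        (E.finePt M x.1 x.2 m ω - E.finePt M x.1 x.2 0 ω)) := by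
    have hn := hsub.norm stepMesh_nonneg
    refine (hn.mul stepMesh_pos hn).of_le stepMesh_nonneg (fun x => ?_) K fun x ω => ?_
    · exact (((hf.continuous (A.coarseTime_mem x)).measurable.comp (A.measurable_finePt hm x)).sub
        ((hf.continuous (A.coarseTime_mem x)).measurable.comp
          (A.measurable_finePt (Nat.zero_le M) x))).sub ((A.bigO_fderiv hf hsub).allMoments x).1
    · rw [Real.norm_of_nonneg (mul_nonneg (norm_nonneg _) (norm_nonneg _)), ← sq]
      exact hf.taylor _ (A.coarseTime_mem x) _ _
  have := (h1.add h2).add h3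
  refine this.of_le stepMesh_nonneg (fun x => ?_) 1 fun x ω => ?_
  · exact (((hf.continuous (A.fineTime_mem hm x)).measurable.comp (A.measurable_finePt hm x)).sub
        ((hf.continuous (A.coarseTime_mem x)).measurable.comp
          (A.measurable_finePt (Nat.zero_le M) x))).sub
          ((A.bigO_fderiv hf A.bigO_frozen).allMoments x).1
  · rw [one_mul, SDE.remainder]
    simp only [map_sub]
    exact le_of_eq (congrArg _ (by ring))

theorem bigO_driftRem (i : Fin d) {m : ℕ} (hm : m ≤ M) :
    E.StepO 4 (fun x => E.driftRem M i x.1 x.2 m) :=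
  BigO.sum _ stepMesh_nonneg fun l hl => BigO.mul (r := 2) (s := 2) stepMesh_pos
    (A.bigO_remainder (A.ha i) (by have := Finset.mem_range.1 hl; omega)) A.bigO_mesh

/-- The three kinds of terms have orders 1 + 2, 2 + 1 and 1 + 2. The first, with the derivative of
`a`, would be too large for a drift error, which must have order 4; it is admissible here because it
is linear in the Brownian increment and hence centered. -/
theorem bigO_martRem (i : Fin d) {m : ℕ} (hm : m ≤ M) :
    E.StepO 3 (fun x => E.martRem M i x.1 x.2 m) := by
  refine BigO.sum _ stepMesh_nonneg fun l hl => ?_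
  have hl' : l ≤ M := by have := Finset.mem_range.1 hl; omega
  refine BigO.add (BigO.add ?_ (BigO.sum _ stepMesh_nonneg fun j _ => ?_))
    (BigO.sum _ stepMesh_nonneg fun β _ => ?_)
  · exact BigO.mul (r := 1) (s := 2) stepMesh_pos (A.bigO_fderiv (A.ha i) A.bigO_frozen) A.bigO_mesh
  · exact BigO.mul (r := 2) (s := 1) stepMesh_pos (A.bigO_remainder (A.hb i j) hl')
      (A.bigO_fineIncr l j)
  · exact BigO.mul (r := 1) (s := 2) stepMesh_pos (A.bigO_variation (A.hc i _) hl')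
      (A.bigO_fine_noise_inr l β)

theorem bigO_area (m : ℕ) (β : Fin D × Fin D) : E.StepO 2 (fun x => E.area M x.1 x.2 m β) :=
  BigO.sum _ stepMesh_nonneg fun l _ => BigO.sub stepMesh_nonneg
    (BigO.mul (r := 1) (s := 1) stepMesh_pos (A.bigO_blockIncr l β.2) (A.bigO_fineIncr l β.1))
    (BigO.mul (r := 1) (s := 1) stepMesh_pos (A.bigO_blockIncr l β.1) (A.bigO_fineIncr l β.2))

theorem bigO_areaTerm (i : Fin d) (m : ℕ) : E.StepO 2 (fun x => E.areaTerm M i x.1 x.2 m) :=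
  BigO.sum _ stepMesh_nonneg fun β _ => BigO.mul (r := 0) (s := 2) stepMesh_pos
    (A.bigO_coef_init (A.hc i _)) (A.bigO_area m β)

end SDE.Admissible

theorem SDE.dependsOn_blockIncr (N : ℕ+) (n m : ℕ) :
    DependsOn (E.blockIncr M N n m) (Set.Ico (n * M) (n * M + m)) :=
  dependsOn_partialIncr_scaled _ _ _

theorem SDE.dependsOn_fineIncr (N : ℕ+) (n m : ℕ) :
    DependsOn (E.fineIncr M N n m) (Set.Ico (n * M + m) (n * M + m + 1)) :=
  dependsOn_partialIncr_scaled _ _ _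

theorem SDE.dependsOn_variation (f : Vec d → ℝ → ℝ) (N : ℕ+) (n m : ℕ) :
    DependsOn (E.variation M f N n m) (Set.Iio (n * M + m)) := by
  intro x y h
  simp only [SDE.variation, E.dependsOn_finePt (M := M) N n m h,
    (E.dependsOn_finePt (M := M) N n 0).mono (Set.Iio_subset_Iio (by omega)) h]

theorem SDE.dependsOn_frozen (N : ℕ+) (n m : ℕ) :
    DependsOn (E.frozen M N n m) (Set.Iio (n * M + m)) := by
  intro x y h
  simp only [SDE.frozen, (E.dependsOn_finePt (M := M) N n 0).mono (Set.Iio_subset_Iio (by omega)) h,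
    (E.dependsOn_blockIncr (M := M) N n m).mono Set.Ico_subset_Iio_self h]

theorem SDE.dependsOn_remainder (f : Vec d → ℝ → ℝ) (N : ℕ+) (n m : ℕ) :
    DependsOn (E.remainder M f N n m) (Set.Iio (n * M + m)) := by
  intro x y h
  simp only [SDE.remainder, E.dependsOn_finePt (M := M) N n m h, E.dependsOn_frozen (M := M) N n m h,
    (E.dependsOn_finePt (M := M) N n 0).mono (Set.Iio_subset_Iio (by omega)) h]

theorem SDE.dependsOn_martRem (i : Fin d) (N : ℕ+) (n m : ℕ) :
    DependsOn (E.martRem M i N n m) (Set.Iio (n * M + m)) := by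
  intro x y h
  refine Finset.sum_congr rfl fun l hl => ?_
  have hl' := Finset.mem_range.1 hl
  simp only [(E.dependsOn_finePt (M := M) N n 0).mono (Set.Iio_subset_Iio (by omega)) h,
    (E.dependsOn_frozen (M := M) N n l).mono (Set.Iio_subset_Iio (by omega)) h,
    (E.dependsOn_remainder (M := M) _ N n l).mono (Set.Iio_subset_Iio (by omega)) h,
    (E.dependsOn_variation (M := M) _ N n l).mono (Set.Iio_subset_Iio (by omega)) h,
    (E.dependsOn_fineIncr (M := M) N n l).mono
      (Set.Ico_subset_Iio_self.trans (Set.Iio_subset_Iio (by omega))) h]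

theorem SDE.dependsOn_area (N : ℕ+) (n m : ℕ) (β : Fin D × Fin D) :
    DependsOn (E.area M N n m β) (Set.Iio (n * M + m)) := by
  intro x y h
  refine Finset.sum_congr rfl fun l hl => ?_
  have hl' := Finset.mem_range.1 hl
  simp only [(E.dependsOn_blockIncr (M := M) N n l).mono
      (Set.Ico_subset_Iio_self.trans (Set.Iio_subset_Iio (by omega))) h,
    (E.dependsOn_fineIncr (M := M) N n l).mono
      (Set.Ico_subset_Iio_self.trans (Set.Iio_subset_Iio (by omega))) h]

theorem SDE.dependsOn_areaTerm (i : Fin d) (N : ℕ+) (n m : ℕ) :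
    DependsOn (E.areaTerm M i N n m) (Set.Iio (n * M + m)) := by
  intro x y h
  simp only [SDE.areaTerm, (E.dependsOn_finePt (M := M) N n 0).mono (Set.Iio_subset_Iio (by omega)) h,
    E.dependsOn_area (M := M) N n m _ h]

namespace SDE.Admissible

variable (A : E.Admissible M K)
include A

theorem centered_mul_fineIncr {g : (ℕ → Vec D) → ℝ} (mg : AllMoments (noiseLaw E.corr) g)
    (N : ℕ+) (n l : ℕ) (dg : DependsOn g (Set.Iio (n * M + l))) (j : Fin D) :
    Centered (noiseLaw E.corr) (n * M) (fun ω => g ω * E.fineIncr M N n l ω j) := by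
  refine centered_mul (l := n * M + l + 1) (Nat.le_add_right _ l) mg ?_ dg (fun x y h => ?_)
    (integral_partialIncr_scaled _ (n * M + l) 1 j)
  · have : Measurable (E.fineIncr M N n l) := measurable_partialIncr_scaled _ _ _
    fun_prop
  · simp only [E.dependsOn_fineIncr (M := M) N n l h]

theorem centered_mul_fine_noise {g : (ℕ → Vec D) → ℝ} (mg : AllMoments (noiseLaw E.corr) g)
    (N : ℕ+) (n l : ℕ) (dg : DependsOn g (Set.Iio (n * M + l))) (β : Fin D × Fin D) :
    Centered (noiseLaw E.corr) (n * M) (fun ω => g ω *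
      E.noise (E.mesh M N) (E.fineIncr M N n l ω) (Sum.inr β)) := by
  have h0 := E.integral_noise A.hcorr (E.mesh_nonneg A.hT (M := M) N) (n * M + l) 1 (Sum.inr β)
  rw [Nat.cast_one, one_mul] at h0
  refine centered_mul (l := n * M + l + 1) (Nat.le_add_right _ l) mg ?_ dg (fun x y h => ?_) h0
  · have : Measurable (E.fineIncr M N n l) := measurable_partialIncr_scaled _ _ _
    exact (E.measurable_noise (E.mesh M N) (Sum.inr β)).comp this
  · simp only [E.dependsOn_fineIncr (M := M) N n l h]

theorem centered_mul_blockIncr {g : (ℕ → Vec D) → ℝ} (mg : AllMoments (noiseLaw E.corr) g)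
    (N : ℕ+) (n l : ℕ) (dg : DependsOn g (Set.Iio (n * M))) (j : Fin D) :
    Centered (noiseLaw E.corr) (n * M) (fun ω => g ω * E.blockIncr M N n l ω j) := by
  refine centered_mul (l := n * M + l) le_rfl mg ?_ dg (fun x y h => ?_)
    (integral_partialIncr_scaled _ (n * M) l j)
  · have : Measurable (E.blockIncr M N n l) := measurable_partialIncr_scaled _ _ _
    fun_prop
  · simp only [E.dependsOn_blockIncr (M := M) N n l h]

theorem centered_martRem (i : Fin d) (x : StepIdx) {m : ℕ} (hm : m ≤ M) :
    Centered (noiseLaw E.corr) (x.2 * M) (E.martRem M i x.1 x.2 m) := by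
  have hpart1 : ∀ l, Centered (noiseLaw E.corr) (x.2 * M) (fun ω =>
      fderiv ℝ (fun y => E.a i y (E.coarseTime M x.1 x.2)) (E.finePt M x.1 x.2 0 ω)
        (E.frozen M x.1 x.2 l ω) * E.mesh M x.1) := fun l => by
    simp only [E.fderiv_frozen, Finset.sum_mul _ _ (E.mesh M x.1)]
    have mb : ∀ k, AllMoments (noiseLaw E.corr) (fun ω =>
        ∑ l, E.b l k (E.finePt M x.1 x.2 0 ω) (E.coarseTime M x.1 x.2) *
          fderiv ℝ (fun y => E.a i y (E.coarseTime M x.1 x.2)) (E.finePt M x.1 x.2 0 ω)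
            (EuclideanSpace.single l 1)) := fun k => by
      refine AllMoments.sum _ fun l _ => ((A.bigO_coef_init (A.hb l k).toLipCoef).allMoments x).mul ?_
      exact (A.bigO_fderiv (A.ha i) (v := fun _ _ => EuclideanSpace.single l (1 : ℝ)) (r := 0)
        (bigO_const 1 stepMesh_nonneg (by simp))).allMoments x
    have mB := fun k => (A.bigO_blockIncr l k).allMoments x
    refine Centered.sum _ (fun k _ => ?_)
      fun k _ => ((mb k).mul (mB k)).mul (allMoments_const _)
    simp only [mul_comm _ (E.mesh M x.1)]
    refine (A.centered_mul_blockIncr (mb k) x.1 x.2 l (fun y z h => ?_) k).const_mul _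
    have := E.dependsOn_finePt (M := M) x.1 x.2 0 h
    simp only [this]
  have hpart2 : ∀ l < M, ∀ j, Centered (noiseLaw E.corr) (x.2 * M) (fun ω =>
      E.remainder M (E.b i j) x.1 x.2 l ω * E.fineIncr M x.1 x.2 l ω j) := fun l hl j =>
    A.centered_mul_fineIncr ((A.bigO_remainder (A.hb i j) hl.le).allMoments x) x.1 x.2 l
      (E.dependsOn_remainder (M := M) _ _ _ _) j
  have hpart3 : ∀ l < M, ∀ β, Centered (noiseLaw E.corr) (x.2 * M) (fun ω =>
      E.variation M (E.coef i (Sum.inr β)) x.1 x.2 l ω *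
        E.noise (E.mesh M x.1) (E.fineIncr M x.1 x.2 l ω) (Sum.inr β)) := fun l hl β =>
    A.centered_mul_fine_noise ((A.bigO_variation (A.hc i _) hl.le).allMoments x) x.1 x.2 l
      (E.dependsOn_variation (M := M) _ _ _ _) β
  have m1 : ∀ l, AllMoments (noiseLaw E.corr) (fun ω =>
      fderiv ℝ (fun y => E.a i y (E.coarseTime M x.1 x.2)) (E.finePt M x.1 x.2 0 ω)
        (E.frozen M x.1 x.2 l ω) * E.mesh M x.1) := fun l =>
    ((A.bigO_fderiv (A.ha i) A.bigO_frozen).allMoments x).mul (allMoments_const _)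
  have m2 : ∀ l < M, ∀ j, AllMoments (noiseLaw E.corr) (fun ω =>
      E.remainder M (E.b i j) x.1 x.2 l ω * E.fineIncr M x.1 x.2 l ω j) := fun l hl j =>
    ((A.bigO_remainder (A.hb i j) hl.le).allMoments x).mul ((A.bigO_fineIncr l j).allMoments x)
  have m3 : ∀ l < M, ∀ β, AllMoments (noiseLaw E.corr) (fun ω =>
      E.variation M (E.coef i (Sum.inr β)) x.1 x.2 l ω *
        E.noise (E.mesh M x.1) (E.fineIncr M x.1 x.2 l ω) (Sum.inr β)) := fun l hl β =>
    ((A.bigO_variation (A.hc i _) hl.le).allMoments x).mul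
      ((A.bigO_fine_noise_inr l β).allMoments x)
  have hlt : ∀ l ∈ Finset.range m, l < M := fun l hl => (Finset.mem_range.1 hl).trans_le hm
  refine Centered.sum _ (fun l hl => ?_) fun l hl => ?_
  · refine Centered.add (Centered.add (hpart1 l)
      (Centered.sum _ (fun j _ => hpart2 l (hlt l hl) j) fun j _ => m2 l (hlt l hl) j) (m1 l)
      (AllMoments.sum _ fun j _ => m2 l (hlt l hl) j))
      (Centered.sum _ (fun j _ => hpart3 l (hlt l hl) j) fun j _ => m3 l (hlt l hl) j)
      ((m1 l).add (AllMoments.sum _ fun j _ => m2 l (hlt l hl) j))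
      (AllMoments.sum _ fun j _ => m3 l (hlt l hl) j)
  · exact ((m1 l).add (AllMoments.sum _ fun j _ => m2 l (hlt l hl) j)).add
      (AllMoments.sum _ fun j _ => m3 l (hlt l hl) j)

/-- In each summand of the area, the block increment precedes the fine increment it is multiplied
by, so the latter is fresh mean-zero noise. -/
theorem centered_mul_area {g : (ℕ → Vec D) → ℝ} (mg : AllMoments (noiseLaw E.corr) g)
    (x : StepIdx) (m : ℕ) (dg : DependsOn g (Set.Iio (x.2 * M))) (β : Fin D × Fin D) :
    Centered (noiseLaw E.corr) (x.2 * M) (fun ω => g ω * E.area M x.1 x.2 m β ω) := by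
  unfold SDE.area
  have mB := fun l k => (A.bigO_blockIncr l k).allMoments x
  have mF := fun l k => (A.bigO_fineIncr l k).allMoments x
  have dgB : ∀ l k, DependsOn (fun ω => g ω * E.blockIncr M x.1 x.2 l ω k)
      (Set.Iio (x.2 * M + l)) := fun l k y z h => by
    simp only [dg.mono (Set.Iio_subset_Iio (by omega)) h,
      (E.dependsOn_blockIncr (M := M) x.1 x.2 l).mono Set.Ico_subset_Iio_self h]
  simp only [Finset.mul_sum, mul_sub, ← mul_assoc]
  have hm : ∀ l k k', AllMoments (noiseLaw E.corr) (fun ω =>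
      g ω * E.blockIncr M x.1 x.2 l ω k * E.fineIncr M x.1 x.2 l ω k') := fun l k k' =>
    (mg.mul (mB l k)).mul (mF l k')
  have hc : ∀ l k k', Centered (noiseLaw E.corr) (x.2 * M) (fun ω =>
      g ω * E.blockIncr M x.1 x.2 l ω k * E.fineIncr M x.1 x.2 l ω k') := fun l k k' =>
    A.centered_mul_fineIncr (mg.mul (mB l k)) x.1 x.2 l (dgB l k) k'
  simp only [sub_eq_add_neg, ← neg_one_mul (_ * E.fineIncr M _ _ _ _ _)]
  exact Centered.sum _ (fun l _ => (hc l β.2 β.1).add ((hc l β.1 β.2).const_mul (-1))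
    (hm l β.2 β.1) ((hm l β.1 β.2).const_mul (-1))) fun l _ =>
    (hm l β.2 β.1).add ((hm l β.1 β.2).const_mul (-1))

theorem centered_areaTerm (i : Fin d) (x : StepIdx) (m : ℕ) :
    Centered (noiseLaw E.corr) (x.2 * M) (E.areaTerm M i x.1 x.2 m) := by
  have mc : ∀ β, AllMoments (noiseLaw E.corr) (fun ω =>
      E.coef i (Sum.inr β) (E.finePt M x.1 x.2 0 ω) (E.coarseTime M x.1 x.2)) := fun β =>
    (A.bigO_coef_init (A.hc i (Sum.inr β))).allMoments x
  refine Centered.sum _ (fun β _ => A.centered_mul_area (mc β) x m (fun y z h => ?_) β)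
    fun β _ => (mc β).mul ((A.bigO_area m β).allMoments x)
  have := E.dependsOn_finePt (M := M) x.1 x.2 0 h
  simp only [this]

end SDE.Admissible

end Orders

/-! ### Reversal of the increments inside each block. -/

section Reversal

variable {d D : ℕ} {M : ℕ}

theorem reverseBlocks_apply (w : ℕ → Vec D) (n : ℕ) {m : ℕ} (hm : m < M) :
    reverseBlocks M w (n * M + m) = w (n * M + (M - 1 - m)) := by
  have hM : 0 < M := by omega
  rw [reverseBlocks, mul_comm n M, Nat.mul_add_div hM, Nat.mul_add_mod, Nat.div_eq_of_lt hm,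
    Nat.mod_eq_of_lt hm, add_zero, mul_comm]

theorem reverseBlocks_reverseBlocks (hM : 1 ≤ M) (w : ℕ → Vec D) :
    reverseBlocks M (reverseBlocks M w) = w := by
  funext k
  have hk := Nat.mod_lt k hM
  rw [← Nat.div_add_mod' k M, reverseBlocks_apply _ _ hk, reverseBlocks_apply _ _ (by omega)]
  congr 2
  omega

theorem sumBlocks_reverseBlocks (w : ℕ → Vec D) :
    sumBlocks M (reverseBlocks M w) = sumBlocks M w := by
  funext n
  rw [sumBlocks, sumBlocks, ← Finset.sum_range_reflect (fun m => w (n * M + m))]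
  exact Finset.sum_congr rfl fun m hm => reverseBlocks_apply w n (Finset.mem_range.1 hm)

theorem measurable_reverseBlocks :
    Measurable (reverseBlocks M : (ℕ → Vec D) → ℕ → Vec D) := by
  unfold reverseBlocks; fun_prop

/-- Block reversal is an involutive, hence injective, reindexing of an independent and identically
distributed sequence. -/
theorem measurePreserving_reverseBlocks (hM : 1 ≤ M) (R : Matrix (Fin D) (Fin D) ℝ) :
    MeasurePreserving (reverseBlocks M) (noiseLaw R) (noiseLaw R) := by
  refine ⟨measurable_reverseBlocks, ?_⟩
  have hinj : Function.Injective (fun k => k / M * M + (M - 1 - k % M)) := by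
    refine Function.LeftInverse.injective (g := fun k => k / M * M + (M - 1 - k % M)) fun k => ?_
    have hk := Nat.mod_lt k hM
    have h' : M - 1 - k % M < M := by omega
    simp only
    rw [mul_comm (k / M) M, Nat.mul_add_div hM, Nat.mul_add_mod, Nat.div_eq_of_lt h',
      Nat.mod_eq_of_lt h']
    have := Nat.div_add_mod k M
    rw [add_zero, mul_comm]
    omega
  have hind : iIndepFun (fun (i : ℕ) (ω : ℕ → Vec D) => ω i) (noiseLaw R) := by
    rw [noiseLaw, iIndepFun_iff_map_fun_eq_infinitePi_map (fun i => measurable_pi_apply i)]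
    simp only [Measure.infinitePi_map_eval, Measure.map_id']
  have := (iIndepFun_iff_map_fun_eq_infinitePi_map (fun i => measurable_pi_apply _)).1
    (hind.precomp hinj)
  refine this.trans ?_
  simp only [(measurePreserving_eval_noiseLaw (R := R) _).map_eq]
  rfl

/-- Indices never leave their block, so adaptedness survives at the coarse times `n * M`, although
not inside a block. -/
theorem dependsOn_comp_reverseBlocks {F : Type*} (hM : 1 ≤ M) {f : (ℕ → Vec D) → F} {n : ℕ}
    (hf : DependsOn f (Set.Iio (n * M))) :
    DependsOn (fun ω => f (reverseBlocks M ω)) (Set.Iio (n * M)) := by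
  intro x y h
  refine hf fun k hk => h _ ?_
  have h1 : k / M < n := (Nat.div_lt_iff_lt_mul hM).2 hk
  have h2 : (k / M + 1) * M ≤ n * M := Nat.mul_le_mul_right M h1
  rw [Set.mem_Iio]
  rw [add_one_mul] at h2
  omega

/-- The reversal is moved onto the test function, which stays adapted at time `n * M`; measure
invariance and involutivity do the rest. -/
theorem Centered.comp_reverseBlocks (hM : 1 ≤ M) {R : Matrix (Fin D) (Fin D) ℝ}
    {v : (ℕ → Vec D) → ℝ} (mv : Measurable v) {n : ℕ} (hv : Centered (noiseLaw R) (n * M) v) :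
    Centered (noiseLaw R) (n * M) (fun ω => v (reverseBlocks M ω)) := by
  intro X hX hd
  have hφ := measurePreserving_reverseBlocks (D := D) hM R
  have h1 := hv (fun ω => X (reverseBlocks M ω)) (hX.comp hφ) (dependsOn_comp_reverseBlocks hM hd)
  have hm : Measurable fun ω => X (reverseBlocks M ω) * v ω := (hX.1.comp hφ.measurable).mul mv
  rw [← hφ.map_eq, integral_map hφ.measurable.aemeasurable hm.aestronglyMeasurable] at h1
  simpa only [reverseBlocks_reverseBlocks hM] using h1

/-- The map `(l, k) ↦ (M - 1 - k, M - 1 - l)` permutes the pairs with `k < l < M`. Writing the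
triangle as a square with an indicator allows the two sums to be reflected and exchanged. -/
theorem sum_range_lt_reflect (G : ℕ → ℕ → ℝ) :
    ∑ l ∈ Finset.range M, ∑ k ∈ Finset.range l, G (M - 1 - k) (M - 1 - l) =
      ∑ l ∈ Finset.range M, ∑ k ∈ Finset.range l, G l k := by
  have h : ∀ F : ℕ → ℕ → ℝ, ∑ l ∈ Finset.range M, ∑ k ∈ Finset.range l, F l k =
      ∑ l ∈ Finset.range M, ∑ k ∈ Finset.range M, if k < l then F l k else 0 := fun F => by
    refine Finset.sum_congr rfl fun l hl => ?_
    have hl' := Finset.mem_range.1 hl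
    rw [← Finset.sum_filter]
    refine Finset.sum_congr ?_ fun _ _ => rfl
    ext k
    simp only [Finset.mem_filter, Finset.mem_range]
    omega
  rw [h, h, ← Finset.sum_range_reflect, Finset.sum_comm, ← Finset.sum_range_reflect]
  refine Finset.sum_congr rfl fun l hl => Finset.sum_congr rfl fun k hk => ?_
  have hl' := Finset.mem_range.1 hl
  have hk' := Finset.mem_range.1 hk
  have e1 : M - 1 - (M - 1 - l) = l := by omega
  have e2 : M - 1 - (M - 1 - k) = k := by omega
  rw [e1, e2]
  exact if_congr (by omega) rfl rfl

variable {E : SDE d D}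

theorem SDE.coarsePt_reverseBlocks (N : ℕ+) (n : ℕ) (ω : ℕ → Vec D) :
    E.coarsePt M N n (reverseBlocks M ω) = E.coarsePt M N n ω := by
  have : scaled (E.mesh M N) (reverseBlocks M ω) = reverseBlocks M (scaled (E.mesh M N) ω) := rfl
  rw [SDE.coarsePt, this, SDE.coarse, sumBlocks_reverseBlocks]
  rfl

theorem SDE.coarseIncr_reverseBlocks (N : ℕ+) (n : ℕ) (ω : ℕ → Vec D) :
    E.coarseIncr M N n (reverseBlocks M ω) = E.coarseIncr M N n ω :=
  congrFun (sumBlocks_reverseBlocks (M := M) (scaled (E.mesh M N) ω)) n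

theorem SDE.area_eq (N : ℕ+) (n m : ℕ) (β : Fin D × Fin D) (ω : ℕ → Vec D) :
    E.area M N n m β ω = ∑ l ∈ Finset.range m, ∑ k ∈ Finset.range l,
      (scaled (E.mesh M N) ω (n * M + k) β.2 * scaled (E.mesh M N) ω (n * M + l) β.1 -
        scaled (E.mesh M N) ω (n * M + k) β.1 * scaled (E.mesh M N) ω (n * M + l) β.2) := by
  refine Finset.sum_congr rfl fun l _ => ?_
  simp only [SDE.fineIncr_eq, SDE.blockIncr, partialIncr, WithLp.ofLp_sum, Finset.sum_apply,
    Finset.sum_mul, Finset.sum_sub_distrib]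

/-- The Lévy areas change sign when the increments are reversed. -/
theorem SDE.area_reverseBlocks (N : ℕ+) (n : ℕ) (β : Fin D × Fin D) (ω : ℕ → Vec D) :
    E.area M N n M β (reverseBlocks M ω) = -E.area M N n M β ω := by
  set w := scaled (E.mesh M N) ω with hw
  have hs : scaled (E.mesh M N) (reverseBlocks M ω) = reverseBlocks M w := rfl
  rw [SDE.area_eq, SDE.area_eq, hs, ← hw]
  have := sum_range_lt_reflect (M := M) (fun k l =>
    w (n * M + k) β.2 * w (n * M + l) β.1 - w (n * M + k) β.1 * w (n * M + l) β.2)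
  rw [← Finset.sum_neg_distrib]
  simp only [← Finset.sum_neg_distrib]
  refine Eq.trans (Finset.sum_congr rfl fun l hl => Finset.sum_congr rfl fun k hk => ?_)
    (this.trans (Finset.sum_congr rfl fun l _ => Finset.sum_congr rfl fun k _ => by ring))
  have hl' := Finset.mem_range.1 hl
  have hk' := Finset.mem_range.1 hk
  rw [reverseBlocks_apply _ _ hl', reverseBlocks_apply _ _ (by omega)]

end Reversal

/-! ### Strong error of the fine, antithetic and averaged paths. -/

section Strong

variable {d D : ℕ} {E : SDE d D} {M : ℕ} {K : ℝ}

theorem SDE.finePt_last (N : ℕ+) (n : ℕ) (ω : ℕ → Vec D) :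
    E.finePt M N n M ω = E.finePt M N (n + 1) 0 ω := by
  rw [SDE.finePt, SDE.finePt, add_zero, add_one_mul]

theorem SDE.coarse_expansion (i : Fin d) (N : ℕ+) (n : ℕ) (ω : ℕ → Vec D) :
    E.finePt M N (n + 1) 0 ω i = E.finePt M N n 0 ω i +
      E.step (E.finePt M N n 0 ω) (n * (M * E.mesh M N)) (M * E.mesh M N) (E.coarseIncr M N n ω) i +
      E.areaTerm M i N n M ω + E.driftRem M i N n M ω + E.martRem M i N n M ω := by
  rw [← E.finePt_last]
  exact E.finePt_expansion i N n M ω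

theorem BigO.stepO_of_partialSups {F : Type*} [NormedAddCommGroup F] [MeasurableSpace F]
    [BorelSpace F] {r : ℕ} {g : ℕ+ → ℕ → (ℕ → Vec D) → F}
    (h : BigO (noiseLaw E.corr) rootMesh r (fun N ω => partialSups (fun n => ‖g N n ω‖) (N : ℕ)))
    (hg : ∀ x : StepIdx, Measurable (g x.1 x.2)) : E.StepO r (fun x => g x.1 x.2) :=
  (h.reindex (fun x : StepIdx => x.1)).of_le stepMesh_nonneg hg 1 fun x ω => by
    rw [one_mul]
    exact (le_partialSups_of_le (fun n => ‖g x.1 n ω‖) x.2.2.le).trans (le_abs_self _)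

/-- The average of the fine and the antithetic path on the canonical space. -/
def SDE.avgPt (E : SDE d D) (M : ℕ) (N : ℕ+) (n : ℕ) (ω : ℕ → Vec D) : Vec d :=
  (1 / 2 : ℝ) • (E.finePt M N n 0 ω + E.finePt M N n 0 (reverseBlocks M ω))

/-- The midpoint defect of `f` on the fine and the antithetic path. -/
def SDE.midDefect (E : SDE d D) (M : ℕ) (f : Vec d → ℝ → ℝ) (N : ℕ+) (n : ℕ) (ω : ℕ → Vec D) : ℝ :=
  (f (E.finePt M N n 0 ω) (E.coarseTime M N n) +
    f (E.finePt M N n 0 (reverseBlocks M ω)) (E.coarseTime M N n)) / 2 -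
  f (E.avgPt M N n ω) (E.coarseTime M N n)

theorem midpoint_sub (x y : Vec d) :
    ‖x - (1 / 2 : ℝ) • (x + y)‖ = 1 / 2 * ‖x - y‖ ∧
      ‖y - (1 / 2 : ℝ) • (x + y)‖ = 1 / 2 * ‖x - y‖ := by
  constructor
  · have : x - (1 / 2 : ℝ) • (x + y) = (1 / 2 : ℝ) • (x - y) := by module
    rw [this, norm_smul]; norm_num
  · have : y - (1 / 2 : ℝ) • (x + y) = (1 / 2 : ℝ) • (y - x) := by module
    rw [this, norm_smul, norm_sub_rev y x]; norm_num

theorem abs_midpoint_le_of_lip {f : Vec d → ℝ} {K : ℝ} (h : ∀ x y, |f x - f y| ≤ K * ‖x - y‖)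
    (x y : Vec d) : |(f x + f y) / 2 - f ((1 / 2 : ℝ) • (x + y))| ≤ K * ‖x - y‖ := by
  have h1 := h x ((1 / 2 : ℝ) • (x + y))
  have h2 := h y ((1 / 2 : ℝ) • (x + y))
  rw [(midpoint_sub x y).1] at h1
  rw [(midpoint_sub x y).2] at h2
  have h3 := (abs_nonneg _).trans h1
  rw [abs_le] at *
  constructor <;> linarith [h1.1, h1.2, h2.1, h2.2]

/-- Expanding at the midpoint, the two linear terms are opposite and cancel. -/
theorem abs_midpoint_le_of_taylor {f : Vec d → ℝ} {K : ℝ}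
    (h : ∀ x y, |f y - f x - fderiv ℝ f x (y - x)| ≤ K * ‖y - x‖ ^ 2) (x y : Vec d) :
    |(f x + f y) / 2 - f ((1 / 2 : ℝ) • (x + y))| ≤ K * ‖x - y‖ ^ 2 := by
  have h1 := h ((1 / 2 : ℝ) • (x + y)) x
  have h2 := h ((1 / 2 : ℝ) • (x + y)) y
  rw [(midpoint_sub x y).1] at h1
  rw [(midpoint_sub x y).2] at h2
  have e : y - (1 / 2 : ℝ) • (x + y) = -(x - (1 / 2 : ℝ) • (x + y)) := by module
  rw [e, map_neg] at h2
  have h3 := (abs_nonneg _).trans h1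
  rw [abs_le] at *
  constructor <;> nlinarith [h1.1, h1.2, h2.1, h2.2]

namespace SDE.Admissible

variable (A : E.Admissible M K)
include A

theorem measurePreserving_rev :
    MeasurePreserving (reverseBlocks M) (noiseLaw E.corr) (noiseLaw E.corr) :=
  measurePreserving_reverseBlocks A.hM E.corr

theorem allMoments_finePt_zero (N : ℕ+) {n : ℕ} (hn : n ≤ N) :
    AllMoments (noiseLaw E.corr) (E.finePt M N n 0) :=
  E.allMoments_finePt A.hT A.hM (fun i => (A.ha i).toLipCoef) A.hc (Nat.mul_le_mul_right M hn)

theorem allMoments_coarsePt (N : ℕ+) {n : ℕ} (hn : n ≤ N) :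
    AllMoments (noiseLaw E.corr) (E.coarsePt M N n) :=
  E.allMoments_coarsePt A.hT A.hM (fun i => (A.ha i).toLipCoef) A.hc hn

theorem allMoments_avgPt (N : ℕ+) {n : ℕ} (hn : n ≤ N) :
    AllMoments (noiseLaw E.corr) (E.avgPt M N n) := by
  have h := A.allMoments_finePt_zero N hn
  have h2 := h.add (h.comp A.measurePreserving_rev)
  exact h2.of_le (h2.1.const_smul (1 / 2 : ℝ)) (1 / 2) fun ω => by
    rw [SDE.avgPt, norm_smul]; norm_num

/-- The fine path converges to the coarse path with strong order one half. -/
theorem bigO_fine_sub_coarse : BigO (noiseLaw E.corr) rootMesh 1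
    (fun N ω => partialSups (fun n => ‖E.finePt M N n 0 ω - E.coarsePt M N n ω‖) (N : ℕ)) := by
  refine E.integral_partialSups_dev_le A.hT A.hcorr A.hM A.hK (fun i => (A.ha i).toLipCoef) A.hc 1
    (fun N n => E.finePt M N n 0) (E.coarsePt M) (fun i N n => E.driftRem M i N n M)
    (fun i N n ω => E.areaTerm M i N n M ω + E.martRem M i N n M ω)
    (fun N n hn => A.allMoments_finePt_zero N hn) (fun N n hn => A.allMoments_coarsePt N hn)
    (fun N n _ => E.dependsOn_finePt N n 0) (fun N n _ => E.dependsOn_coarsePt N n) ?_ ?_ ?_ ?_ ?_ ?_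
  · exact fun i => (A.bigO_driftRem i le_rfl).mono stepMesh_nonneg stepMesh_le_one (by norm_num)
  -- The area term has order 2 only, and is what limits this estimate to `r = 1`.
  · exact fun i => (A.bigO_areaTerm i M).add
      ((A.bigO_martRem i le_rfl).mono stepMesh_nonneg stepMesh_le_one (by norm_num))
  · intro i N n hn x y h
    rw [add_one_mul] at h
    simp only [E.dependsOn_areaTerm i N n M h, E.dependsOn_martRem i N n M h]
  · exact fun i N n hn => (A.centered_areaTerm i ⟨N, n, hn⟩ M).add
      (A.centered_martRem i ⟨N, n, hn⟩ le_rfl) ((A.bigO_areaTerm i M).allMoments ⟨N, n, hn⟩)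
      ((A.bigO_martRem i le_rfl).allMoments ⟨N, n, hn⟩)
  · intro N ω
    simp only [SDE.finePt, zero_mul, add_zero]
    rfl
  · intro N n hn ω i
    rw [E.coarse_expansion, SDE.coarsePt_succ, PiLp.add_apply]
    ring

/-- Composition with the reversal, which preserves the law and fixes the coarse path. -/
theorem bigO_anti_sub_coarse : BigO (noiseLaw E.corr) rootMesh 1
    (fun N ω => partialSups (fun n => ‖E.finePt M N n 0 (reverseBlocks M ω) -
      E.coarsePt M N n ω‖) (N : ℕ)) := by
  have := A.bigO_fine_sub_coarse.comp A.measurePreserving_rev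
  simpa only [E.coarsePt_reverseBlocks] using this

theorem bigO_fine_sub_anti : E.StepO 1 (fun x ω =>
    E.finePt M x.1 x.2 0 ω - E.finePt M x.1 x.2 0 (reverseBlocks M ω)) := by
  have m1 : ∀ x : StepIdx, Measurable (E.finePt M x.1 x.2 0) := A.measurable_finePt (Nat.zero_le M)
  have m2 : ∀ x : StepIdx, Measurable (E.coarsePt M x.1 x.2) := fun x =>
    (A.allMoments_coarsePt x.1 x.2.2.le).1
  have h1 := A.bigO_fine_sub_coarse.stepO_of_partialSups fun x => (m1 x).sub (m2 x)
  have h2 := A.bigO_anti_sub_coarse.stepO_of_partialSups fun x =>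
    ((m1 x).comp A.measurePreserving_rev.measurable).sub (m2 x)
  simpa using h1.vec_sub stepMesh_nonneg h2

theorem measurable_midDefect {f : Vec d → ℝ → ℝ} (hf : LipCoef E.T K f) (x : StepIdx) :
    Measurable (E.midDefect M f x.1 x.2) := by
  have hc := (hf.continuous (A.coarseTime_mem x)).measurable
  have m1 := A.measurable_finePt (Nat.zero_le M) x
  have m2 := m1.comp A.measurePreserving_rev.measurable
  exact (((hc.comp m1).add (hc.comp m2)).div_const 2).sub
    (hc.comp (A.allMoments_avgPt x.1 x.2.2.le).1)

theorem bigO_midDefect_lip {f : Vec d → ℝ → ℝ} (hf : LipCoef E.T K f) :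
    E.StepO 1 (fun x => E.midDefect M f x.1 x.2) :=
  A.bigO_fine_sub_anti.of_le stepMesh_nonneg (A.measurable_midDefect hf) K fun x _ =>
    abs_midpoint_le_of_lip (hf.lip _ (A.coarseTime_mem x)) _ _

theorem bigO_midDefect_smooth {f : Vec d → ℝ → ℝ} (hf : SmoothCoef E.T K f) :
    E.StepO 2 (fun x => E.midDefect M f x.1 x.2) := by
  have hn := A.bigO_fine_sub_anti.norm stepMesh_nonneg
  refine (BigO.mul (r := 1) (s := 1) stepMesh_pos hn hn).of_le stepMesh_nonneg
    (A.measurable_midDefect hf.toLipCoef) K fun x ω => ?_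
  rw [Real.norm_of_nonneg (mul_nonneg (norm_nonneg _) (norm_nonneg _)), ← sq]
  exact abs_midpoint_le_of_taylor (hf.taylor _ (A.coarseTime_mem x)) _ _

theorem bigO_coarse_noise (α : Fin D ⊕ Fin D × Fin D) : E.StepO 1 (fun x ω =>
    E.noise (M * E.mesh M x.1) (E.coarseIncr M x.1 x.2 ω) α) :=
  E.bigO_noise stepMesh_pos stepMesh_le_one (c := fun x : StepIdx => E.mesh M x.1)
    (fun x => E.mesh_nonneg A.hT x.1) (fun x => E.sqrt_mesh_le A.hT A.hM x.1)
    (fun x => x.2 * M) M α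

theorem bigO_coarse_noise_inr (β : Fin D × Fin D) : E.StepO 2 (fun x ω =>
    E.noise (M * E.mesh M x.1) (E.coarseIncr M x.1 x.2 ω) (Sum.inr β)) :=
  E.bigO_noise_inr stepMesh_pos (c := fun x : StepIdx => E.mesh M x.1)
    (fun x => E.mesh_nonneg A.hT x.1) (fun x => E.sqrt_mesh_le A.hT A.hM x.1)
    (fun x => x.2 * M) M β

/-- Order 3 arises in two ways: 2 + 1 for the smooth `b` with a linear noise term, 1 + 2 for the
Lipschitz `hCoeff` with a quadratic one. -/
theorem bigO_midDefect_mul_noise (i : Fin d) (α : Fin D ⊕ Fin D × Fin D) : E.StepO 3 (fun x ω =>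
    E.midDefect M (E.coef i α) x.1 x.2 ω *
      E.noise (M * E.mesh M x.1) (E.coarseIncr M x.1 x.2 ω) α) := by
  rcases α with j | β
  · exact BigO.mul (r := 2) (s := 1) stepMesh_pos (A.bigO_midDefect_smooth (A.hb i j))
      (A.bigO_coarse_noise _)
  · exact BigO.mul (r := 1) (s := 2) stepMesh_pos (A.bigO_midDefect_lip (A.hc i _))
      (A.bigO_coarse_noise_inr β)

theorem centered_midDefect_mul_noise (i : Fin d) (α : Fin D ⊕ Fin D × Fin D) (x : StepIdx) :
    Centered (noiseLaw E.corr) (x.2 * M) (fun ω => E.midDefect M (E.coef i α) x.1 x.2 ω *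
      E.noise (M * E.mesh M x.1) (E.coarseIncr M x.1 x.2 ω) α) := by
  refine centered_mul (l := x.2 * M + M) le_rfl
    ((A.bigO_midDefect_lip (A.hc i α)).allMoments x) ((A.bigO_coarse_noise α).allMoments x).1
    (fun y z h => ?_) (fun y z h => ?_)
    (E.integral_noise A.hcorr (E.mesh_nonneg A.hT x.1) (x.2 * M) M α)
  · have h1 := E.dependsOn_finePt (M := M) x.1 x.2 0
    have h2 := dependsOn_comp_reverseBlocks A.hM h1 h
    simp only [SDE.midDefect, SDE.avgPt, h1 h, h2]
  · have := dependsOn_partialIncr_scaled (D := D) (E.mesh M x.1) (x.2 * M) M h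
    simp only at this
    simp only [SDE.coarseIncr, this]

/-- The half difference of a coefficient between the fine and the antithetic path, times the
Lévy area. -/
theorem bigO_diff_mul_area (i : Fin d) (β : Fin D × Fin D) : E.StepO 3 (fun x ω =>
    (E.coef i (Sum.inr β) (E.finePt M x.1 x.2 0 ω) (E.coarseTime M x.1 x.2) -
      E.coef i (Sum.inr β) (E.finePt M x.1 x.2 0 (reverseBlocks M ω)) (E.coarseTime M x.1 x.2)) *
      E.area M x.1 x.2 M β ω) :=
  BigO.mul (r := 1) (s := 2) stepMesh_pos ((A.hc i _).bigO_sub stepMesh_nonneg A.coarseTime_mem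
    (A.measurable_finePt (Nat.zero_le M)) (fun x => (A.measurable_finePt (Nat.zero_le M) x).comp
      A.measurePreserving_rev.measurable) A.bigO_fine_sub_anti) (A.bigO_area M β)

theorem centered_diff_mul_area (i : Fin d) (β : Fin D × Fin D) (x : StepIdx) :
    Centered (noiseLaw E.corr) (x.2 * M) (fun ω =>
    (E.coef i (Sum.inr β) (E.finePt M x.1 x.2 0 ω) (E.coarseTime M x.1 x.2) -
      E.coef i (Sum.inr β) (E.finePt M x.1 x.2 0 (reverseBlocks M ω)) (E.coarseTime M x.1 x.2)) *
      E.area M x.1 x.2 M β ω) := by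
  have h0 := (A.bigO_coef_init (A.hc i (Sum.inr β))).allMoments x
  refine A.centered_mul_area (h0.sub (h0.comp A.measurePreserving_rev)) x M (fun y z h => ?_) β
  have h1 := E.dependsOn_finePt (M := M) x.1 x.2 0
  have h2 := dependsOn_comp_reverseBlocks A.hM h1 h
  simp only [h1 h, h2]

/-- The averaged fine path converges to the coarse path with strong order one. -/
theorem bigO_avg_sub_coarse : BigO (noiseLaw E.corr) rootMesh 2
    (fun N ω => partialSups (fun n => ‖E.avgPt M N n ω - E.coarsePt M N n ω‖) (N : ℕ)) := by
  have hrev := A.measurePreserving_rev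
  have dF := fun (N : ℕ+) n => E.dependsOn_finePt (M := M) N n 0
  have dA := fun (N : ℕ+) n => dependsOn_comp_reverseBlocks A.hM (dF N n)
  have hV1 := fun i => BigO.sum (Finset.univ : Finset (Fin D ⊕ Fin D × Fin D)) stepMesh_nonneg
    fun α _ => A.bigO_midDefect_mul_noise i α
  have hV2 := fun i => (BigO.sum (Finset.univ : Finset (Fin D × Fin D)) stepMesh_nonneg
    fun β _ => A.bigO_diff_mul_area i β).const_mul stepMesh_nonneg (1 / 2)
  have hR := fun i => A.bigO_martRem i (m := M) le_rfl
  have hV3 := fun i => ((hR i).add ((hR i).comp hrev)).const_mul stepMesh_nonneg (1 / 2)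
  have hV := fun i => ((hV1 i).add (hV2 i)).add (hV3 i)
  refine E.integral_partialSups_dev_le A.hT A.hcorr A.hM A.hK (fun i => (A.ha i).toLipCoef) A.hc 2
    (E.avgPt M) (E.coarsePt M)
    -- The average of the two one-step expansions, minus the scheme step at the average: a drift
    -- error of order 4, and a centered error of order 3 made of the midpoint defects times noise,
    -- the areas times half the coefficient difference, and the averaged martingale remainders.
    (fun i N n ω => E.midDefect M (E.a i) N n ω * (M * E.mesh M N) +
      1 / 2 * (E.driftRem M i N n M ω + E.driftRem M i N n M (reverseBlocks M ω)))
    (fun i N n ω => ∑ α, E.midDefect M (E.coef i α) N n ω *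
        E.noise (M * E.mesh M N) (E.coarseIncr M N n ω) α +
      1 / 2 * ∑ β, (E.coef i (Sum.inr β) (E.finePt M N n 0 ω) (E.coarseTime M N n) -
        E.coef i (Sum.inr β) (E.finePt M N n 0 (reverseBlocks M ω)) (E.coarseTime M N n)) *
        E.area M N n M β ω +
      1 / 2 * (E.martRem M i N n M ω + E.martRem M i N n M (reverseBlocks M ω)))
    (fun N n hn => A.allMoments_avgPt N hn) (fun N n hn => A.allMoments_coarsePt N hn)
    (fun N n _ x y h => ?_) (fun N n _ => E.dependsOn_coarsePt N n) ?_ hV ?_ ?_ ?_ ?_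
  · have h1 := dF N n h
    have h2 := dA N n h
    simp only [SDE.avgPt, h1, h2]
  · intro i
    have hR := A.bigO_driftRem i (m := M) le_rfl
    refine BigO.add (BigO.mul (r := 2) (s := 2) stepMesh_pos (A.bigO_midDefect_smooth (A.ha i)) ?_)
      ((hR.add (hR.comp hrev)).const_mul stepMesh_nonneg (1 / 2))
    exact (A.bigO_mesh).const_mul stepMesh_nonneg (M : ℝ)
  · intro i N n hn x y h
    have hle : n * M ≤ (n + 1) * M := Nat.mul_le_mul_right M (Nat.le_succ n)
    have h' : ∀ k ∈ Set.Iio (n * M), x k = y k := fun k hk => h k (Set.Iio_subset_Iio hle hk)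
    have h1 := dF N n h'
    have h2 := dA N n h'
    have h3 : E.coarseIncr M N n x = E.coarseIncr M N n y :=
      dependsOn_partialIncr_scaled (D := D) (E.mesh M N) (n * M) M
        fun k hk => h k (by rw [Set.mem_Iio, add_one_mul]; exact hk.2)
    have hm := E.dependsOn_martRem (M := M) i N n M
    have ha := fun β => E.dependsOn_area (M := M) N n M β
    rw [← add_one_mul] at hm
    simp only [← add_one_mul] at ha
    have h4 := hm h
    have h5 := dependsOn_comp_reverseBlocks A.hM hm h
    have h6 := fun β => ha β h
    simp only [SDE.midDefect, SDE.avgPt, h1, h2, h3, h4, h5, h6]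
  · intro i N n hn
    set x : StepIdx := ⟨N, n, hn⟩
    have mR := (hR i).allMoments x
    have cR := A.centered_martRem i x (m := M) le_rfl
    refine Centered.add (Centered.add (Centered.sum _
      (fun α _ => A.centered_midDefect_mul_noise i α x) fun α _ =>
        (A.bigO_midDefect_mul_noise i α).allMoments x) (Centered.const_mul (Centered.sum _
      (fun β _ => A.centered_diff_mul_area i β x) fun β _ =>
        (A.bigO_diff_mul_area i β).allMoments x) _) ((hV1 i).allMoments x) ((hV2 i).allMoments x))
      (Centered.const_mul (Centered.add cR (cR.comp_reverseBlocks A.hM mR.1) mR (mR.comp hrev)) _)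
      (((hV1 i).add (hV2 i)).allMoments x) ((hV3 i).allMoments x)
  · intro N ω
    simp only [SDE.avgPt, SDE.finePt, zero_mul, add_zero, SDE.path]
    change _ = E.init
    module
  · intro N n hn ω i
    have e1 := E.coarse_expansion (M := M) i N n ω
    have e2 := E.coarse_expansion (M := M) i N n (reverseBlocks M ω)
    -- The antithetic cancellation: the areas of the two paths are opposite, so averaging leaves
    -- only the difference of their coefficients.
    have e3 : E.areaTerm M i N n M (reverseBlocks M ω) = -∑ β : Fin D × Fin D,
        E.coef i (Sum.inr β) (E.finePt M N n 0 (reverseBlocks M ω)) (E.coarseTime M N n) *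
        E.area M N n M β ω := by
      simp only [SDE.areaTerm, E.area_reverseBlocks, mul_neg, Finset.sum_neg_distrib]
    have e4 : ∀ k, E.avgPt M N k ω i =
        1 / 2 * (E.finePt M N k 0 ω i + E.finePt M N k 0 (reverseBlocks M ω) i) := fun k => rfl
    rw [E.coarseIncr_reverseBlocks, e3] at e2
    rw [SDE.coarsePt_succ, PiLp.add_apply, e4, e4, e1, e2, E.step_apply (E.avgPt M N n ω)]
    simp only [E.step_apply (E.finePt M N n 0 _), SDE.midDefect, SDE.areaTerm, sub_mul,
      Finset.sum_sub_distrib, SDE.coarseTime]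
    have e5 : ∑ α, (E.coef i α (E.finePt M N n 0 ω) (n * (M * E.mesh M N)) +
        E.coef i α (E.finePt M N n 0 (reverseBlocks M ω)) (n * (M * E.mesh M N))) / 2 *
        E.noise (M * E.mesh M N) (E.coarseIncr M N n ω) α =
        1 / 2 * (∑ α, E.coef i α (E.finePt M N n 0 ω) (n * (M * E.mesh M N)) *
          E.noise (M * E.mesh M N) (E.coarseIncr M N n ω) α +
        ∑ α, E.coef i α (E.finePt M N n 0 (reverseBlocks M ω)) (n * (M * E.mesh M N)) *
          E.noise (M * E.mesh M N) (E.coarseIncr M N n ω) α) := by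
      rw [← Finset.sum_add_distrib, Finset.mul_sum]
      exact Finset.sum_congr rfl fun α _ => by ring
    rw [e5]
    ring

end SDE.Admissible

end Strong

/-! ### Transfer from Brownian increments to the canonical noise. -/

section Law

variable {D : ℕ} {R : Matrix (Fin D) (Fin D) ℝ}

theorem multivariateGaussian_smul (hR : R.PosSemidef) {h : ℝ} (hh : 0 ≤ h) :
    multivariateGaussian (0 : Vec D) (h • R) =
      (multivariateGaussian (0 : Vec D) R).map (fun x => Real.sqrt h • x) := by
  have : IsProbabilityMeasure
      ((multivariateGaussian (0 : Vec D) R).map (fun x => Real.sqrt h • x)) :=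
    Measure.isProbabilityMeasure_map (by fun_prop)
  refine Measure.ext_of_charFun ?_
  funext x
  rw [charFun_map_smul, charFun_multivariateGaussian (hR.smul hh), charFun_multivariateGaussian hR]
  congr 1
  simp only [inner_zero_right, Complex.ofReal_zero, zero_mul, zero_sub, WithLp.ofLp_smul,
    Matrix.mulVec_smul, Matrix.smul_mulVec, dotProduct_smul, smul_dotProduct, smul_eq_mul]
  rw [← mul_assoc, Real.mul_self_sqrt hh]

variable {Ω : Type*} [MeasurableSpace Ω] {μ : Measure Ω} [IsProbabilityMeasure μ]
  {W : ℝ≥0 → Ω → Vec D}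

theorem IsBrownian.measurable_increments (hW : IsBrownian R μ W) (h : ℝ) :
    Measurable (increments W h) :=
  measurable_pi_lambda _ fun _ => (hW.measurable _).sub (hW.measurable _)

/-- The increments of a Brownian motion over time steps of length `h` are independent Gaussian
vectors. -/
theorem IsBrownian.map_increments (hR : R.PosSemidef) (hW : IsBrownian R μ W) {h : ℝ}
    (hh : 0 ≤ h) : μ.map (increments W h) = (noiseLaw R).map (scaled h) := by
  have ht : Monotone fun k : ℕ => ((k : ℝ) * h).toNNReal := fun a b hab =>
    Real.toNNReal_le_toNNReal (mul_le_mul_of_nonneg_right (by exact_mod_cast hab) hh)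
  have hind := hW.indep.nat ht
  have hlaw := (iIndepFun_iff_map_fun_eq_infinitePi_map fun i =>
    (hW.measurable _).sub (hW.measurable _)).1 hind
  have hinc : (fun ω (k : ℕ) => W (((k + 1 : ℕ) : ℝ) * h).toNNReal ω - W ((k : ℝ) * h).toNNReal ω) =
      increments W h := by
    funext ω k
    simp only [increments, Nat.cast_add, Nat.cast_one]
  have hk : ∀ k : ℕ, μ.map
      (W (((k + 1 : ℕ) : ℝ) * h).toNNReal - W ((k : ℝ) * h).toNNReal) =
      (multivariateGaussian (0 : Vec D) R).map (fun x => Real.sqrt h • x) := fun k => by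
    refine (hW.law _ _ (ht (Nat.le_succ k))).trans ?_
    rw [← multivariateGaussian_smul hR hh]
    congr 2
    rw [Real.coe_toNNReal _ (by positivity), Real.coe_toNNReal _ (by positivity)]
    push_cast
    ring
  rw [← hinc]
  refine hlaw.trans ?_
  beta_reduce
  simp only [hk]
  exact (Measure.infinitePi_map_pi (μ := fun _ : ℕ => multivariateGaussian (0 : Vec D) R)
    (f := fun _ x => Real.sqrt h • x) fun _ => by fun_prop).symm

theorem IsBrownian.integral_increments (hR : R.PosSemidef) (hW : IsBrownian R μ W) {h : ℝ}
    (hh : 0 ≤ h) {F : (ℕ → Vec D) → ℝ} (mF : Measurable F) :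
    ∫ ω, F (increments W h ω) ∂μ = ∫ ω, F (scaled h ω) ∂(noiseLaw R) := by
  rw [← integral_map (hW.measurable_increments h).aemeasurable mF.aestronglyMeasurable,
    hW.map_increments hR hh, integral_map (measurable_scaled h).aemeasurable
      mF.aestronglyMeasurable]

theorem IsBrownian.integrable_increments (hR : R.PosSemidef) (hW : IsBrownian R μ W) {h : ℝ}
    (hh : 0 ≤ h) {F : (ℕ → Vec D) → ℝ} (mF : Measurable F)
    (hF : Integrable (fun ω => F (scaled h ω)) (noiseLaw R)) :
    Integrable (fun ω => F (increments W h ω)) μ := by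
  have h1 := (integrable_map_measure (μ := noiseLaw R) (f := scaled h) mF.aestronglyMeasurable
    (measurable_scaled h).aemeasurable).2 hF
  rw [← hW.map_increments hR hh] at h1
  exact h1.comp_measurable (hW.measurable_increments h)

theorem IsBrownian.memLp_increments (hR : R.PosSemidef) (hW : IsBrownian R μ W) {h : ℝ}
    (hh : 0 ≤ h) {F : (ℕ → Vec D) → ℝ} (mF : Measurable F)
    (hF : AllMoments (noiseLaw R) (fun ω => F (scaled h ω))) :
    MemLp (fun ω => F (increments W h ω)) 2 μ := by
  have m : AEStronglyMeasurable (fun ω => F (increments W h ω)) μ :=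
    (mF.comp (hW.measurable_increments h)).aestronglyMeasurable
  rw [memLp_two_iff_integrable_sq m]
  exact hW.integrable_increments hR hh (mF.pow_const 2) (by simpa using hF.2 2)

theorem IsBrownian.variance_increments (hR : R.PosSemidef) (hW : IsBrownian R μ W) {h : ℝ}
    (hh : 0 ≤ h) {F : (ℕ → Vec D) → ℝ} (mF : Measurable F) :
    Var[fun ω => F (increments W h ω); μ] = Var[fun ω => F (scaled h ω); noiseLaw R] := by
  have m1 := hW.measurable_increments h
  have e1 := variance_map (μ := μ) (X := F) (Y := increments W h) mF.aemeasurable m1.aemeasurable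
  have e2 := variance_map (μ := noiseLaw R) (X := F) (Y := scaled h) mF.aemeasurable
    (measurable_scaled h).aemeasurable
  rw [hW.map_increments hR hh] at e1
  exact e1.symm.trans e2

end Law

/-! ### Measurability of the paths and the strong error for real exponents. -/

section PathMeasurability

variable {d D : ℕ} {E : SDE d D} {M : ℕ} {K : ℝ}

namespace SDE.Admissible

variable (A : E.Admissible M K)
include A

theorem measurable_path {h : ℝ} {k : ℕ} (ht : ∀ j < k, (j : ℝ) * h ∈ Set.Icc 0 E.T) :
    Measurable fun w : ℕ → Vec D => E.path h w k := by
  induction k with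
  | zero => exact measurable_const
  | succ k ih =>
    have ih' := ih fun j hj => ht j (by omega)
    have hk := ht k (by omega)
    refine ih'.add (measurable_vec fun i => ?_)
    simp only [E.step_apply]
    refine Measurable.add (((((A.ha i).toLipCoef.continuous hk).measurable.comp ih').mul_const h))
      (Finset.measurable_sum _ fun α _ => ?_)
    exact (((A.hc i α).continuous hk).measurable.comp ih').mul
      ((E.measurable_noise h α).comp (measurable_pi_apply k))

theorem measurable_fine (N : ℕ+) {n : ℕ} (hn : n ≤ N) :
    Measurable fun w : ℕ → Vec D => E.fine M (E.mesh M N) w n :=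
  A.measurable_path fun _ hj => E.time_mem A.hT A.hM
    (hj.le.trans (Nat.mul_le_mul_right M hn))

theorem measurable_anti (N : ℕ+) {n : ℕ} (hn : n ≤ N) :
    Measurable fun w : ℕ → Vec D => E.anti M (E.mesh M N) w n :=
  (A.measurable_fine N hn).comp measurable_reverseBlocks

theorem measurable_coarse (N : ℕ+) {n : ℕ} (hn : n ≤ N) :
    Measurable fun w : ℕ → Vec D => E.coarse M (E.mesh M N) w n :=
  (A.measurable_path fun _ hj => E.coarse_time_mem A.hT A.hM (hj.le.trans hn)).comp
    (measurable_pi_lambda _ fun _ => Finset.measurable_sum _ fun _ _ => measurable_pi_apply _)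

theorem measurable_maxDev (N : ℕ+) (p : ℝ) :
    Measurable (E.maxDev M (E.mesh M N) p N) := by
  unfold SDE.maxDev
  refine Finset.measurable_range_sup'' fun n hn => ?_
  exact ((((A.measurable_fine N hn).add (A.measurable_anti N hn)).const_smul
    (1 / 2 : ℝ)).sub (A.measurable_coarse N hn)).norm.pow_const p

theorem maxDev_le (N : ℕ+) {p : ℝ} (hp : 0 ≤ p) (ω : ℕ → Vec D) :
    0 ≤ E.maxDev M (E.mesh M N) p N (scaled (E.mesh M N) ω) ∧
    E.maxDev M (E.mesh M N) p N (scaled (E.mesh M N) ω) ≤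
      (partialSups (fun n => ‖E.avgPt M N n ω - E.coarsePt M N n ω‖) (N : ℕ)) ^ p := by
  constructor
  · refine le_trans ?_ (Finset.le_sup' _ (Finset.mem_range.2 (Nat.succ_pos (N : ℕ))))
    positivity
  · refine Finset.sup'_le _ _ fun n hn => ?_
    refine Real.rpow_le_rpow (norm_nonneg _) ?_ hp
    exact le_partialSups_of_le (fun n => ‖E.avgPt M N n ω - E.coarsePt M N n ω‖)
      (Finset.mem_range_succ_iff.1 hn)

theorem integral_maxDev_le {p : ℝ} (hp : 0 ≤ p) : ∃ C : ℝ, ∀ N : ℕ+,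
    Integrable (fun ω => E.maxDev M (E.mesh M N) p N (scaled (E.mesh M N) ω)) (noiseLaw E.corr) ∧
    ∫ ω, E.maxDev M (E.mesh M N) p N (scaled (E.mesh M N) ω) ∂(noiseLaw E.corr) ≤
      C * (E.T / (N : ℕ)) ^ p := by
  obtain ⟨C, hC⟩ := A.bigO_avg_sub_coarse
  set q := ⌈p⌉₊ with hq
  refine ⟨(1 + C q) / E.T ^ p, fun N => ?_⟩
  have hT := A.hT
  have hN : (0 : ℝ) < (N : ℕ) := by exact_mod_cast N.pos
  set X : (ℕ → Vec D) → ℝ := fun ω =>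
    partialSups (fun n => ‖E.avgPt M N n ω - E.coarsePt M N n ω‖) (N : ℕ) with hX
  have hX0 : ∀ ω, 0 ≤ X ω := fun ω => (norm_nonneg _).trans
    (le_partialSups_of_le (fun n => ‖E.avgPt M N n ω - E.coarsePt M N n ω‖) (Nat.zero_le _))
  set s : ℝ := 1 / (N : ℕ) with hs
  have hs0 : 0 < s := by positivity
  -- The order bound concerns natural exponents; a real `p` is reached through `x ^ p ≤ 1 + x ^ ⌈p⌉`
  -- at the scale `s = 1 / N`.
  have hpt : ∀ ω, X ω ^ p ≤ s ^ p * (1 + X ω ^ q / s ^ q) := fun ω => by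
    have h0 : 0 ≤ X ω / s := div_nonneg (hX0 ω) hs0.le
    have h1 : (X ω / s) ^ p ≤ 1 + (X ω / s) ^ q := by
      rcases le_total (X ω / s) 1 with h | h
      · have := Real.rpow_le_one h0 h hp
        have : 0 ≤ (X ω / s) ^ q := by positivity
        linarith
      · have := Real.rpow_le_rpow_of_exponent_le h (Nat.le_ceil p)
        rw [Real.rpow_natCast] at this
        linarith
    rw [Real.div_rpow (hX0 ω) hs0.le, div_pow] at h1
    have h2 : 0 < s ^ p := by positivity
    rwa [div_le_iff₀ h2, mul_comm] at h1
  have hXm := (hC N).1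
  have iq : Integrable (fun ω => X ω ^ q) (noiseLaw E.corr) := by
    have : Integrable (fun ω => ‖X ω‖ ^ q) (noiseLaw E.corr) := hXm.2 q
    simpa only [Real.norm_of_nonneg (hX0 _)] using this
  have iq' : Integrable (fun ω => s ^ p * (1 + X ω ^ q / s ^ q)) (noiseLaw E.corr) :=
    ((integrable_const 1).add (iq.div_const _)).const_mul _
  have hle : ∀ ω, E.maxDev M (E.mesh M N) p N (scaled (E.mesh M N) ω) ≤
      s ^ p * (1 + X ω ^ q / s ^ q) := fun ω => (A.maxDev_le N hp ω).2.trans (hpt ω)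
  have hi : Integrable (fun ω => E.maxDev M (E.mesh M N) p N (scaled (E.mesh M N) ω))
      (noiseLaw E.corr) := iq'.mono'
    ((A.measurable_maxDev N p).comp (measurable_scaled _)).aestronglyMeasurable
    (Filter.Eventually.of_forall fun ω => by
      rw [Real.norm_of_nonneg (A.maxDev_le N hp ω).1]; exact hle ω)
  refine ⟨hi, (integral_mono hi iq' hle).trans ?_⟩
  rw [integral_const_mul, integral_add (integrable_const _) (iq.div_const _), integral_div]
  simp only [integral_const, probReal_univ, smul_eq_mul, one_mul]
  have h3 : ∫ ω, X ω ^ q ∂(noiseLaw E.corr) ≤ C q * s ^ q := by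
    have : ∫ ω, ‖X ω‖ ^ q ∂(noiseLaw E.corr) ≤ C q * (rootMesh N ^ 2) ^ q := (hC N).2 q
    rw [rootMesh_sq] at this
    simpa only [Real.norm_of_nonneg (hX0 _)] using this
  have h4 : (∫ ω, X ω ^ q ∂(noiseLaw E.corr)) / s ^ q ≤ C q := (div_le_iff₀ (by positivity)).2 h3
  calc s ^ p * (1 + (∫ ω, X ω ^ q ∂(noiseLaw E.corr)) / s ^ q) ≤ s ^ p * (1 + C q) := by gcongr
    _ = _ := by
      have e : s ^ p = (E.T / (N : ℕ)) ^ p / E.T ^ p := by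
        rw [← Real.div_rpow (by positivity) hT.le, hs]
        congr 1
        field_simp
      rw [e]; ring

end SDE.Admissible

end PathMeasurability

/-! ### Level corrections: variance and telescoping expectations. -/

section Levels

variable {d D : ℕ} {E : SDE d D} {M : ℕ} {K : ℝ}

theorem SDE.h_nonneg (hT : 0 < E.T) (l : ℕ) : 0 ≤ E.h M l := by
  unfold SDE.h; positivity

theorem SDE.h_pos (hT : 0 < E.T) (hM : 1 ≤ M) (l : ℕ) : 0 < E.h M l := by
  have : (0 : ℝ) < M := by positivity
  unfold SDE.h; positivity

theorem SDE.mul_h_succ (hM : 1 ≤ M) (l : ℕ) : M * E.h M (l + 1) = E.h M l := by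
  have : (M : ℝ) ≠ 0 := by positivity
  rw [SDE.h, SDE.h]
  field_simp
  ring

/-- The number of coarse time steps at level `l + 1`. -/
def levelSteps (hM : 1 ≤ M) (l : ℕ) : ℕ+ := ⟨M ^ l, Nat.pow_pos hM⟩

theorem SDE.mesh_levelSteps (hM : 1 ≤ M) (l : ℕ) : E.mesh M (levelSteps hM l) = E.h M (l + 1) := by
  simp only [SDE.mesh, levelSteps, SDE.h, PNat.mk_coe, Nat.cast_pow, pow_succ]

theorem SDE.level_time_mem (hT : 0 < E.T) (hM : 1 ≤ M) {l k : ℕ} (hk : k ≤ M ^ l) :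
    (k : ℝ) * E.h M l ∈ Set.Icc 0 E.T := by
  have h1 : (0 : ℝ) < (M : ℝ) ^ l := by positivity
  refine ⟨mul_nonneg (Nat.cast_nonneg _) (E.h_nonneg hT l), ?_⟩
  rw [SDE.h, ← mul_div_assoc, div_le_iff₀ h1, mul_comm]
  exact mul_le_mul_of_nonneg_left (by exact_mod_cast hk) hT.le

theorem HasTwoBoundedDerivs.lip {B : ℝ} {P : Vec d → ℝ} (hP : HasTwoBoundedDerivs B P)
    (x y : Vec d) : |P x - P y| ≤ B * ‖x - y‖ :=
  abs_sub_le_of_norm_fderiv_le (hP.1.differentiable (by norm_num)) (fun z => (hP.2 z).1) x y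

theorem HasTwoBoundedDerivs.nonneg {B : ℝ} {P : Vec d → ℝ} (hP : HasTwoBoundedDerivs B P) :
    0 ≤ B := (norm_nonneg _).trans (hP.2 0).1

theorem HasTwoBoundedDerivs.measurable {B : ℝ} {P : Vec d → ℝ} (hP : HasTwoBoundedDerivs B P) :
    Measurable P := hP.1.continuous.measurable

theorem HasTwoBoundedDerivs.allMoments {B : ℝ} {P : Vec d → ℝ} (hP : HasTwoBoundedDerivs B P)
    {Ω : Type*} [MeasurableSpace Ω] {μ : Measure Ω} [IsProbabilityMeasure μ] {y : Ω → Vec d}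
    (hy : AllMoments μ y) : AllMoments μ fun ω => P (y ω) := by
  refine ((allMoments_const (|P 0|)).add (hy.norm.const_mul B)).of_le
    (hP.measurable.comp hy.1) 1 fun ω => ?_
  have h1 := hP.lip (y ω) 0
  have h2 := abs_sub_abs_le_abs_sub (P (y ω)) (P 0)
  rw [sub_zero] at h1
  rw [one_mul, Real.norm_eq_abs]
  refine le_trans ?_ (le_abs_self _)
  linarith

namespace SDE.Admissible

variable (A : E.Admissible M K)
include A

variable {B : ℝ} {P : Vec d → ℝ} (hP : HasTwoBoundedDerivs B P)
include hP

/-- The value of `P` at the midpoint of the two fine paths is inserted. The midpoint defect is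
quadratic in their distance, of order 1 + 1; the rest is Lipschitz in the deviation of the average
from the coarse path, of order 2. -/
theorem bigO_payoff_correction : BigO (noiseLaw E.corr) rootMesh 2 (fun N ω =>
    (P (E.finePt M N N 0 ω) + P (E.finePt M N N 0 (reverseBlocks M ω))) / 2 -
      P (E.coarsePt M N N ω)) := by
  have hη : ∀ N, 0 ≤ rootMesh N := fun N => (rootMesh_pos N).le
  have h1 := A.bigO_fine_sub_coarse.add A.bigO_anti_sub_coarse
  have h2 := (BigO.mul (r := 1) (s := 1) rootMesh_pos h1 h1).add A.bigO_avg_sub_coarse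
  refine h2.of_le hη (fun N => ?_) B fun N ω => ?_
  · have m1 := hP.measurable.comp (A.allMoments_finePt_zero N le_rfl).1
    exact ((m1.add (m1.comp A.measurePreserving_rev.measurable)).div_const 2).sub
      (hP.measurable.comp (A.allMoments_coarsePt N le_rfl).1)
  · have hB := hP.nonneg
    set F := E.finePt M N N 0 ω
    set G := E.finePt M N N 0 (reverseBlocks M ω)
    set c := E.coarsePt M N N ω
    have e1 : ‖F - c‖ ≤ partialSups (fun n => ‖E.finePt M N n 0 ω - E.coarsePt M N n ω‖) (N : ℕ) :=
      le_partialSups_of_le (fun n => ‖E.finePt M N n 0 ω - E.coarsePt M N n ω‖) le_rfl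
    have e2 : ‖G - c‖ ≤ partialSups (fun n => ‖E.finePt M N n 0 (reverseBlocks M ω) -
        E.coarsePt M N n ω‖) (N : ℕ) :=
      le_partialSups_of_le (fun n => ‖E.finePt M N n 0 (reverseBlocks M ω) -
        E.coarsePt M N n ω‖) le_rfl
    have e3 : ‖(1 / 2 : ℝ) • (F + G) - c‖ ≤
        partialSups (fun n => ‖E.avgPt M N n ω - E.coarsePt M N n ω‖) (N : ℕ) :=
      le_partialSups_of_le (fun n => ‖E.avgPt M N n ω - E.coarsePt M N n ω‖) le_rfl
    set s1 := partialSups (fun n => ‖E.finePt M N n 0 ω - E.coarsePt M N n ω‖) (N : ℕ)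
    set s2 := partialSups (fun n => ‖E.finePt M N n 0 (reverseBlocks M ω) -
      E.coarsePt M N n ω‖) (N : ℕ)
    set s3 := partialSups (fun n => ‖E.avgPt M N n ω - E.coarsePt M N n ω‖) (N : ℕ)
    have e4 : ‖F - G‖ ≤ s1 + s2 := by
      have : F - G = (F - c) - (G - c) := by abel
      rw [this]
      exact (norm_sub_le _ _).trans (add_le_add e1 e2)
    have e5 := abs_midpoint_le_of_taylor hP.taylor F G
    have e6 := hP.lip ((1 / 2 : ℝ) • (F + G)) c
    have e7 : ‖F - G‖ ^ 2 ≤ (s1 + s2) * (s1 + s2) := by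
      rw [← sq]; exact pow_le_pow_left₀ (norm_nonneg _) e4 2
    rw [Real.norm_eq_abs]
    calc |(P F + P G) / 2 - P c| ≤ |(P F + P G) / 2 - P ((1 / 2 : ℝ) • (F + G))| +
          |P ((1 / 2 : ℝ) • (F + G)) - P c| := abs_sub_le _ _ _
      _ ≤ B * ((s1 + s2) * (s1 + s2)) + B * s3 := by
          refine add_le_add (e5.trans ?_) (e6.trans ?_) <;> gcongr
      _ = B * ((s1 + s2) * (s1 + s2) + s3) := by ring
      _ ≤ _ := mul_le_mul_of_nonneg_left (le_abs_self _) hB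

theorem measurable_payoff_path (l : ℕ) :
    Measurable fun w : ℕ → Vec D => P (E.path (E.h M l) w (M ^ l)) :=
  hP.measurable.comp (A.measurable_path fun _ hj => E.level_time_mem A.hT A.hM hj.le)

theorem allMoments_payoff_path (l : ℕ) : AllMoments (noiseLaw E.corr) fun ω =>
    P (E.path (E.h M l) (scaled (E.h M l) ω) (M ^ l)) := by
  refine hP.allMoments (E.allMoments_path (fun i => (A.ha i).toLipCoef) A.hc (n := M ^ l)
    (fun k hk => E.level_time_mem A.hT A.hM hk.le) (fun k _ => ?_) le_rfl)
  exact (allMoments_eval k).of_le (by unfold scaled; fun_prop) (Real.sqrt (E.h M l)) fun ω => by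
    rw [scaled, norm_smul, Real.norm_of_nonneg (Real.sqrt_nonneg _)]

theorem measurable_correction (l : ℕ) : Measurable (E.correction M P l) := by
  cases l with
  | zero =>
    have := A.measurable_payoff_path hP 0
    rw [pow_zero] at this
    exact this
  | succ l =>
    have h1 := A.measurable_fine (levelSteps A.hM l) le_rfl
    have h2 := A.measurable_anti (levelSteps A.hM l) le_rfl
    have h3 := A.measurable_coarse (levelSteps A.hM l) le_rfl
    rw [E.mesh_levelSteps] at h1 h2 h3
    exact (((hP.measurable.comp h1).add (hP.measurable.comp h2)).div_const 2).sub
      (hP.measurable.comp h3)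

theorem correction_succ_scaled (l : ℕ) (ω : ℕ → Vec D) :
    E.correction M P (l + 1) (scaled (E.h M (l + 1)) ω) =
      (P (E.finePt M (levelSteps A.hM l) (levelSteps A.hM l) 0 ω) +
        P (E.finePt M (levelSteps A.hM l) (levelSteps A.hM l) 0 (reverseBlocks M ω))) / 2 -
      P (E.coarsePt M (levelSteps A.hM l) (levelSteps A.hM l) ω) := by
  rw [← E.mesh_levelSteps A.hM]
  simp only [SDE.correction, ← E.mesh_levelSteps A.hM]
  rfl

theorem allMoments_correction (l : ℕ) : AllMoments (noiseLaw E.corr) fun ω =>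
    E.correction M P l (scaled (E.h M l) ω) := by
  cases l with
  | zero =>
    have := A.allMoments_payoff_path hP 0
    rw [pow_zero] at this
    exact this
  | succ l =>
    simp only [A.correction_succ_scaled hP]
    exact (A.bigO_payoff_correction hP).allMoments (levelSteps A.hM l)

theorem exists_variance_correction_le : ∃ C : ℝ, 0 ≤ C ∧ ∀ l,
    Var[fun ω => E.correction M P l (scaled (E.h M l) ω); noiseLaw E.corr] ≤ C * E.h M l ^ 2 := by
  obtain ⟨C, hC⟩ := A.bigO_payoff_correction hP
  have hT := A.hT
  set v0 := Var[fun ω => E.correction M P 0 (scaled (E.h M 0) ω); noiseLaw E.corr] with hv0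
  have hv0' : 0 ≤ v0 := variance_nonneg _ _
  -- The first summand covers level `0`, where `h = T`; in the second, `M / E.T` converts `1 / N`
  -- into the fine step. Including level `0` gives the cost analysis a single bound.
  refine ⟨v0 / E.T ^ 2 + |C 2| * (M / E.T) ^ 2, by positivity, fun l => ?_⟩
  cases l with
  | zero =>
    rw [← hv0]
    have : E.h M 0 = E.T := by simp [SDE.h]
    rw [this, add_mul, div_mul_cancel₀ _ (by positivity)]
    have : 0 ≤ |C 2| * (M / E.T) ^ 2 * E.T ^ 2 := by positivity
    linarith
  | succ l =>
    refine (variance_le_expectation_sq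
      (A.allMoments_correction hP (l + 1)).1.aestronglyMeasurable).trans ?_
    have h2 := (hC (levelSteps A.hM l)).2 2
    simp only [Real.norm_eq_abs, sq_abs, rootMesh_sq] at h2
    simp only [Pi.pow_apply, A.correction_succ_scaled hP]
    refine h2.trans ?_
    have e : (1 / ((levelSteps A.hM l : ℕ+) : ℕ) : ℝ) = M / E.T * E.h M (l + 1) := by
      have := E.mul_h_succ A.hM l
      rw [div_mul_eq_mul_div, this, SDE.h]
      simp only [levelSteps, PNat.mk_coe, Nat.cast_pow]
      field_simp
    rw [e, mul_pow, ← mul_assoc]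
    refine mul_le_mul_of_nonneg_right ?_ (by positivity)
    calc _ ≤ |C 2| * (M / E.T) ^ 2 := by gcongr; exact le_abs_self _
      _ ≤ _ := le_add_of_nonneg_left (by positivity)

section Brownian

variable {Ω : Type*} [MeasurableSpace Ω] {μ : Measure Ω} [IsProbabilityMeasure μ]
  {W : ℝ≥0 → Ω → Vec D} (hW : IsBrownian E.corr μ W)
include hW

theorem memLp_sample (l : ℕ) : MemLp (E.sample M P l W) 2 μ :=
  hW.memLp_increments A.hcorr (E.h_nonneg A.hT l) (A.measurable_correction hP l)
    (A.allMoments_correction hP l)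

theorem V_eq (l : ℕ) : E.V M P μ l W =
    Var[fun ω => E.correction M P l (scaled (E.h M l) ω); noiseLaw E.corr] :=
  hW.variance_increments A.hcorr (E.h_nonneg A.hT l) (A.measurable_correction hP l)

theorem integral_sample (l : ℕ) : ∫ ω, E.sample M P l W ω ∂μ =
    ∫ ω, E.correction M P l (scaled (E.h M l) ω) ∂(noiseLaw E.corr) :=
  hW.integral_increments A.hcorr (E.h_nonneg A.hT l) (A.measurable_correction hP l)

theorem integral_payoff (l : ℕ) : ∫ ω, E.payoff M P l W ω ∂μ =
    ∫ ω, P (E.path (E.h M l) (scaled (E.h M l) ω) (M ^ l)) ∂(noiseLaw E.corr) :=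
  hW.integral_increments A.hcorr (E.h_nonneg A.hT l) (A.measurable_payoff_path hP l)

end Brownian

end SDE.Admissible

/-- The coarse path of one level is thereby the scheme of the level below driven by the same
Brownian path. -/
theorem sumBlocks_increments {Ω : Type*} (W : ℝ≥0 → Ω → Vec D) (δ : ℝ) (ω : Ω) :
    sumBlocks M (increments W δ ω) = increments W (M * δ) ω := by
  funext n
  have := Finset.sum_range_sub (fun m : ℕ => W (((n * M + m : ℕ) : ℝ) * δ).toNNReal ω) M
  have e1 : (((n * M + M : ℕ) : ℝ) * δ) = ((n : ℝ) + 1) * (M * δ) := by push_cast; ring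
  have e2 : (((n * M + 0 : ℕ) : ℝ) * δ) = (n : ℝ) * (M * δ) := by push_cast; ring
  rw [e1, e2] at this
  rw [increments, ← this, sumBlocks]
  refine Finset.sum_congr rfl fun m _ => ?_
  simp only [increments]
  push_cast
  ring_nf

namespace SDE.Admissible

variable (A : E.Admissible M K)
include A

variable {B : ℝ} {P : Vec d → ℝ} (hP : HasTwoBoundedDerivs B P)
include hP

variable {Ω : Type*} [MeasurableSpace Ω] {μ : Measure Ω} [IsProbabilityMeasure μ]
  {W : ℝ≥0 → Ω → Vec D} (hW : IsBrownian E.corr μ W)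
include hW

theorem integral_correction_zero :
    ∫ ω, E.correction M P 0 (scaled (E.h M 0) ω) ∂(noiseLaw E.corr) =
      ∫ ω, E.payoff M P 0 W ω ∂μ := by
  rw [A.integral_payoff hP hW]
  simp only [pow_zero]
  rfl

/-- The expectations of the corrections telescope. -/
theorem integral_correction_succ (l : ℕ) :
    ∫ ω, E.correction M P (l + 1) (scaled (E.h M (l + 1)) ω) ∂(noiseLaw E.corr) =
      ∫ ω, E.payoff M P (l + 1) W ω ∂μ - ∫ ω, E.payoff M P l W ω ∂μ := by
  have hrev := A.measurePreserving_rev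
  have hF := A.allMoments_payoff_path hP (l + 1)
  have hcoarse : ∫ ω, P (E.coarse M (E.h M (l + 1)) (scaled (E.h M (l + 1)) ω) (M ^ l))
      ∂(noiseLaw E.corr) = ∫ ω, E.payoff M P l W ω ∂μ := by
    have m := A.measurable_coarse (levelSteps A.hM l) le_rfl
    rw [E.mesh_levelSteps] at m
    have := hW.integral_increments A.hcorr (E.h_nonneg A.hT (M := M) (l + 1))
      (hP.measurable.comp m)
    refine this.symm.trans (integral_congr_ae (Filter.Eventually.of_forall fun ω => ?_))
    simp only [Function.comp_apply, SDE.coarse, SDE.payoff, sumBlocks_increments,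
      E.mul_h_succ A.hM, levelSteps, PNat.mk_coe]
  -- The antithetic path has the law of the fine path, so averaging the two payoffs does not alter
  -- the expectation.
  have hanti : ∫ ω, P (E.anti M (E.h M (l + 1)) (scaled (E.h M (l + 1)) ω) (M ^ l))
      ∂(noiseLaw E.corr) =
      ∫ ω, P (E.path (E.h M (l + 1)) (scaled (E.h M (l + 1)) ω) (M ^ (l + 1)))
        ∂(noiseLaw E.corr) := by
    conv_rhs => rw [← hrev.map_eq, integral_map hrev.measurable.aemeasurable
      (by rw [hrev.map_eq]; exact hF.1.aestronglyMeasurable)]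
    rfl
  have iA : Integrable (fun ω => P (E.anti M (E.h M (l + 1)) (scaled (E.h M (l + 1)) ω) (M ^ l)))
      (noiseLaw E.corr) := (hF.comp hrev).integrable
  have iF : Integrable (fun ω => P (E.fine M (E.h M (l + 1)) (scaled (E.h M (l + 1)) ω) (M ^ l)))
      (noiseLaw E.corr) := hF.integrable
  have ic : Integrable (fun ω => P (E.coarse M (E.h M (l + 1)) (scaled (E.h M (l + 1)) ω) (M ^ l)))
      (noiseLaw E.corr) := by
    have := (hP.allMoments (A.allMoments_coarsePt (levelSteps A.hM l) le_rfl)).integrable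
    simp only [SDE.coarsePt, E.mesh_levelSteps] at this
    exact this
  have iFA : Integrable (fun ω =>
      (P (E.fine M (E.h M (l + 1)) (scaled (E.h M (l + 1)) ω) (M ^ l)) +
        P (E.anti M (E.h M (l + 1)) (scaled (E.h M (l + 1)) ω) (M ^ l))) / 2) (noiseLaw E.corr) :=
    (iF.add iA).div_const 2
  simp only [SDE.correction]
  rw [integral_sub iFA ic, integral_div, integral_add iF iA, hanti, hcoarse,
    A.integral_payoff hP hW (l + 1)]
  simp only [SDE.fine, ← pow_succ]
  ring

theorem sum_integral_correction (L : ℕ) : ∑ l ∈ Finset.range (L + 1),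
    ∫ ω, E.correction M P l (scaled (E.h M l) ω) ∂(noiseLaw E.corr) =
      ∫ ω, E.payoff M P L W ω ∂μ := by
  induction L with
  | zero => simpa using A.integral_correction_zero hP hW
  | succ L ih =>
    rw [Finset.sum_range_succ, ih, A.integral_correction_succ hP hW]
    ring

end SDE.Admissible

end Levels

/-! ### Sample numbers, bias and cost. -/

section Complexity

variable {d D : ℕ} {E : SDE d D} {M : ℕ}

theorem SDE.numSamples_bounds (v : ℕ → ℝ) (ε : ℝ) (L l : ℕ) :
    (1 : ℝ) ≤ E.numSamples M v ε L l ∧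
    2 / ε ^ 2 * Real.sqrt (v l * E.h M l) *
      ∑ k ∈ Finset.range (L + 1), Real.sqrt (v k / E.h M k) ≤ E.numSamples M v ε L l ∧
    (E.numSamples M v ε L l : ℝ) ≤ 1 + 2 / ε ^ 2 * Real.sqrt (v l * E.h M l) *
      ∑ k ∈ Finset.range (L + 1), Real.sqrt (v k / E.h M k) := by
  set x := 2 / ε ^ 2 * Real.sqrt (v l * E.h M l) *
    ∑ k ∈ Finset.range (L + 1), Real.sqrt (v k / E.h M k) with hx
  have hx0 : 0 ≤ x := by positivity
  have e : E.numSamples M v ε L l = max 1 ⌈x⌉₊ := rfl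
  rw [e, Nat.cast_max, Nat.cast_one]
  refine ⟨le_max_left _ _, (Nat.le_ceil x).trans (le_max_right _ _), max_le (by linarith) ?_⟩
  linarith [Nat.ceil_lt_add_one hx0]

/-- With the optimal sample numbers the variance of the estimator is at most `ε² / 2`. -/
theorem SDE.sum_variance_le (hT : 0 < E.T) (hM : 1 ≤ M) {v : ℕ → ℝ} (hv : ∀ l, 0 ≤ v l) {ε : ℝ}
    (hε : 0 < ε) (L : ℕ) :
    ∑ l ∈ Finset.range (L + 1), v l / (E.numSamples M v ε L l : ℝ) ≤ ε ^ 2 / 2 := by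
  set S := ∑ k ∈ Finset.range (L + 1), Real.sqrt (v k / E.h M k) with hS
  have hS0 : 0 ≤ S := Finset.sum_nonneg fun k _ => Real.sqrt_nonneg _
  have hle : ∀ l ∈ Finset.range (L + 1), v l / (E.numSamples M v ε L l : ℝ) ≤
      ε ^ 2 / 2 * (Real.sqrt (v l / E.h M l) / S) := by
    intro l hl
    obtain ⟨h1, h2, -⟩ := E.numSamples_bounds (M := M) v ε L l
    have hh := E.h_pos hT hM l
    -- A positive variance at one level makes `S` positive; otherwise the term vanishes.
    rcases (hv l).eq_or_lt with h0 | h0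
    · rw [← h0]; simp
    · have hr : 0 < Real.sqrt (v l / E.h M l) := Real.sqrt_pos.2 (by positivity)
      have hSpos : 0 < S := hr.trans_le
        (Finset.single_le_sum (f := fun k => Real.sqrt (v k / E.h M k))
          (fun k _ => Real.sqrt_nonneg _) hl)
      -- In this form the first root cancels against the sample number, leaving a share `√(v l / h
      -- l) / S` of the budget `ε² / 2`.
      have e : v l = Real.sqrt (v l * E.h M l) * Real.sqrt (v l / E.h M l) := by
        rw [← Real.sqrt_mul (by positivity), mul_div_assoc', mul_assoc, mul_comm (E.h M l),
          ← mul_assoc, mul_div_assoc, div_self hh.ne', mul_one, Real.sqrt_mul_self h0.le]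
      rw [div_le_iff₀ (by linarith)]
      calc v l = ε ^ 2 / 2 * (Real.sqrt (v l / E.h M l) / S) *
            (2 / ε ^ 2 * Real.sqrt (v l * E.h M l) * S) := by
            conv_lhs => rw [e]
            field_simp
        _ ≤ _ := mul_le_mul_of_nonneg_left h2 (by positivity)
  refine (Finset.sum_le_sum hle).trans ?_
  rw [← Finset.mul_sum, ← Finset.sum_div, ← hS]
  exact mul_le_of_le_one_right (by positivity) (div_self_le_one S)

/-- The lower bound controls the bias and the upper bound the cost. Rounding up loses at most one
factor `M`; the `1` in the maximum is the case of a nonpositive logarithm, where the level is `0`.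
-/
theorem SDE.finestLevel_bounds (hT : 0 < E.T) (hM : 2 ≤ M) {c₁ ε : ℝ} (hc : 0 < c₁) (hε : 0 < ε) :
    Real.sqrt 2 * c₁ * E.T / ε ≤ (M : ℝ) ^ E.finestLevel M c₁ ε ∧
    (M : ℝ) ^ E.finestLevel M c₁ ε ≤ max 1 (Real.sqrt 2 * c₁ * E.T / ε * M) := by
  set y := Real.sqrt 2 * c₁ * E.T / ε with hy
  have hy0 : 0 < y := by positivity
  have hM1 : (1 : ℝ) < M := by exact_mod_cast hM
  have hM0 : (0 : ℝ) < M := by linarith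
  have hlog : 0 < Real.log M := Real.log_pos hM1
  have e : E.finestLevel M c₁ ε = ⌈Real.log y / Real.log M⌉₊ := rfl
  rw [e]
  set x := Real.log y / Real.log M with hx
  constructor
  · rw [← Real.log_le_log_iff hy0 (by positivity), Real.log_pow]
    exact (div_le_iff₀ hlog).1 (Nat.le_ceil x)
  · rcases le_or_gt x 0 with h | h
    · rw [Nat.ceil_eq_zero.2 h, pow_zero]
      exact le_max_left _ _
    · refine le_trans ?_ (le_max_right _ _)
      rw [← Real.log_le_log_iff (by positivity) (by positivity), Real.log_pow,
        Real.log_mul hy0.ne' hM0.ne']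
      have h1 := (Nat.ceil_lt_add_one h.le).le
      calc (⌈x⌉₊ : ℝ) * Real.log M ≤ (x + 1) * Real.log M := by gcongr
        _ = _ := by rw [add_mul, hx, div_mul_cancel₀ _ hlog.ne', one_mul]

theorem SDE.bias_sq_le (hT : 0 < E.T) (hM : 2 ≤ M) {c₁ ε : ℝ} (hc : 0 < c₁) (hε : 0 < ε) :
    (c₁ * E.h M (E.finestLevel M c₁ ε)) ^ 2 ≤ ε ^ 2 / 2 := by
  have h1 := (E.finestLevel_bounds hT hM hc hε).1
  set L := E.finestLevel M c₁ ε
  have hM0 : (0 : ℝ) < M := by positivity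
  have hp : (0 : ℝ) < (M : ℝ) ^ L := by positivity
  have h2 : Real.sqrt 2 * (c₁ * E.h M L) ≤ ε := by
    rw [SDE.h, ← mul_div_assoc, ← mul_div_assoc, div_le_iff₀ hp, ← mul_assoc, mul_comm ε]
    exact (div_le_iff₀ hε).1 h1
  have h0 : 0 ≤ Real.sqrt 2 * (c₁ * E.h M L) := by
    have := E.h_nonneg hT (M := M) L
    positivity
  have h3 := pow_le_pow_left₀ h0 h2 2
  rw [mul_pow, Real.sq_sqrt (by norm_num)] at h3
  linarith

theorem sum_range_pow_le (hM : 2 ≤ M) (L : ℕ) :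
    ∑ l ∈ Finset.range (L + 1), (M : ℝ) ^ l ≤ 2 * (M : ℝ) ^ L := by
  have hM' : (2 : ℝ) ≤ M := by exact_mod_cast hM
  induction L with
  | zero => simp
  | succ L ih =>
    rw [Finset.sum_range_succ]
    have : (0 : ℝ) ≤ (M : ℝ) ^ L := by positivity
    rw [pow_succ]
    nlinarith

theorem SDE.sum_sqrt_le (hT : 0 < E.T) (hM : 2 ≤ M) {v : ℕ → ℝ} {C : ℝ} (hC : 0 ≤ C)
    (hv : ∀ l, v l ≤ C * E.h M l ^ 2) (L : ℕ) :
    ∑ k ∈ Finset.range (L + 1), Real.sqrt (v k / E.h M k) ≤ 4 * Real.sqrt (C * E.T) := by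
  have hM' : (2 : ℝ) ≤ M := by exact_mod_cast hM
  -- The true ratio is `M ^ (-1/2)`; the rational bound `3 / 4` works since `1 / M ≤ 1 / 2 ≤ (3 / 4)
  -- ^ 2`, and its geometric series sums to `4`.
  have hk : ∀ k, Real.sqrt (v k / E.h M k) ≤ Real.sqrt (C * E.T) * (3 / 4) ^ k := fun k => by
    have hh := E.h_pos hT (by omega : 1 ≤ M) k
    rw [Real.sqrt_le_iff]
    refine ⟨by positivity, ?_⟩
    rw [mul_pow, Real.sq_sqrt (by positivity), ← pow_mul, mul_comm k 2, pow_mul]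
    calc v k / E.h M k ≤ C * E.h M k := by
          rw [div_le_iff₀ hh]
          exact (hv k).trans (le_of_eq (by ring))
      _ = C * E.T * (1 / M) ^ k := by rw [SDE.h, div_pow, one_pow]; ring
      _ ≤ C * E.T * ((3 / 4) ^ 2) ^ k := by
          gcongr
          rw [div_le_iff₀ (by linarith)]
          linarith
  refine (Finset.sum_le_sum fun k _ => hk k).trans ?_
  rw [← Finset.mul_sum, mul_comm]
  refine mul_le_mul_of_nonneg_right ?_ (Real.sqrt_nonneg _)
  rw [geom_sum_eq (by norm_num)]
  have h0 : (0 : ℝ) ≤ (3 / 4) ^ (L + 1) := by positivity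
  rw [div_le_iff_of_neg (by norm_num)]
  linarith

/-- The cost of the estimator with the optimal sample numbers. -/
theorem SDE.exists_cost_le (hT : 0 < E.T) (hM : 2 ≤ M) {C : ℝ} (hC : 0 ≤ C) {c₁ : ℝ}
    (hc : 0 < c₁) : ∃ K : ℝ, ∀ v : ℕ → ℝ, (∀ l, 0 ≤ v l) → (∀ l, v l ≤ C * E.h M l ^ 2) →
      ∀ ε : ℝ, 0 < ε → ε ≤ 1 →
      E.cost M (E.finestLevel M c₁ ε) (E.numSamples M v ε (E.finestLevel M c₁ ε)) ≤
        K * ε⁻¹ ^ 2 := by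
  -- The `3` bounds the cost `2 h⁻¹ + (M h)⁻¹` of a sample by `3 h⁻¹`. The first summand pays for at
  -- least one sample per level, where `∑ h_l⁻¹` is of the size of its last term; the second for the
  -- optimal sample numbers, whose cost is `2 ε⁻² S²` with `S² ≤ 16 C T`.
  refine ⟨3 * (2 * (1 + Real.sqrt 2 * c₁ * E.T * M) / E.T + 2 * (16 * (C * E.T))),
    fun v hv0 hv ε hε hε1 => ?_⟩
  have h1 := (E.finestLevel_bounds hT hM hc hε).2
  set L := E.finestLevel M c₁ ε
  have hM' : (2 : ℝ) ≤ M := by exact_mod_cast hM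
  have hM0 : (0 : ℝ) < M := by linarith
  have hh := fun l => E.h_pos hT (by omega : 1 ≤ M) l
  set S := ∑ k ∈ Finset.range (L + 1), Real.sqrt (v k / E.h M k) with hS
  have hS0 : 0 ≤ S := Finset.sum_nonneg fun k _ => Real.sqrt_nonneg _
  have hS1 : S ^ 2 ≤ 16 * (C * E.T) := by
    have := pow_le_pow_left₀ hS0 (E.sum_sqrt_le hT hM hC hv L) 2
    rw [mul_pow, Real.sq_sqrt (by positivity)] at this
    linarith
  have hi : 1 ≤ ε⁻¹ := (one_le_inv₀ hε).2 hε1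
  have hi2 : ε⁻¹ ≤ ε⁻¹ ^ 2 := le_self_pow₀ hi (by norm_num)
  have hML : (M : ℝ) ^ L ≤ (1 + Real.sqrt 2 * c₁ * E.T * M) * ε⁻¹ ^ 2 := by
    refine h1.trans (max_le ?_ ?_)
    · have : 0 ≤ Real.sqrt 2 * c₁ * E.T * M := by positivity
      nlinarith
    · have h2 : 0 ≤ Real.sqrt 2 * c₁ * E.T * M := by positivity
      calc Real.sqrt 2 * c₁ * E.T / ε * M = Real.sqrt 2 * c₁ * E.T * M * ε⁻¹ := by
            rw [div_eq_mul_inv]; ring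
        _ ≤ Real.sqrt 2 * c₁ * E.T * M * ε⁻¹ ^ 2 := by gcongr
        _ ≤ _ := by
            rw [add_mul]
            exact le_add_of_nonneg_left (by positivity)
  have hterm : ∀ l ∈ Finset.range (L + 1), (E.numSamples M v ε L l : ℝ) *
      (2 * (E.h M l)⁻¹ + (M * E.h M l)⁻¹) ≤
      3 * ((M : ℝ) ^ l / E.T + 2 * ε⁻¹ ^ 2 * Real.sqrt (v l / E.h M l) * S) := by
    intro l _
    obtain ⟨-, -, h2⟩ := E.numSamples_bounds (M := M) v ε L l
    have e1 : (M * E.h M l)⁻¹ ≤ (E.h M l)⁻¹ := inv_anti₀ (hh l)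
      (le_mul_of_one_le_left (hh l).le (by linarith))
    have e2 : Real.sqrt (v l * E.h M l) * (E.h M l)⁻¹ = Real.sqrt (v l / E.h M l) := by
      have : v l / E.h M l = v l * E.h M l / E.h M l ^ 2 := by
        have := (hh l).ne'
        field_simp
      rw [this, Real.sqrt_div' _ (by positivity), Real.sqrt_sq (hh l).le, div_eq_mul_inv]
    have e3 : (E.h M l)⁻¹ = (M : ℝ) ^ l / E.T := by rw [SDE.h, inv_div]
    have e4 : 0 ≤ (E.h M l)⁻¹ := (inv_pos.2 (hh l)).le
    calc _ ≤ (1 + 2 / ε ^ 2 * Real.sqrt (v l * E.h M l) * S) * (3 * (E.h M l)⁻¹) := by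
          refine mul_le_mul h2 (by linarith) ?_ (by positivity)
          have := (hh l).le
          positivity
      _ = 3 * ((E.h M l)⁻¹ + 2 / ε ^ 2 * (Real.sqrt (v l * E.h M l) * (E.h M l)⁻¹) * S) := by ring
      _ = _ := by rw [e2, e3, inv_pow, div_eq_mul_inv 2]
  refine (Finset.sum_le_sum hterm).trans ?_
  rw [← Finset.mul_sum, Finset.sum_add_distrib, ← Finset.sum_div, ← Finset.sum_mul,
    ← Finset.mul_sum, ← hS]
  have e5 := (sum_range_pow_le hM L).trans (mul_le_mul_of_nonneg_left hML (by norm_num))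
  calc _ ≤ 3 * (2 * ((1 + Real.sqrt 2 * c₁ * E.T * M) * ε⁻¹ ^ 2) / E.T +
        2 * ε⁻¹ ^ 2 * (16 * (C * E.T))) := by
        rw [mul_assoc (2 * ε⁻¹ ^ 2), ← sq]
        gcongr
    _ = _ := by ring

end Complexity

/-! ### Mean and variance of the multilevel estimator. -/

section Estimator

variable {d D : ℕ} {E : SDE d D} {M : ℕ} {K : ℝ}

namespace SDE.Admissible

variable (A : E.Admissible M K)
include A

variable {B : ℝ} {P : Vec d → ℝ} (hP : HasTwoBoundedDerivs B P)
include hP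

variable {Ω : Type*} [MeasurableSpace Ω] {μ : Measure Ω} [IsProbabilityMeasure μ]
  {W : ℕ → ℕ → ℝ≥0 → Ω → Vec D} (hW : ∀ l r, IsBrownian E.corr μ (W l r))
include hW

theorem memLp_estimator (L : ℕ) (N : ℕ → ℕ) : MemLp (E.estimator M P L N W) 2 μ :=
  memLp_finsetSum _ fun l _ => (memLp_finsetSum _ fun r _ =>
    A.memLp_sample hP (hW l r) l).const_mul _

theorem integral_estimator (L : ℕ) {N : ℕ → ℕ} (hN : ∀ l, 1 ≤ N l) :
    ∫ ω, E.estimator M P L N W ω ∂μ = ∫ ω, E.payoff M P L (W L 0) ω ∂μ := by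
  rw [← A.sum_integral_correction hP (hW L 0)]
  have hi : ∀ l r, Integrable (E.sample M P l (W l r)) μ := fun l r =>
    (A.memLp_sample hP (hW l r) l).integrable (by norm_num)
  unfold SDE.estimator
  rw [integral_finsetSum _ fun l _ => (integrable_finsetSum _ fun r _ => hi l r).const_mul _]
  refine Finset.sum_congr rfl fun l _ => ?_
  rw [integral_const_mul, integral_finsetSum _ fun r _ => hi l r]
  simp only [A.integral_sample hP (hW l _), Finset.sum_const, Finset.card_range, nsmul_eq_mul]
  have : (N l : ℝ) ≠ 0 := by have := hN l; positivity
  field_simp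

theorem variance_estimator (hind : iIndepFun (fun (i : ℕ × ℕ) ω t => W i.1 i.2 t ω) μ)
    (L : ℕ) {N : ℕ → ℕ} (hN : ∀ l, 1 ≤ N l) : Var[E.estimator M P L N W; μ] =
      ∑ l ∈ Finset.range (L + 1), E.V M P μ l (W l 0) / (N l : ℝ) := by
  set X : (Σ _ : ℕ, ℕ) → Ω → ℝ := fun i ω => 1 / (N i.1 : ℝ) * E.sample M P i.1 (W i.1 i.2) ω
  set s : Finset (Σ _ : ℕ, ℕ) := (Finset.range (L + 1)).sigma fun l => Finset.range (N l)
  have e : E.estimator M P L N W = ∑ i ∈ s, X i := by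
    funext ω
    rw [Finset.sum_apply, Finset.sum_sigma]
    exact Finset.sum_congr rfl fun l _ => Finset.mul_sum _ _ _
  -- The sample as a measurable function on the path space itself, so that independence of the paths
  -- passes to the samples.
  have hmeas : ∀ l, Measurable
      (E.sample M P l (fun (t : ℝ≥0) (y : ℝ≥0 → Vec D) => y t)) := fun l =>
    (A.measurable_correction hP l).comp (measurable_pi_lambda _ fun k =>
      (measurable_pi_apply _).sub (measurable_pi_apply _))
  have hindX : Set.Pairwise (s : Set (Σ _ : ℕ, ℕ)) fun i j => X i ⟂ᵢ[μ] X j := by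
    intro i _ j _ hij
    have hij' : (i.1, i.2) ≠ (j.1, j.2) := fun h => hij (by
      rw [Prod.mk.injEq] at h
      exact Sigma.ext h.1 (heq_of_eq h.2))
    exact (hind.indepFun hij').comp ((hmeas i.1).const_mul (1 / (N i.1 : ℝ)))
      ((hmeas j.1).const_mul (1 / (N j.1 : ℝ)))
  rw [e, IndepFun.variance_sum (fun i _ => (A.memLp_sample hP (hW i.1 i.2) i.1).const_mul _) hindX,
    Finset.sum_sigma]
  refine Finset.sum_congr rfl fun l _ => ?_
  have h1 : ∀ r, Var[X ⟨l, r⟩; μ] = (1 / (N l : ℝ)) ^ 2 * E.V M P μ l (W l 0) := fun r => by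
    rw [A.V_eq hP (hW l 0), ← A.V_eq hP (hW l r)]
    exact variance_const_mul _ _ _
  have : (N l : ℝ) ≠ 0 := by have := hN l; positivity
  simp only [h1, Finset.sum_const, Finset.card_range, nsmul_eq_mul]
  field_simp

/-- Decomposition into variance and squared bias; by telescoping, the bias is that of the finest
level alone. -/
theorem integral_estimator_sub_sq (hind : iIndepFun (fun (i : ℕ × ℕ) ω t => W i.1 i.2 t ω) μ)
    (L : ℕ) {N : ℕ → ℕ} (hN : ∀ l, 1 ≤ N l) (c : ℝ) :
    ∫ ω, (E.estimator M P L N W ω - c) ^ 2 ∂μ =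
      ∑ l ∈ Finset.range (L + 1), E.V M P μ l (W l 0) / (N l : ℝ) +
        (∫ ω, E.payoff M P L (W L 0) ω ∂μ - c) ^ 2 := by
  have hm := A.memLp_estimator hP hW L N
  have h1 := variance_sub_const hm.aestronglyMeasurable c
  have h2 := variance_eq_sub (hm.sub (memLp_const c))
  have h3 : ∫ ω, (E.estimator M P L N W ω - c) ∂μ = ∫ ω, E.payoff M P L (W L 0) ω ∂μ - c := by
    rw [integral_sub (hm.integrable (by norm_num)) (integrable_const c),
      A.integral_estimator hP hW L hN]
    simp
  rw [A.variance_estimator hP hW hind L hN] at h1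
  simp only [Pi.pow_apply, Pi.sub_apply, h3] at h2
  have h4 : Var[fun ω => E.estimator M P L N W ω - c; μ] =
    Var[E.estimator M P L N W - fun _ => c; μ] := rfl
  rw [← h1, h4, h2]
  ring

end SDE.Admissible

end Estimator

end MLMC

end

/-! ### The main theorem. -/

theorem mainTheorem3 {d D : ℕ} (E : MLMC.SDE d D) (hT : 0 < E.T) (hcorr : E.corr.PosSemidef)
    (hreg : E.Regular) (M : ℕ) (hM : 2 ≤ M) :
    -- strong difference of the averaged fine path and the coarse path, `N` coarse steps
    (∀ p : ℝ, 2 ≤ p → ∃ C : ℝ,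
      ∀ (Ω : Type*) [MeasurableSpace Ω] (μ : Measure Ω) [IsProbabilityMeasure μ]
        (W : ℝ≥0 → Ω → MLMC.Vec D), MLMC.IsBrownian E.corr μ W →
      ∀ N : ℕ, 1 ≤ N →
        Integrable (fun ω => E.maxDev M (E.T / (N * M)) p N
          (MLMC.increments W (E.T / (N * M)) ω)) μ ∧
        ∫ ω, E.maxDev M (E.T / (N * M)) p N (MLMC.increments W (E.T / (N * M)) ω) ∂μ
          ≤ C * (E.T / N) ^ p) ∧
    ∀ P : MLMC.Vec d → ℝ, (∃ B : ℝ, MLMC.HasTwoBoundedDerivs B P) →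
      -- variance of the level corrections
      (∃ C : ℝ,
        ∀ (Ω : Type*) [MeasurableSpace Ω] (μ : Measure Ω) [IsProbabilityMeasure μ]
          (W : ℝ≥0 → Ω → MLMC.Vec D), MLMC.IsBrownian E.corr μ W →
        ∀ l : ℕ, 1 ≤ l →
          MemLp (E.sample M P l W) 2 μ ∧ E.V M P μ l W ≤ C * E.h M l ^ 2) ∧
      -- cost of the multilevel estimator, for a scheme of weak order one with constant `c₁`
      ∀ c₁ : ℝ, 0 < c₁ → ∃ K : ℝ,
        ∀ (Ω : Type*) [MeasurableSpace Ω] (μ : Measure Ω) [IsProbabilityMeasure μ]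
          (W : ℕ → ℕ → ℝ≥0 → Ω → MLMC.Vec D),
          (∀ l r, MLMC.IsBrownian E.corr μ (W l r)) →
          iIndepFun (fun (i : ℕ × ℕ) ω t => W i.1 i.2 t ω) μ →
        ∀ (Ω' : Type*) [MeasurableSpace Ω'] (μ' : Measure Ω') [IsProbabilityMeasure μ']
          (S : ℝ → Ω' → MLMC.Vec d), E.IsSolution μ' S →
          (∀ l : ℕ, |∫ ω, E.payoff M P l (W l 0) ω ∂μ - ∫ ω, P (S E.T ω) ∂μ'| ≤ c₁ * E.h M l) →
        ∀ ε : ℝ, 0 < ε → ε ≤ 1 →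
          MemLp (E.estimator M P (E.finestLevel M c₁ ε) (E.samples M P c₁ ε μ W) W) 2 μ ∧
          ∫ ω, (E.estimator M P (E.finestLevel M c₁ ε) (E.samples M P c₁ ε μ W) W ω
              - ∫ ω', P (S E.T ω') ∂μ') ^ 2 ∂μ ≤ ε ^ 2 ∧
          E.cost M (E.finestLevel M c₁ ε) (E.samples M P c₁ ε μ W) ≤ K * ε⁻¹ ^ 2 := by
  obtain ⟨K, hK, ha, hb, hc⟩ := hreg.exists_bound hT
  have hM1 : 1 ≤ M := by omega
  have A : E.Admissible M K := ⟨hT, hcorr, hM1, hK, ha, hb, hc⟩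
  refine ⟨fun p hp => ?_, ?_⟩
  · have hp0 : 0 ≤ p := by linarith
    obtain ⟨C, hC⟩ := A.integral_maxDev_le hp0
    refine ⟨C, fun Ω _ μ _ W hW N hN => ?_⟩
    have h := hC ⟨N, hN⟩
    have m := A.measurable_maxDev ⟨N, hN⟩ p
    have hh := E.mesh_nonneg hT (M := M) ⟨N, hN⟩
    refine ⟨hW.integrable_increments hcorr hh m h.1, ?_⟩
    exact (hW.integral_increments hcorr hh m).trans_le h.2
  · rintro P ⟨B, hP⟩
    obtain ⟨C, hC0, hC⟩ := A.exists_variance_correction_le hP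
    refine ⟨⟨C, fun Ω _ μ _ W hW l _ => ⟨A.memLp_sample hP hW l, ?_⟩⟩, fun c₁ hc₁ => ?_⟩
    · rw [A.V_eq hP hW]
      exact hC l
    obtain ⟨K', hK'⟩ := E.exists_cost_le hT hM hC0 hc₁
    refine ⟨K', fun Ω _ μ _ W hW hind Ω' _ μ' _ S _ hweak ε hε hε1 => ⟨A.memLp_estimator hP hW _ _,
      ?_, hK' (fun l => E.V M P μ l (W l 0)) (fun l => variance_nonneg _ _) (fun l => ?_) ε hε hε1⟩⟩
    · have hN : ∀ l, 1 ≤ E.samples M P c₁ ε μ W l := fun l => le_max_left _ _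
      rw [A.integral_estimator_sub_sq hP hW hind _ hN]
      -- Variance and squared bias each take half of `ε²`.
      have h1 := E.sum_variance_le hT hM1 (v := fun l => E.V M P μ l (W l 0))
        (fun l => variance_nonneg _ _) hε (E.finestLevel M c₁ ε)
      have h2 := E.bias_sq_le hT hM hc₁ hε
      have h3 := pow_le_pow_left₀ (abs_nonneg _) (hweak (E.finestLevel M c₁ ε)) 2
      rw [sq_abs] at h3
      exact (add_le_add h1 (h3.trans h2)).trans (le_of_eq (by ring))
    · rw [A.V_eq hP (hW l 0)]
      exact hC l
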